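/- Let $n\ge 1$ and $m\ge 0$ be integers, let $\nu\in\mathbb C$ with $\operatorname{Re}\nu>0$, and let $p>1+\frac{m+2}{n}$. Let $f:\mathbb C\to\mathbb C$ satisfy $f(0)=0$ and, for some $K>0$, $$|f(\xi)-f(\eta)|\le K\left(|\xi|^{p-1}+|\eta|^{p-1}\right)|\xi-\eta|\qquad\text{for all }\xi,\eta\in\mathbb C.$$ For a multi-index $\alpha\in\mathbb Z_{\ge0}^n$ write $|\alpha|=\sum_j\alpha_j$, $\alpha!=\prod_j\alpha_j!$, $x^\alpha=\prod_j x_j^{\alpha_j}$. Write $L^q=L^q(\mathbb R^n;\mathbb C)$ with norm $\|\cdot\|_q$, and let $L^1_m$ be the set of $\varphi\in L^1$ with $x^\alpha\varphi\in L^1$ for all $|\alpha|\le m$. For $\operatorname{Re}z>0$ let $G_z(x)=(4\pi z)^{-n/2}\exp\left(-\frac{|x|^2}{4z}\right)$ (principal branch), and let $e^{t\nu\Delta}\varphi=G_{t\nu}*\varphi$ for $t>0$, $e^{0\nu\Delta}\varphi=\varphi$. Let $u_0\in L^1_m\cap L^\infty$ and let $u$ be a global mild solution of $\partial_tu-\nu\Delta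 u=f(u)$, $u(0)=u_0$; that is, $u$ is bounded and continuous from $[0,\infty)$ to $L^1$ and from $(0,\infty)$ to $L^\infty$, and $$u(t)=e^{t\nu\Delta}u_0+\int_0^te^{(t-s)\nu\Delta}f(u(s))\,ds\qquad\text{in }L^1\cap L^\infty\text{ for all }t>0.$$ Assume that $$\sup_{q\in[1,\infty]}\ \sup_{t>0}\ t^{\frac n2\left(1-\frac1q\right)}\|u(t)\|_q<\infty .$$ For $t>0$ and multi-indices $\alpha,\beta$ put $$\mathcal M_\beta(\varphi)=\frac1{\beta!}\int_{\mathbb R^n}y^\beta\varphi(y)\,dy,\qquad (\delta_t\varphi)(x)=t^{-\frac n2}\varphi\left(t^{-\frac12}x\right),$$ $$\mathbf h_{\nu,\alpha}(x)=\sum_{2\beta\le\alpha}\frac{(-1)^{|\beta|}\alpha!}{\beta!\,(\alpha-2\beta)!}\,\nu^{-|\alpha-\beta|}x^{\alpha-2\beta},\qquad \psi_k=\int_0^\infty s^kf(u(s))\,ds,$$ $$\Lambda_{\alpha,N}(t;\varphi)=(-2)^{-|\alpha|}t^{-\frac{|\alpha|}2}\sum_{k=0}^N2^{-k}t^{-\frac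 k2}\sum_{|\beta|=k}\mathcal M_\beta(\varphi)\,\delta_t\left(\mathbf h_{\nu,\alpha+\beta}G_\nu\right),$$ $$\mathcal A_m(t)=\Lambda_{0,m}(t;u_0)+\sum_{|\gamma|\le m/2}\frac{(-\nu)^{|\gamma|}}{\gamma!}\,\Lambda_{2\gamma,\,m-2|\gamma|}\left(t;\psi_{|\gamma|}\right).$$ Then $\mathcal A_m(t)$ is well defined: for every integer $k$ with $0\le k\le m/2$ the integral $\psi_k$ converges absolutely in $L^1$ and $\psi_k\in L^1_{m-2k}$. Moreover, for every $q\in[1,\infty]$, $$\lim_{t\to+\infty}t^{\frac n2\left(1-\frac1q\right)+\frac m2}\,\|u(t)-\mathcal A_m(t)\|_q=0 .$$ -/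

import Mathlib

open MeasureTheory Filter Topology Set
open scoped ENNReal NNReal Convolution

noncomputable section

namespace CGL

/-- The Euclidean space `ℝⁿ`. -/
abbrev E (n : ℕ) : Type := EuclideanSpace ℝ (Fin n)

/-- The Banach space `L¹(ℝⁿ; ℂ)` of classes of functions modulo almost everywhere equality. -/
abbrev L1 (n : ℕ) : Type := Lp ℂ 1 (volume : Measure (E n))

section MultiIndex

variable {n : ℕ}

/-- Length `|α| = α₁ + ⋯ + αₙ` of a multi-index. -/
def length (α : Fin n → ℕ) : ℕ := ∑ j, α j

/-- `α! = α₁! ⋯ αₙ!`. -/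
def multiFactorial (α : Fin n → ℕ) : ℕ := ∏ j, (α j).factorial

/-- The monomial `x^α = x₁^α₁ ⋯ xₙ^αₙ`. -/
def monomial (α : Fin n → ℕ) (x : E n) : ℝ := ∏ j, x j ^ α j

/-- The multi-indices `β` with `|β| = k`. -/
def indicesEq (n k : ℕ) : Finset (Fin n → ℕ) :=
  (Finset.Iic (fun _ => k)).filter (fun β => length β = k)

/-- The multi-indices `γ` with `|γ| ≤ m / 2`. -/
def indicesHalf (n m : ℕ) : Finset (Fin n → ℕ) :=
  (Finset.Iic (fun _ => m)).filter (fun γ => 2 * length γ ≤ m)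

/-- The multi-indices `β` with `2 β ≤ α` componentwise. -/
def indicesTwoLe (α : Fin n → ℕ) : Finset (Fin n → ℕ) :=
  (Finset.Iic α).filter (fun β => ∀ j, 2 * β j ≤ α j)

theorem le_length (α : Fin n → ℕ) (j : Fin n) : α j ≤ length α :=
  Finset.single_le_sum (f := α) (fun _ _ => Nat.zero_le _) (Finset.mem_univ j)

theorem mem_indicesEq {k : ℕ} {β : Fin n → ℕ} : β ∈ indicesEq n k ↔ length β = k := by
  simp only [indicesEq, Finset.mem_filter, Finset.mem_Iic, and_iff_right_iff_imp]
  rintro rfl j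
  exact le_length β j

theorem mem_indicesHalf {m : ℕ} {γ : Fin n → ℕ} : γ ∈ indicesHalf n m ↔ 2 * length γ ≤ m := by
  simp only [indicesHalf, Finset.mem_filter, Finset.mem_Iic, and_iff_right_iff_imp]
  intro h j
  have := le_length γ j
  show γ j ≤ m
  omega

theorem mem_indicesTwoLe {α β : Fin n → ℕ} : β ∈ indicesTwoLe α ↔ ∀ j, 2 * β j ≤ α j := by
  simp only [indicesTwoLe, Finset.mem_filter, Finset.mem_Iic, and_iff_right_iff_imp]
  intro h j
  have := h j
  show β j ≤ α j
  omega

end MultiIndex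

section Equation

variable {n : ℕ}

/-- The weighted space `L¹_m(ℝⁿ)`: `φ ∈ L¹` and `x^α φ ∈ L¹` for all `|α| ≤ m`. -/
def MemWeightedL1 (m : ℕ) (φ : E n → ℂ) : Prop :=
  Integrable φ ∧ ∀ α : Fin n → ℕ, length α ≤ m → Integrable (fun x => (monomial α x : ℂ) * φ x)

/-- `f(0) = 0` and `|f(ξ) - f(η)| ≤ K (|ξ|^(p-1) + |η|^(p-1)) |ξ - η|` for some `K > 0`. -/
def IsPowerNonlinearity (p : ℝ) (f : ℂ → ℂ) : Prop :=
  f 0 = 0 ∧ ∃ K : ℝ, 0 < K ∧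
    ∀ ξ η : ℂ, ‖f ξ - f η‖ ≤ K * (‖ξ‖ ^ (p - 1) + ‖η‖ ^ (p - 1)) * ‖ξ - η‖

/-- The Gaussian `G_z(x) = (4πz)^(-n/2) exp(-|x|²/(4z))` for `Re z > 0`
(principal branch of the power). -/
def gaussian (z : ℂ) (x : E n) : ℂ :=
  (4 * (Real.pi : ℂ) * z) ^ (-(n : ℂ) / 2) * Complex.exp (-((‖x‖ ^ 2 : ℝ) : ℂ) / (4 * z))

/-- `e^{tνΔ} φ = G_{tν} ∗ φ` for `t > 0`, and `φ` for `t = 0`. -/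
def semigroup (ν : ℂ) (t : ℝ) (φ : E n → ℂ) : E n → ℂ :=
  if t = 0 then φ
  else gaussian ((t : ℂ) * ν) ⋆[ContinuousLinearMap.mul ℝ ℂ, volume] φ

open Classical in
/-- The class in `L¹(ℝⁿ)` of an integrable function. It is only used for functions that are
integrable; other functions are sent to `0`. -/
def toL1 (φ : E n → ℂ) : L1 n :=
  if h : MemLp φ 1 volume then h.toLp φ else 0

/-- The nonlinear term `f(u)` as an element of `L¹(ℝⁿ)`. It is integrable when
`u ∈ L¹ ∩ L^∞` and `f` is a power nonlinearity. -/
def nonlin (f : ℂ → ℂ) (v : L1 n) : L1 n := toL1 (fun x => f (v x))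

/-- The solution space
`X = (C ∩ L^∞)([0,∞); L¹(ℝⁿ)) ∩ (C ∩ L^∞)((0,∞); L^∞(ℝⁿ))`.
Only the values `u t` with `t ≥ 0` matter. -/
structure MemX (u : ℝ → L1 n) : Prop where
  continuousOn_L1 : ContinuousOn u (Ici 0)
  bounded_L1 : ∃ C : ℝ, ∀ t, 0 ≤ t → ‖u t‖ ≤ C
  memLp_top : ∀ t, 0 < t → MemLp (u t) ∞ volume
  continuous_top : ∀ t, 0 < t →
    Tendsto (fun s => eLpNorm (fun x => u s x - u t x) ∞ volume) (𝓝 t) (𝓝 0)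
  bounded_top : ∃ C : ℝ≥0, ∀ t, 0 < t → eLpNorm (u t) ∞ volume ≤ C

/-- Global mild solutions of `∂ₜu - νΔu = f(u)`, `u(0) = u₀`: a function `u ∈ X` with
`u(t) = e^{tνΔ}u₀ + ∫₀ᵗ e^{(t-s)νΔ} f(u(s)) ds` for all `t > 0`. The time integral is a
Bochner integral in `L¹(ℝⁿ)`. (Both sides are classes of functions modulo almost everywhere
equality, so equality in `L¹ ∩ L^∞` is the same as equality in `L¹`.) -/
structure IsGlobalSolution (ν : ℂ) (f : ℂ → ℂ) (u₀ : E n → ℂ) (u : ℝ → L1 n) : Prop where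
  memX : MemX u
  integral_eq : ∀ t, 0 < t →
    u t = toL1 (semigroup ν t u₀) + ∫ s in (0 : ℝ)..t, toL1 (semigroup ν (t - s) (nonlin f (u s)))

/-- The decay exponent `(n/2)(1 - 1/q)` for `q ∈ [1, ∞]` (with `1/∞ = 0`). -/
def decayExponent (n : ℕ) (q : ℝ≥0∞) : ℝ := (n : ℝ) / 2 * (1 - (q⁻¹).toReal)

/-- `sup_{q ∈ [1,∞]} sup_{t > 0} t^{(n/2)(1-1/q)} ‖u(t)‖_q < ∞`. -/
def Decays (u : ℝ → L1 n) : Prop :=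
  ∃ C : ℝ≥0, ∀ q : ℝ≥0∞, 1 ≤ q → ∀ t : ℝ, 0 < t →
    ENNReal.ofReal (t ^ decayExponent n q) * eLpNorm (u t) q volume ≤ C

end Equation

section Profiles

variable {n : ℕ}

/-- `M_β(φ) = (1/β!) ∫ y^β φ(y) dy`. -/
def moment (β : Fin n → ℕ) (φ : E n → ℂ) : ℂ :=
  (multiFactorial β : ℂ)⁻¹ * ∫ y, (monomial β y : ℂ) * φ y

/-- The Hermite polynomial
`h_{ν,α}(x) = ∑_{2β ≤ α} (-1)^|β| α! / (β! (α-2β)!) ν^{-|α-β|} x^{α-2β}`. -/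
def hermite (ν : ℂ) (α : Fin n → ℕ) (x : E n) : ℂ :=
  ∑ β ∈ indicesTwoLe α,
    (-1) ^ length β * (multiFactorial α : ℂ)
      / ((multiFactorial β : ℂ) * (multiFactorial (fun j => α j - 2 * β j) : ℂ))
      * (ν ^ length (fun j => α j - β j))⁻¹
      * (monomial (fun j => α j - 2 * β j) x : ℂ)

/-- `(δ_t φ)(x) = t^{-n/2} φ(t^{-1/2} x)`. -/
def dilation (t : ℝ) (φ : E n → ℂ) (x : E n) : ℂ :=
  ((t ^ (-(n : ℝ) / 2) : ℝ) : ℂ) * φ (t ^ (-(1 / 2) : ℝ) • x)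

/-- `Λ_{α,N}(t; φ) = (-2)^{-|α|} t^{-|α|/2}
  ∑_{k=0}^N 2^{-k} t^{-k/2} ∑_{|β|=k} M_β(φ) δ_t(h_{ν,α+β} G_ν)`. -/
def Lam (ν : ℂ) (α : Fin n → ℕ) (N : ℕ) (t : ℝ) (φ : E n → ℂ) (x : E n) : ℂ :=
  ((-2 : ℂ) ^ length α)⁻¹ * ((t ^ (-(length α : ℝ) / 2) : ℝ) : ℂ) *
    ∑ k ∈ Finset.range (N + 1), ((2 : ℂ) ^ k)⁻¹ * ((t ^ (-(k : ℝ) / 2) : ℝ) : ℂ) *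
      ∑ β ∈ indicesEq n k,
        moment β φ * dilation t (fun y => hermite ν (α + β) y * gaussian ν y) x

/-- The integrand `s^k f(u(s))` of `ψ_k`, with values in `L¹(ℝⁿ)`. -/
def psiIntegrand (f : ℂ → ℂ) (u : ℝ → L1 n) (k : ℕ) (s : ℝ) : L1 n :=
  (s ^ k) • nonlin f (u s)

/-- `ψ_k = ∫₀^∞ s^k f(u(s)) ds`, a Bochner integral in `L¹(ℝⁿ)`. -/
def psi (f : ℂ → ℂ) (u : ℝ → L1 n) (k : ℕ) : L1 n :=
  ∫ s in Ioi (0 : ℝ), psiIntegrand f u k s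

/-- `A_m(t) = Λ_{0,m}(t; u₀)
  + ∑_{|γ| ≤ m/2} ((-ν)^|γ| / γ!) Λ_{2γ, m-2|γ|}(t; ψ_{|γ|})`. -/
def profile (ν : ℂ) (f : ℂ → ℂ) (u₀ : E n → ℂ) (u : ℝ → L1 n) (m : ℕ) (t : ℝ) (x : E n) : ℂ :=
  Lam ν 0 m t u₀ x +
    ∑ γ ∈ indicesHalf n m,
      (-ν) ^ length γ / (multiFactorial γ : ℂ) *
        Lam ν (fun j => 2 * γ j) (m - 2 * length γ) t (psi f u (length γ)) x

end Profiles

end CGL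

end

/-!
Write `F(s) = f(u(s))` and `θ = (n/2)(p - 1)`. The condition on `p` is exactly `θ > m/2 + 1`. The
boundedness and the decay of `u` give `|F(s)| ≤ A (1 + s)^(-θ) |u(s)|` pointwise, so that `u` solves
a linear heat equation with a strongly damped source (`IsDampedMildSolution`,
`IsGlobalSolution.exists_isDamped`). The argument then rests on three facts.

*Weighted decay.* The weights `min(1 + |x|, R)^j` are moderate, and the heat semigroup grows at most
like `(1 + t)^(j/2)` in the corresponding weighted norms, uniformly in `R`. Since
`(1 + s)^(j/2 - θ)` is integrable for `j ≤ m`, Grönwall's inequality bounds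
`‖(1 + |x|)^j u(t)‖₁` by `C (1 + t)^(j/2)`, and hence `‖(1 + |x|)^j F(t)‖₁` by
`C (1 + t)^(j/2 - θ)` (`IsDampedMildSolution.exists_lintegral_weight_F_le`). Thus `s^k F(s)` is
Bochner integrable with weight `(1 + |x|)^(m - 2k)`; this is the well-definedness of the profile,
and it shows that the moments of `ψ_k` are the time integrals of those of `s^k F(s)`
(`IsDampedMildSolution.time_moment`).

*Taylor expansion of the kernel.* By scaling, the kernel `G_{(t-s)ν}(x - y)` is governed by
`G_{(1-σ)ν}(x - η)` with `σ = s/t`, `η = y/√t`. Along the parabolic curve `λ ↦ (λ²σ, λη)` this is a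
holomorphic function of `λ`. The Fourier representation of the Gaussian identifies its Taylor
coefficients with Hermite polynomials times `G_ν`; the polynomial of degree `m` is the kernel that
produces `𝒜_m` (`sum_heatSeriesCoeff`, `kerOp_remKer_eq`). Cauchy's estimates
on a disc of radius comparable to `1/(√σ + |η|)` bound the remainder by
`(√σ + |η|)^m min(1, √σ + |η|)` times a Gaussian when `√σ + |η|` is small, and the crude bound for
both terms gives the same when it is not, after cutting the kernel off at `σ < 1/2`
(`exists_heatRem_le`, `exists_scaledNorm_remKer_le`).

*Remainder formula.* Consequently `u(t) - 𝒜_m(t)` is the remainder kernel applied to `u₀`, plus the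
time integral over `(0, ∞)` of the remainder kernel applied to `F(s)`, plus the Duhamel integral over
`(t/2, t)` (`IsDampedMildSolution.eq_profile_add`). After multiplication by `t^(m/2)` the first two
tend to `0` by dominated convergence, because the factor `min(1, ·)` tends to `0` pointwise and the
weights are integrable, and the last is `O(t^(m/2 + 1 - θ))`.

All estimates are made in the norm `max(‖·‖₁, t^(n/2) ‖·‖_∞)` (`scaledNorm`), which controls
`t^((n/2)(1 - 1/q)) ‖·‖_q` for all `q` by interpolation (`decayExponent_mul_eLpNorm_le`).
-/

noncomputable section

namespace CGL

variable {n : ℕ}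

/-! ### Classes of integrable functions -/

theorem coeFn_toL1 {φ : E n → ℂ} (h : Integrable φ) : toL1 φ =ᵐ[volume] φ := by
  rw [toL1, dif_pos (memLp_one_iff_integrable.2 h)]
  exact MemLp.coeFn_toLp _

theorem toL1_congr {φ ψ : E n → ℂ} (h : φ =ᵐ[volume] ψ) : toL1 φ = toL1 ψ := by
  by_cases hφ : MemLp φ 1 volume
  · have hψ : MemLp ψ 1 volume := (memLp_congr_ae h).1 hφ
    rw [toL1, toL1, dif_pos hφ, dif_pos hψ]
    exact MemLp.toLp_congr _ _ h
  · have hψ : ¬ MemLp ψ 1 volume := fun hψ => hφ ((memLp_congr_ae h).2 hψ)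
    rw [toL1, toL1, dif_neg hφ, dif_neg hψ]

theorem integrable_coe (v : L1 n) : Integrable (fun x => v x) :=
  memLp_one_iff_integrable.1 (Lp.memLp v)

theorem toL1_coe (v : L1 n) : toL1 (fun x => v x) = v :=
  Lp.ext (coeFn_toL1 (integrable_coe v))

theorem toL1_add {φ ψ : E n → ℂ} (hφ : Integrable φ) (hψ : Integrable ψ) :
    toL1 (fun x => φ x + ψ x) = toL1 φ + toL1 ψ := by
  apply Lp.ext
  filter_upwards [coeFn_toL1 (hφ.add hψ), coeFn_toL1 hφ, coeFn_toL1 hψ,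
    Lp.coeFn_add (toL1 φ) (toL1 ψ)] with x h1 h2 h3 h4
  rw [h4, Pi.add_apply, h2, h3]
  exact h1

theorem toL1_smul (c : ℂ) {φ : E n → ℂ} (hφ : Integrable φ) :
    toL1 (fun x => c * φ x) = c • toL1 φ := by
  apply Lp.ext
  filter_upwards [coeFn_toL1 (hφ.const_mul c), coeFn_toL1 hφ,
    Lp.coeFn_smul c (toL1 φ)] with x h1 h2 h3
  rw [h3, Pi.smul_apply, h2, smul_eq_mul]
  exact h1

theorem toL1_sub {φ ψ : E n → ℂ} (hφ : Integrable φ) (hψ : Integrable ψ) :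
    toL1 (fun x => φ x - ψ x) = toL1 φ - toL1 ψ := by
  apply Lp.ext
  filter_upwards [coeFn_toL1 (hφ.sub hψ), coeFn_toL1 hφ, coeFn_toL1 hψ,
    Lp.coeFn_sub (toL1 φ) (toL1 ψ)] with x h1 h2 h3 h4
  rw [h4, Pi.sub_apply, h2, h3]
  exact h1

theorem toL1_zero : toL1 (fun _ : E n => (0 : ℂ)) = 0 := by
  have := toL1_smul (n := n) 0 (φ := fun _ => 0) (integrable_zero _ _ _)
  simpa using this

theorem toL1_sum {ι : Type*} (s : Finset ι) {φ : ι → E n → ℂ} (h : ∀ i ∈ s, Integrable (φ i)) :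
    toL1 (fun x => ∑ i ∈ s, φ i x) = ∑ i ∈ s, toL1 (φ i) := by
  classical
  induction s using Finset.induction_on with
  | empty => simpa using toL1_zero
  | insert a s ha ih =>
    have hs : ∀ i ∈ s, Integrable (φ i) := fun i hi => h i (Finset.mem_insert_of_mem hi)
    simp only [Finset.sum_insert ha]
    rw [toL1_add (h a (Finset.mem_insert_self a s)) (integrable_finsetSum _ hs), ih hs]

theorem enorm_eq_lintegral (v : L1 n) : ‖v‖ₑ = ∫⁻ x, ‖v x‖ₑ := by
  rw [Lp.enorm_def, eLpNorm_one_eq_lintegral_enorm]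

theorem enorm_toL1 {φ : E n → ℂ} (h : Integrable φ) : ‖toL1 φ‖ₑ = ∫⁻ x, ‖φ x‖ₑ := by
  rw [enorm_eq_lintegral]
  exact lintegral_congr_ae ((coeFn_toL1 h).mono fun x hx => by simp only [hx])

theorem integrable_bdd_mul {b φ : E n → ℂ} {C : ℝ} (hb : Measurable b) (hC : ∀ x, ‖b x‖ ≤ C)
    (hφ : Integrable φ) : Integrable (fun x => b x * φ x) :=
  hφ.bdd_mul hb.aestronglyMeasurable (Eventually.of_forall hC)

/-- Multiplication by a bounded measurable function, as a bounded operator on `L¹`. -/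
def mulL (b : E n → ℂ) (C : ℝ) (hb : Measurable b) (hC : ∀ x, ‖b x‖ ≤ C) : L1 n →L[ℂ] L1 n :=
  LinearMap.mkContinuous
    { toFun := fun v => toL1 (fun x => b x * v x)
      map_add' := fun v w => by
        rw [← toL1_add (integrable_bdd_mul hb hC (integrable_coe v))
          (integrable_bdd_mul hb hC (integrable_coe w))]
        apply toL1_congr
        filter_upwards [Lp.coeFn_add v w] with x hx
        rw [hx, Pi.add_apply, mul_add]
      map_smul' := fun c v => by
        rw [RingHom.id_apply, ← toL1_smul _ (integrable_bdd_mul hb hC (integrable_coe v))]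
        apply toL1_congr
        filter_upwards [Lp.coeFn_smul c v] with x hx
        rw [hx, Pi.smul_apply, smul_eq_mul]
        ring }
    C (fun v => by
      have hi := integrable_bdd_mul hb hC (integrable_coe v)
      refine Lp.norm_le_mul_norm_of_ae_le_mul ?_
      filter_upwards [coeFn_toL1 hi] with x hx
      simp only [LinearMap.coe_mk, AddHom.coe_mk]
      rw [hx, norm_mul]
      exact mul_le_mul_of_nonneg_right (hC x) (norm_nonneg _))

theorem mulL_apply {b : E n → ℂ} {C : ℝ} (hb : Measurable b) (hC : ∀ x, ‖b x‖ ≤ C) (v : L1 n) :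
    mulL b C hb hC v = toL1 (fun x => b x * v x) := rfl

theorem coeFn_mulL {b : E n → ℂ} {C : ℝ} (hb : Measurable b) (hC : ∀ x, ‖b x‖ ≤ C) (v : L1 n) :
    mulL b C hb hC v =ᵐ[volume] fun x => b x * v x :=
  coeFn_toL1 (integrable_bdd_mul hb hC (integrable_coe v))

/-- Pairing with a bounded measurable function commutes with Bochner integrals in `L¹`. -/
theorem integral_mul_integral {ι : Type*} [MeasurableSpace ι] {μ : Measure ι} {b : E n → ℂ} {C : ℝ}
    (hb : Measurable b) (hC : ∀ x, ‖b x‖ ≤ C) {F : ι → L1 n} (hF : Integrable F μ) :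
    Integrable (fun s => ∫ x, b x * F s x) μ ∧
    ∫ x, b x * (∫ s, F s ∂μ : L1 n) x = ∫ s, (∫ x, b x * F s x) ∂μ := by
  set L : L1 n →L[ℝ] ℂ :=
    L1.integralCLM.comp ((mulL b C hb hC).restrictScalars ℝ) with hL
  have key : ∀ v : L1 n, L v = ∫ x, b x * v x := by
    intro v
    have h1 : L v = L1.integral (mulL b C hb hC v) := by
      rw [L1.integral_eq]; rfl
    rw [h1, L1.integral_eq_integral]
    exact integral_congr_ae (coeFn_mulL hb hC v)
  refine ⟨?_, ?_⟩
  · simpa only [key] using L.integrable_comp hF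
  · have := L.integral_comp_comm hF
    simp only [key] at this
    exact this.symm

/-! ### The scaled norm -/

/-- A function all of whose averages over sets of finite measure are bounded by `C` is
essentially bounded by `C`. -/
theorem eLpNorm_top_le_of_setIntegral {g : E n → ℂ} (hg : Integrable g) {C : ℝ}
    (h : ∀ A : Set (E n), MeasurableSet A → volume A < ∞ →
      ‖∫ x in A, g x‖ ≤ C * volume.real A) :
    eLpNorm g ∞ volume ≤ ENNReal.ofReal C := by
  -- it suffices to bound `Re (c g)` for `c` in a countable dense subset of `ℂ`
  have h1 : ∀ c : ℂ, ∀ᵐ x, (c * g x).re ≤ ‖c‖ * C := by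
    intro c
    have hcg : Integrable (fun x => (c * g x).re) := (hg.const_mul c).re
    have hloc : ∀ s : Set (E n), MeasurableSet s → volume s < ∞ →
        0 ≤ ∫ x in s, (‖c‖ * C - (c * g x).re) := by
      intro s hs hsf
      have hconst : IntegrableOn (fun _ : E n => ‖c‖ * C) s := integrableOn_const hsf.ne
      have hre : ∫ x in s, (c * g x).re = (c * ∫ x in s, g x).re := by
        rw [← integral_const_mul]
        exact integral_re (hg.const_mul c).integrableOn
      rw [integral_sub hconst hcg.integrableOn, setIntegral_const, hre, sub_nonneg]
      calc (c * ∫ x in s, g x).re ≤ ‖c * ∫ x in s, g x‖ := Complex.re_le_norm _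
        _ = ‖c‖ * ‖∫ x in s, g x‖ := norm_mul _ _
        _ ≤ ‖c‖ * (C * volume.real s) := by gcongr; exact h s hs hsf
        _ = _ := by rw [smul_eq_mul]; ring
    have := ae_nonneg_of_forall_setIntegral_nonneg_of_sigmaFinite
      (μ := (volume : Measure (E n))) (f := fun x => ‖c‖ * C - (c * g x).re)
      (fun s hs hsf => by
        exact Integrable.sub (integrableOn_const hsf.ne) hcg.integrableOn) hloc
    filter_upwards [this] with x hx
    simpa using hx
  obtain ⟨D, hDc, hDd⟩ := TopologicalSpace.exists_countable_dense ℂ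
  have h2 : ∀ᵐ x, ∀ c ∈ D, (c * g x).re ≤ ‖c‖ * C := (ae_ball_iff hDc).2 fun c _ => h1 c
  rw [eLpNorm_exponent_top]
  have h3 : ∀ᵐ x, ‖g x‖ ≤ C := by
    filter_upwards [h2] with x hx
    have hall : ∀ c : ℂ, (c * g x).re ≤ ‖c‖ * C := by
      intro c
      have hcl : IsClosed {c : ℂ | (c * g x).re ≤ ‖c‖ * C} :=
        isClosed_le (by fun_prop) (by fun_prop)
      exact hDd.induction (P := fun c => (c * g x).re ≤ ‖c‖ * C) hx hcl c
    have h4 := hall (starRingEnd ℂ (g x))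
    rw [← Complex.normSq_eq_conj_mul_self, Complex.ofReal_re, Complex.normSq_eq_norm_sq,
      Complex.norm_conj] at h4
    rcases (norm_nonneg (g x)).eq_or_lt with h0 | h0
    · have h5 := hall 1
      have h6 : g x = 0 := norm_eq_zero.1 h0.symm
      simp [h6] at h5
      rw [← h0]; exact h5
    · nlinarith
  refine eLpNormEssSup_le_of_ae_bound h3

/-- Minkowski's inequality in `L^∞` for Bochner integrals taken in `L¹`. -/
theorem eLpNorm_top_integral_le {ι : Type*} [MeasurableSpace ι] {μ : Measure ι} {F : ι → L1 n}
    (hF : Integrable F μ) {c : ι → ℝ≥0∞} (hc : ∀ᵐ s ∂μ, eLpNorm (F s) ∞ volume ≤ c s) :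
    eLpNorm (∫ s, F s ∂μ : L1 n) ∞ volume ≤ ∫⁻ s, c s ∂μ := by
  rcases eq_or_ne (∫⁻ s, c s ∂μ) ∞ with htop | htop
  · rw [htop]; exact le_top
  rw [← ENNReal.ofReal_toReal htop]
  refine eLpNorm_top_le_of_setIntegral (integrable_coe _) fun A hA hAf => ?_
  have hb : Measurable (A.indicator fun _ : E n => (1 : ℂ)) := measurable_const.indicator hA
  have hC : ∀ x, ‖A.indicator (fun _ : E n => (1 : ℂ)) x‖ ≤ 1 := fun x => by
    refine (norm_indicator_le_norm_self _ _).trans (by simp)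
  have hind : ∀ v : E n → ℂ, (∫ x, A.indicator (fun _ : E n => (1 : ℂ)) x * v x)
      = ∫ x in A, v x := by
    intro v
    rw [← integral_indicator hA]
    congr 1
    ext x
    by_cases hx : x ∈ A <;> simp [hx]
  have h1 := (integral_mul_integral hb hC hF).2
  simp only [hind] at h1
  rw [h1, ← toReal_enorm]
  have h2 : ‖∫ s, (∫ x in A, F s x) ∂μ‖ₑ ≤ (∫⁻ s, c s ∂μ) * volume A := by
    calc ‖∫ s, (∫ x in A, F s x) ∂μ‖ₑ ≤ ∫⁻ s, ‖∫ x in A, F s x‖ₑ ∂μ :=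
          enorm_integral_le_lintegral_enorm _
      _ ≤ ∫⁻ s, c s * volume A ∂μ := by
          refine lintegral_mono_ae ?_
          filter_upwards [hc] with s hs
          calc ‖∫ x in A, F s x‖ₑ ≤ ∫⁻ x in A, ‖F s x‖ₑ := enorm_integral_le_lintegral_enorm _
            _ ≤ ∫⁻ x in A, c s := by
              refine lintegral_mono_ae (ae_restrict_of_ae ?_)
              filter_upwards [enorm_ae_le_eLpNormEssSup (F s) volume] with x hx
              exact hx.trans (by simpa using hs)
            _ = c s * volume A := by simp
      _ = _ := lintegral_mul_const' _ _ hAf.ne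
  calc _ ≤ ((∫⁻ s, c s ∂μ) * volume A).toReal :=
        ENNReal.toReal_mono (ENNReal.mul_ne_top htop hAf.ne) h2
    _ = _ := by rw [ENNReal.toReal_mul]; rfl

/-- The parabolically scaled norm `max (‖g‖₁, t^{n/2} ‖g‖_∞)`. By interpolation it controls
`t^{(n/2)(1-1/q)} ‖g‖_q` for every `q ∈ [1, ∞]`. -/
def scaledNorm (t : ℝ) (g : E n → ℂ) : ℝ≥0∞ :=
  max (eLpNorm g 1 volume) (ENNReal.ofReal (t ^ ((n : ℝ) / 2)) * eLpNorm g ∞ volume)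

theorem scaledNorm_congr {t : ℝ} {g h : E n → ℂ} (hgh : g =ᵐ[volume] h) :
    scaledNorm t g = scaledNorm t h := by
  rw [scaledNorm, scaledNorm, eLpNorm_congr_ae hgh, eLpNorm_congr_ae hgh]

theorem scaledNorm_add_le (t : ℝ) {g h : E n → ℂ} (hg : AEStronglyMeasurable g volume)
    (hh : AEStronglyMeasurable h volume) :
    scaledNorm t (fun x => g x + h x) ≤ scaledNorm t g + scaledNorm t h := by
  refine max_le ?_ ?_
  · exact (eLpNorm_add_le hg hh le_rfl).trans (add_le_add (le_max_left _ _) (le_max_left _ _))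
  · calc _ ≤ ENNReal.ofReal (t ^ ((n : ℝ) / 2)) * (eLpNorm g ∞ volume + eLpNorm h ∞ volume) := by
          gcongr; exact eLpNorm_add_le hg hh le_top
      _ ≤ _ := by rw [mul_add]; exact add_le_add (le_max_right _ _) (le_max_right _ _)

/-- Minkowski's inequality in the scaled norm. -/
theorem scaledNorm_integral_le {ι : Type*} [MeasurableSpace ι] {μ : Measure ι} (t : ℝ)
    {F : ι → L1 n} (hF : Integrable F μ) {c : ι → ℝ≥0∞}
    (hc : ∀ᵐ s ∂μ, scaledNorm t (F s) ≤ c s) :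
    scaledNorm t (∫ s, F s ∂μ : L1 n) ≤ ∫⁻ s, c s ∂μ := by
  refine max_le ?_ ?_
  · rw [← Lp.enorm_def]
    refine (enorm_integral_le_lintegral_enorm _).trans (lintegral_mono_ae ?_)
    filter_upwards [hc] with s hs
    rw [Lp.enorm_def]
    exact (le_max_left _ _).trans hs
  · rcases eq_or_ne (ENNReal.ofReal (t ^ ((n : ℝ) / 2))) 0 with h0 | h0
    · simp [h0]
    have hr : ENNReal.ofReal (t ^ ((n : ℝ) / 2)) ≠ ∞ := ENNReal.ofReal_ne_top
    have := eLpNorm_top_integral_le hF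
      (c := fun s => (ENNReal.ofReal (t ^ ((n : ℝ) / 2)))⁻¹ * c s) (by
        filter_upwards [hc] with s hs
        have h1 := (le_max_right _ _).trans hs
        calc _ = (ENNReal.ofReal (t ^ ((n : ℝ) / 2)))⁻¹ *
              (ENNReal.ofReal (t ^ ((n : ℝ) / 2)) * eLpNorm (F s) ∞ volume) := by
              rw [← mul_assoc, ENNReal.inv_mul_cancel h0 hr, one_mul]
          _ ≤ _ := mul_le_mul_right h1 _)
    rw [lintegral_const_mul' _ _ (by simpa using h0)] at this
    calc _ ≤ _ := mul_le_mul_right this _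
      _ = _ := by rw [← mul_assoc, ENNReal.mul_inv_cancel h0 hr, one_mul]

/-- Interpolation between `L¹` and `L^∞`. -/
theorem decayExponent_mul_eLpNorm_le {t : ℝ} (ht : 0 < t) {g : E n → ℂ}
    (hg : AEStronglyMeasurable g volume) {q : ℝ≥0∞} (hq : 1 ≤ q) :
    ENNReal.ofReal (t ^ decayExponent n q) * eLpNorm g q volume ≤ scaledNorm t g := by
  rcases eq_or_ne q ∞ with rfl | hq'
  · simp only [decayExponent, ENNReal.inv_top, ENNReal.toReal_zero, sub_zero, mul_one]
    exact le_max_right _ _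
  set r := q.toReal with hr
  have hr1 : 1 ≤ r := by
    rw [hr, ← ENNReal.toReal_one]; exact ENNReal.toReal_mono hq' hq
  have hr0 : 0 < r := by linarith
  have hq0 : q ≠ 0 := by rintro rfl; simp at hq
  set A := eLpNorm g ∞ volume with hA
  set B := eLpNorm g 1 volume with hB
  have h1 : eLpNorm g q volume ≤ A ^ (1 - 1 / r) * B ^ (1 / r) := by
    rw [eLpNorm_eq_lintegral_rpow_enorm_toReal hq0 hq', ← hr]
    have h2 : ∫⁻ x, ‖g x‖ₑ ^ r ≤ A ^ (r - 1) * B := by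
      calc ∫⁻ x, ‖g x‖ₑ ^ r ≤ ∫⁻ x, A ^ (r - 1) * ‖g x‖ₑ := by
            refine lintegral_mono_ae ?_
            filter_upwards [enorm_ae_le_eLpNormEssSup g volume] with x hx
            calc ‖g x‖ₑ ^ r = ‖g x‖ₑ ^ (r - 1) * ‖g x‖ₑ := by
                  rw [← ENNReal.rpow_one ‖g x‖ₑ, ← ENNReal.rpow_mul, ← ENNReal.rpow_mul,
                    ← ENNReal.rpow_add_of_nonneg _ _ (by linarith) (by norm_num)]
                  congr 1; ring
              _ ≤ _ := by
                  gcongr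
                  rw [hA, eLpNorm_exponent_top]; exact hx
        _ = A ^ (r - 1) * B := by
            rw [lintegral_const_mul'' _ hg.enorm, hB, eLpNorm_one_eq_lintegral_enorm]
    calc (∫⁻ x, ‖g x‖ₑ ^ r) ^ (1 / r) ≤ (A ^ (r - 1) * B) ^ (1 / r) := by gcongr
      _ = _ := by
        rw [ENNReal.mul_rpow_of_nonneg _ _ (by positivity), ← ENNReal.rpow_mul]
        congr 2; field_simp
  have hinv : (q⁻¹).toReal = 1 / r := by rw [ENNReal.toReal_inv, one_div]
  have hnn : 0 ≤ 1 - 1 / r := by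
    rw [sub_nonneg, div_le_one hr0]; exact hr1
  have h3 : ENNReal.ofReal (t ^ decayExponent n q)
      = ENNReal.ofReal (t ^ ((n : ℝ) / 2)) ^ (1 - 1 / r) := by
    rw [decayExponent, hinv, ENNReal.ofReal_rpow_of_nonneg (by positivity) hnn,
      ← Real.rpow_mul ht.le]
  calc _ ≤ ENNReal.ofReal (t ^ ((n : ℝ) / 2)) ^ (1 - 1 / r) * (A ^ (1 - 1 / r) * B ^ (1 / r)) := by
        rw [h3]; gcongr
    _ = (ENNReal.ofReal (t ^ ((n : ℝ) / 2)) * A) ^ (1 - 1 / r) * B ^ (1 / r) := by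
        rw [ENNReal.mul_rpow_of_nonneg _ _ hnn, mul_assoc]
    _ ≤ scaledNorm t g ^ (1 - 1 / r) * scaledNorm t g ^ (1 / r) := by
        gcongr
        · exact le_max_right _ _
        · exact le_max_left _ _
    _ = scaledNorm t g := by
        rw [← ENNReal.rpow_add_of_nonneg _ _ hnn (by positivity)]
        simp

/-! ### Integral operators -/

/-- The integral operator with kernel `k`. -/
def kerOp (k : E n → E n → ℂ) (φ : E n → ℂ) (x : E n) : ℂ := ∫ y, k x y * φ y

theorem kerOp_congr {k : E n → E n → ℂ} {φ ψ : E n → ℂ} (h : φ =ᵐ[volume] ψ) :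
    kerOp k φ = kerOp k ψ := by
  ext x
  exact integral_congr_ae (h.mono fun y hy => by simp only [hy])

theorem aestronglyMeasurable_kerOp {k : E n → E n → ℂ} (hk : Measurable (Function.uncurry k))
    {φ : E n → ℂ} (hφ : AEStronglyMeasurable φ volume) :
    AEStronglyMeasurable (kerOp k φ) volume := by
  have h : AEStronglyMeasurable (fun z : E n × E n => Function.uncurry k z * φ z.2)
      (volume.prod volume) :=
    hk.aestronglyMeasurable.mul hφ.comp_snd
  exact h.integral_prod_right'

/-- Schur's test in weighted `L¹`: the weighted mass of the columns of the kernel bounds the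
operator. -/
theorem lintegral_kerOp_le {k : E n → E n → ℂ} (hk : Measurable (Function.uncurry k))
    {w : E n → ℝ≥0∞} (hw : Measurable w)
    {φ : E n → ℂ} (hφ : AEStronglyMeasurable φ volume) {N : E n → ℝ≥0∞}
    (hN : ∀ y, ∫⁻ x, w x * ‖k x y‖ₑ ≤ N y) :
    ∫⁻ x, w x * ‖kerOp k φ x‖ₑ ≤ ∫⁻ y, N y * ‖φ y‖ₑ := by
  have hk2 : Measurable (Function.uncurry fun x y => w x * ‖k x y‖ₑ) :=
    (hw.comp measurable_fst).mul hk.enorm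
  calc ∫⁻ x, w x * ‖kerOp k φ x‖ₑ ≤ ∫⁻ x, ∫⁻ y, (w x * ‖k x y‖ₑ) * ‖φ y‖ₑ := by
        refine lintegral_mono fun x => ?_
        have h1 : ‖kerOp k φ x‖ₑ ≤ ∫⁻ y, ‖k x y‖ₑ * ‖φ y‖ₑ := by
          refine (enorm_integral_le_lintegral_enorm _).trans (le_of_eq ?_)
          simp only [enorm_mul]
        have hm : AEMeasurable (fun y => ‖k x y‖ₑ * ‖φ y‖ₑ) volume :=
          ((hk.comp (measurable_const.prodMk measurable_id)).enorm.aemeasurable).mul hφ.enorm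
        calc w x * ‖kerOp k φ x‖ₑ ≤ w x * ∫⁻ y, ‖k x y‖ₑ * ‖φ y‖ₑ := by gcongr
          _ = ∫⁻ y, (w x * ‖k x y‖ₑ) * ‖φ y‖ₑ := by
            rw [← lintegral_const_mul'' _ hm]
            simp only [mul_assoc]
    _ = ∫⁻ y, ∫⁻ x, (w x * ‖k x y‖ₑ) * ‖φ y‖ₑ := by
        refine lintegral_lintegral_swap ?_
        exact hk2.aemeasurable.mul hφ.enorm.comp_snd
    _ ≤ ∫⁻ y, N y * ‖φ y‖ₑ := by
        refine lintegral_mono fun y => ?_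
        simp only
        rw [lintegral_mul_const' _ _ enorm_ne_top]
        exact mul_le_mul_left (hN y) _

theorem eLpNorm_one_kerOp_le {k : E n → E n → ℂ} (hk : Measurable (Function.uncurry k))
    {φ : E n → ℂ} (hφ : AEStronglyMeasurable φ volume) {N : E n → ℝ≥0∞}
    (hN : ∀ y, ∫⁻ x, ‖k x y‖ₑ ≤ N y) :
    eLpNorm (kerOp k φ) 1 volume ≤ ∫⁻ y, N y * ‖φ y‖ₑ := by
  rw [eLpNorm_one_eq_lintegral_enorm]
  simpa using lintegral_kerOp_le hk (w := fun _ => 1) measurable_const hφ (N := N)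
    (by simpa using hN)

theorem scaledNorm_kerOp_le {t : ℝ} {k : E n → E n → ℂ} (hk : Measurable (Function.uncurry k))
    {φ : E n → ℂ} (hφ : AEStronglyMeasurable φ volume) {N : E n → ℝ≥0∞}
    (hN : ∀ y, ∫⁻ x, ‖k x y‖ₑ ≤ N y)
    (hN' : ∀ y x, ENNReal.ofReal (t ^ ((n : ℝ) / 2)) * ‖k x y‖ₑ ≤ N y) :
    scaledNorm t (kerOp k φ) ≤ ∫⁻ y, N y * ‖φ y‖ₑ := by
  refine max_le (eLpNorm_one_kerOp_le hk hφ hN) ?_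
  have hr : ENNReal.ofReal (t ^ ((n : ℝ) / 2)) ≠ ∞ := ENNReal.ofReal_ne_top
  rw [eLpNorm_exponent_top, eLpNormEssSup_eq_essSup_enorm,
    ← ENNReal.essSup_const_mul]
  refine essSup_le_of_ae_le _ (Eventually.of_forall fun x => ?_)
  calc ENNReal.ofReal (t ^ ((n : ℝ) / 2)) * ‖kerOp k φ x‖ₑ
      ≤ ENNReal.ofReal (t ^ ((n : ℝ) / 2)) * ∫⁻ y, ‖k x y‖ₑ * ‖φ y‖ₑ := by
        gcongr
        refine (enorm_integral_le_lintegral_enorm _).trans (le_of_eq ?_)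
        simp only [enorm_mul]
    _ = ∫⁻ y, (ENNReal.ofReal (t ^ ((n : ℝ) / 2)) * ‖k x y‖ₑ) * ‖φ y‖ₑ := by
        rw [← lintegral_const_mul' _ _ hr]
        simp only [mul_assoc]
    _ ≤ _ := lintegral_mono fun y => mul_le_mul_left (hN' y x) _

theorem integrable_kerOp {k : E n → E n → ℂ} (hk : Measurable (Function.uncurry k))
    {φ : E n → ℂ} (hφ : Integrable φ) {C : ℝ≥0} (hC : ∀ y, ∫⁻ x, ‖k x y‖ₑ ≤ C) :
    Integrable (kerOp k φ) := by
  rw [← memLp_one_iff_integrable]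
  refine ⟨aestronglyMeasurable_kerOp hk hφ.1, ?_⟩
  refine (eLpNorm_one_kerOp_le hk hφ.1 hC).trans_lt ?_
  rw [lintegral_const_mul' _ _ ENNReal.coe_ne_top]
  exact ENNReal.mul_lt_top ENNReal.coe_lt_top hφ.2

/-! ### Grönwall's inequality -/

/-- Grönwall's inequality in integral form on `(0, ∞)`. -/
theorem gronwall_integral {N b : ℝ → ℝ} {A : ℝ}
    (hN : Continuous N) (hb : Continuous b) (hb0 : ∀ s, 0 ≤ b s)
    (h : ∀ t, 0 < t → N t ≤ A + ∫ s in (0 : ℝ)..t, b s * N s) {t : ℝ} (ht : 0 < t) :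
    N t ≤ A * Real.exp (∫ s in (0 : ℝ)..t, b s) := by
  set F : ℝ → ℝ := fun t => A + ∫ s in (0 : ℝ)..t, b s * N s with hF
  set B : ℝ → ℝ := fun t => ∫ s in (0 : ℝ)..t, b s with hB
  have hF' : ∀ s, HasDerivAt F (b s * N s) s := fun s =>
    ((hb.mul hN).integral_hasStrictDerivAt 0 s).hasDerivAt.const_add A
  have hB' : ∀ s, HasDerivAt B (b s) s := fun s => (hb.integral_hasStrictDerivAt 0 s).hasDerivAt
  have hH : ∀ s, HasDerivAt (fun s => F s * Real.exp (-B s))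
      (b s * N s * Real.exp (-B s) + F s * (Real.exp (-B s) * -b s)) s := fun s =>
    (hF' s).mul (hB' s).neg.exp
  have hanti : AntitoneOn (fun s => F s * Real.exp (-B s)) (Icc 0 t) := by
    refine antitoneOn_of_deriv_nonpos (convex_Icc 0 t)
      (fun s _ => (hH s).continuousAt.continuousWithinAt)
      (fun s _ => (hH s).differentiableAt.differentiableWithinAt) fun s hs => ?_
    rw [interior_Icc] at hs
    rw [(hH s).deriv]
    have h1 : b s * N s ≤ b s * F s := mul_le_mul_of_nonneg_left (h s hs.1) (hb0 s)
    nlinarith [Real.exp_pos (-B s)]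
  have h1 := hanti (left_mem_Icc.2 ht.le) (right_mem_Icc.2 ht.le) ht.le
  simp only [hF, hB, intervalIntegral.integral_same, add_zero, neg_zero, Real.exp_zero, mul_one]
    at h1
  have h2 : N t ≤ F t := h t ht
  calc N t ≤ F t := h2
    _ = (F t * Real.exp (-B t)) * Real.exp (B t) := by
        rw [mul_assoc, ← Real.exp_add]; simp
    _ ≤ A * Real.exp (B t) := mul_le_mul_of_nonneg_right h1 (Real.exp_pos _).le

/-! ### Gaussians -/

theorem norm_gaussian (z : ℂ) (x : E n) :
    ‖gaussian z x‖ = ‖4 * (Real.pi : ℂ) * z‖ ^ (-(n : ℝ) / 2) *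
      Real.exp (-‖x‖ ^ 2 * ((4 * z)⁻¹).re) := by
  have h1 : (-(n : ℂ) / 2) = ((-(n : ℝ) / 2 : ℝ) : ℂ) := by push_cast; ring
  have h2 : (-((‖x‖ ^ 2 : ℝ) : ℂ) / (4 * z)).re = -‖x‖ ^ 2 * ((4 * z)⁻¹).re := by
    rw [div_eq_mul_inv, ← Complex.ofReal_neg, Complex.re_ofReal_mul]
  rw [gaussian, norm_mul, h1, Complex.norm_cpow_real, Complex.norm_exp, h2]

theorem continuous_gaussian (z : ℂ) : Continuous (gaussian z : E n → ℂ) := by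
  unfold gaussian
  fun_prop

theorem inv_four_mul_re_pos {z : ℂ} (hz : 0 < z.re) : 0 < ((4 * z)⁻¹).re := by
  have h0 : z ≠ 0 := by rintro rfl; simp at hz
  rw [Complex.inv_re]
  have h1 : 0 < Complex.normSq (4 * z) := Complex.normSq_pos.2 (by simp [h0])
  have h2 : (4 * z).re = 4 * z.re := by simp
  rw [h2]; positivity

/-- Parabolic scaling of the Gaussian. -/
theorem gaussian_mul {t : ℝ} (ht : 0 < t) {z : ℂ} (hz : z ≠ 0) (x : E n) :
    gaussian ((t : ℂ) * z) x =
      ((t ^ (-(n : ℝ) / 2) : ℝ) : ℂ) * gaussian z (t ^ (-(1 / 2) : ℝ) • x) := by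
  have htc : (t : ℂ) ≠ 0 := by exact_mod_cast ht.ne'
  have h1 : (4 * (Real.pi : ℂ) * ((t : ℂ) * z)) ^ (-(n : ℂ) / 2)
      = ((t ^ (-(n : ℝ) / 2) : ℝ) : ℂ) * (4 * (Real.pi : ℂ) * z) ^ (-(n : ℂ) / 2) := by
    have : 4 * (Real.pi : ℂ) * ((t : ℂ) * z) = (t : ℂ) * (((4 * Real.pi : ℝ) : ℂ) * z) := by
      push_cast; ring
    have hw : 4 * (Real.pi : ℂ) * z ≠ 0 := by simp [hz, Real.pi_ne_zero]
    rw [this, Complex.ofReal_cpow ht.le]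
    push_cast
    rw [Complex.cpow_def_of_ne_zero (mul_ne_zero htc hw), Complex.cpow_def_of_ne_zero htc,
      Complex.cpow_def_of_ne_zero hw, Complex.log_ofReal_mul ht hw, ← Complex.exp_add,
      Complex.ofReal_log ht.le]
    congr 1; ring
  have h2 : ‖t ^ (-(1 / 2) : ℝ) • x‖ ^ 2 = t⁻¹ * ‖x‖ ^ 2 := by
    rw [norm_smul, mul_pow, Real.norm_eq_abs, sq_abs, ← Real.rpow_natCast, ← Real.rpow_mul ht.le]
    norm_num [Real.rpow_neg_one]
  rw [gaussian, gaussian, h1, h2, mul_assoc]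
  congr 3
  push_cast
  field_simp

/-- Polynomial growth is absorbed by a Gaussian. -/
theorem one_add_pow_le_exp (j : ℕ) {c : ℝ} (hc : 0 < c) :
    ∃ C : ℝ, 0 < C ∧ ∀ r : ℝ, 0 ≤ r → (1 + r) ^ j ≤ C * Real.exp (c * r ^ 2) := by
  refine ⟨j.factorial * Real.exp (1 + 1 / (4 * c)), by positivity, fun r hr => ?_⟩
  have h1 := Real.pow_div_factorial_le_exp (1 + r) (by linarith) j
  rw [div_le_iff₀ (by positivity)] at h1
  calc (1 + r) ^ j ≤ Real.exp (1 + r) * j.factorial := h1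
    _ ≤ Real.exp (1 + 1 / (4 * c) + c * r ^ 2) * j.factorial := by
        refine mul_le_mul_of_nonneg_right (Real.exp_le_exp.2 ?_) (by positivity)
        have : 0 ≤ (2 * c * r - 1) ^ 2 / (4 * c) := by positivity
        have h2 : (2 * c * r - 1) ^ 2 / (4 * c) = c * r ^ 2 - r + 1 / (4 * c) := by
          field_simp; ring
        linarith
    _ = _ := by rw [Real.exp_add]; ring

theorem integrable_exp_neg_mul_sq_norm {c : ℝ} (hc : 0 < c) :
    Integrable (fun x : E n => Real.exp (-c * ‖x‖ ^ 2)) := by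
  have h := (GaussianFourier.integrable_cexp_neg_mul_sq_norm_add (b := (c : ℂ)) (V := E n)
    (by simpa using hc) 0 0).norm
  refine h.congr (Eventually.of_forall fun x => ?_)
  simp only [Complex.norm_exp]
  congr 1
  have : (-(c : ℂ) * (‖x‖ : ℂ) ^ 2 + 0 * ((inner ℝ (0 : E n) x : ℝ) : ℂ))
      = ((-c * ‖x‖ ^ 2 : ℝ) : ℂ) := by push_cast; ring
  rw [this, Complex.ofReal_re]

theorem integrable_one_add_pow_mul_exp (j : ℕ) {c : ℝ} (hc : 0 < c) :
    Integrable (fun x : E n => (1 + ‖x‖) ^ j * Real.exp (-c * ‖x‖ ^ 2)) := by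
  obtain ⟨C, hC, hle⟩ := one_add_pow_le_exp j (half_pos hc)
  refine ((integrable_exp_neg_mul_sq_norm (n := n) (half_pos hc)).const_mul C).mono'
    (by fun_prop) (Eventually.of_forall fun x => ?_)
  rw [Real.norm_of_nonneg (by positivity)]
  calc _ ≤ C * Real.exp (c / 2 * ‖x‖ ^ 2) * Real.exp (-c * ‖x‖ ^ 2) := by
        gcongr; exact hle _ (norm_nonneg x)
    _ = _ := by rw [mul_assoc, ← Real.exp_add]; congr 2; ring

theorem integrable_one_add_pow_mul_gaussian (j : ℕ) {z : ℂ} (hz : 0 < z.re) :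
    Integrable (fun x : E n => (1 + ‖x‖) ^ j * ‖gaussian z x‖) := by
  refine ((integrable_one_add_pow_mul_exp (n := n) j (inv_four_mul_re_pos hz)).const_mul
    (‖4 * (Real.pi : ℂ) * z‖ ^ (-(n : ℝ) / 2))).congr (Eventually.of_forall fun x => ?_)
  simp only [norm_gaussian]
  rw [show -((4 * z)⁻¹).re * ‖x‖ ^ 2 = -‖x‖ ^ 2 * ((4 * z)⁻¹).re by ring]
  ring

/-- Change of variables `x ↦ r x` in a lower Lebesgue integral on `ℝⁿ`. -/
theorem lintegral_comp_smul {r : ℝ} (hr : 0 < r) (g : E n → ℝ≥0∞) :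
    ∫⁻ x, g (r • x) = ENNReal.ofReal ((r ^ n)⁻¹) * ∫⁻ x, g x := by
  have h1 : MeasurableEmbedding (fun x : E n => r • x) :=
    (Homeomorph.smulOfNeZero r hr.ne').measurableEmbedding
  rw [← h1.lintegral_map, Measure.map_addHaar_smul _ hr.ne', lintegral_smul_measure,
    smul_eq_mul]
  congr 2
  rw [abs_of_pos (by positivity)]
  simp

/-- The parabolic dilation `t^(-n/2) g(t^(-1/2) ·)` preserves integrals. -/
theorem lintegral_dilation {t : ℝ} (ht : 0 < t) (g : E n → ℝ≥0∞) :
    ENNReal.ofReal (t ^ (-(n : ℝ) / 2)) * ∫⁻ x, g (t ^ (-(1 / 2) : ℝ) • x) = ∫⁻ x, g x := by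
  rw [lintegral_comp_smul (by positivity), ← mul_assoc, ← ENNReal.ofReal_mul (by positivity)]
  have : t ^ (-(n : ℝ) / 2) * ((t ^ (-(1 / 2) : ℝ)) ^ n)⁻¹ = 1 := by
    rw [← Real.rpow_natCast, ← Real.rpow_mul ht.le, ← Real.rpow_neg ht.le, ← Real.rpow_add ht]
    convert Real.rpow_zero t using 2
    ring
  rw [this]; simp

/-! ### Hermite polynomials -/

/-- The term with index `b` of the one-dimensional Hermite polynomial of degree `a`, set to `0`
outside the range `2 b ≤ a`. -/
def hermiteTerm (ν : ℂ) (x : ℝ) (a b : ℕ) : ℂ :=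
  if 2 * b ≤ a then
    (-1) ^ b * (a.factorial : ℂ) / ((b.factorial : ℂ) * ((a - 2 * b).factorial : ℂ))
      * (ν ^ (a - b))⁻¹ * ((x ^ (a - 2 * b) : ℝ) : ℂ)
  else 0

/-- The one-dimensional Hermite polynomial of degree `a`. -/
def hermiteOne (ν : ℂ) (x : ℝ) (a : ℕ) : ℂ :=
  ∑ b ∈ Finset.range (a / 2 + 1), hermiteTerm ν x a b

theorem hermiteOne_eq (ν : ℂ) (x : ℝ) {a N : ℕ} (h : a / 2 + 1 ≤ N) :
    hermiteOne ν x a = ∑ b ∈ Finset.range N, hermiteTerm ν x a b := by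
  refine Finset.sum_subset (Finset.range_mono h) fun b _ hb => ?_
  rw [Finset.mem_range, not_lt] at hb
  rw [hermiteTerm, if_neg (by omega)]

theorem hermiteTerm_zero_succ {ν : ℂ} (hν : ν ≠ 0) (x : ℝ) (a : ℕ) :
    hermiteTerm ν x (a + 1) 0 = ν⁻¹ * (x * hermiteTerm ν x a 0) := by
  have h1 : ((a + 1).factorial : ℂ) ≠ 0 := by exact_mod_cast Nat.factorial_ne_zero _
  have h2 : (a.factorial : ℂ) ≠ 0 := by exact_mod_cast Nat.factorial_ne_zero _
  simp only [hermiteTerm, mul_zero, Nat.zero_le, if_true, Nat.sub_zero, Nat.factorial_zero]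
  push_cast
  field_simp
  ring

theorem hermiteTerm_succ {ν : ℂ} (hν : ν ≠ 0) (x : ℝ) (a b : ℕ) :
    hermiteTerm ν x (a + 2) (b + 1) =
      ν⁻¹ * (x * hermiteTerm ν x (a + 1) (b + 1) - 2 * (a + 1) * hermiteTerm ν x a b) := by
  have hb : (b.factorial : ℂ) ≠ 0 := by exact_mod_cast Nat.factorial_ne_zero _
  have hb' : (b : ℂ) + 1 ≠ 0 := by exact_mod_cast Nat.succ_ne_zero b
  rcases lt_trichotomy a (2 * b) with h | h | h
  · simp only [hermiteTerm]
    rw [if_neg (by omega), if_neg (by omega), if_neg (by omega)]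
    simp
  · subst h
    simp only [hermiteTerm]
    rw [if_pos (by omega), if_neg (by omega), if_pos (by omega)]
    rw [show 2 * b + 2 - 2 * (b + 1) = 0 by omega, show 2 * b + 2 - (b + 1) = b + 1 by omega,
      show 2 * b - 2 * b = 0 by omega, show 2 * b - b = b by omega]
    simp only [Nat.factorial_succ, Nat.factorial_zero]
    push_cast
    field_simp
    ring
  · obtain ⟨d, rfl⟩ : ∃ d, a = 2 * b + 1 + d := ⟨a - (2 * b + 1), by omega⟩
    simp only [hermiteTerm]
    rw [if_pos (by omega), if_pos (by omega), if_pos (by omega)]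
    rw [show 2 * b + 1 + d + 2 - 2 * (b + 1) = d + 1 by omega,
      show 2 * b + 1 + d + 2 - (b + 1) = b + d + 2 by omega,
      show 2 * b + 1 + d + 1 - 2 * (b + 1) = d by omega,
      show 2 * b + 1 + d + 1 - (b + 1) = b + d + 1 by omega,
      show 2 * b + 1 + d - 2 * b = d + 1 by omega,
      show 2 * b + 1 + d - b = b + d + 1 by omega]
    have hd : (d.factorial : ℂ) ≠ 0 := by exact_mod_cast Nat.factorial_ne_zero _
    have hd' : (d : ℂ) + 1 ≠ 0 := by exact_mod_cast Nat.succ_ne_zero d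
    have hf : ((2 * b + 1 + d + 2).factorial : ℂ)
        = (2 * b + 1 + d + 2) * (2 * b + 1 + d + 1) * ((2 * b + 1 + d).factorial : ℂ) := by
      simp only [Nat.factorial_succ]; push_cast; ring
    have hf' : ((2 * b + 1 + d + 1).factorial : ℂ)
        = (2 * b + 1 + d + 1) * ((2 * b + 1 + d).factorial : ℂ) := by
      rw [Nat.factorial_succ (2 * b + 1 + d)]; push_cast; ring
    rw [hf, hf']
    generalize ((2 * b + 1 + d).factorial : ℂ) = Fa
    simp only [Nat.factorial_succ]
    push_cast
    field_simp
    ring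

theorem hermiteOne_zero (ν : ℂ) (x : ℝ) : hermiteOne ν x 0 = 1 := by
  simp [hermiteOne, hermiteTerm]

theorem hermiteOne_one (ν : ℂ) (x : ℝ) : hermiteOne ν x 1 = ν⁻¹ * x := by
  simp [hermiteOne, hermiteTerm]

/-- Three-term recurrence of the Hermite polynomials. -/
theorem hermiteOne_succ {ν : ℂ} (hν : ν ≠ 0) (x : ℝ) (a : ℕ) :
    hermiteOne ν x (a + 2) =
      ν⁻¹ * (x * hermiteOne ν x (a + 1) - 2 * (a + 1) * hermiteOne ν x a) := by
  rw [hermiteOne_eq ν x (a := a + 2) (N := a + 3) (by omega),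
    hermiteOne_eq ν x (a := a + 1) (N := a + 3) (by omega),
    hermiteOne_eq ν x (a := a) (N := a + 2) (by omega),
    Finset.sum_range_succ', Finset.sum_range_succ' _ (a + 2), hermiteTerm_zero_succ hν]
  simp only [hermiteTerm_succ hν]
  rw [← Finset.mul_sum, Finset.sum_sub_distrib, ← Finset.mul_sum, ← Finset.mul_sum]
  ring

/-- The Hermite polynomial in several variables is a product of one-dimensional ones. -/
theorem hermite_eq_prod (ν : ℂ) (α : Fin n → ℕ) (x : E n) :
    hermite ν α x = ∏ j, hermiteOne ν (x j) (α j) := by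
  have hset : indicesTwoLe α = Fintype.piFinset fun j => Finset.range (α j / 2 + 1) := by
    ext β
    simp only [mem_indicesTwoLe, Fintype.mem_piFinset, Finset.mem_range]
    exact forall_congr' fun j => by omega
  simp only [hermite, hermiteOne]
  rw [Finset.prod_univ_sum, ← hset]
  refine Finset.sum_congr rfl fun β hβ => ?_
  rw [mem_indicesTwoLe] at hβ
  simp only [hermiteTerm, hβ, if_true, Finset.prod_mul_distrib, Finset.prod_div_distrib,
    multiFactorial, length, monomial, Nat.cast_prod, Complex.ofReal_prod, Finset.prod_inv_distrib,
    Finset.prod_pow_eq_pow_sum]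

/-! ### Fourier representation of the Gaussian -/

/-- The oscillating Gaussian `exp (-ν |ξ|² + i ⟨x, ξ⟩)`. -/
def wave (ν : ℂ) (x ξ : E n) : ℂ :=
  Complex.exp (-ν * (‖ξ‖ : ℂ) ^ 2 + Complex.I * ((inner ℝ x ξ : ℝ) : ℂ))

theorem continuous_wave (ν : ℂ) (x : E n) : Continuous (wave ν x) := by
  unfold wave
  fun_prop

theorem norm_wave (ν : ℂ) (x ξ : E n) : ‖wave ν x ξ‖ = Real.exp (-ν.re * ‖ξ‖ ^ 2) := by
  rw [wave, Complex.norm_exp]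
  congr 1
  rw [Complex.add_re, Complex.I_mul_re, Complex.ofReal_im, ← Complex.ofReal_pow,
    Complex.re_mul_ofReal]
  simp

/-- The Gaussian kernel is the inverse Fourier transform of `exp (-ν |ξ|²)`. -/
theorem integral_wave {ν : ℂ} (hν : 0 < ν.re) (x : E n) :
    ∫ ξ, wave ν x ξ = (2 * (Real.pi : ℂ)) ^ n * gaussian ν x := by
  have h := GaussianFourier.integral_cexp_neg_mul_sq_norm_add (V := E n) hν Complex.I x
  have hν0 : ν ≠ 0 := by rintro rfl; simp at hν
  have hpi : (Real.pi : ℂ) ≠ 0 := by exact_mod_cast Real.pi_ne_zero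
  simp only [wave]
  rw [h, gaussian, ← mul_assoc]
  congr 1
  · rw [Complex.cpow_def_of_ne_zero (div_ne_zero hpi hν0),
      Complex.cpow_def_of_ne_zero (by simp [hpi, hν0]), div_eq_mul_inv,
      Complex.log_ofReal_mul Real.pi_pos (inv_ne_zero hν0),
      show 4 * (Real.pi : ℂ) * ν = ((4 * Real.pi : ℝ) : ℂ) * ν by push_cast; ring,
      Complex.log_ofReal_mul (by positivity) hν0,
      Complex.log_inv _ (by
        rw [Ne, Complex.arg_eq_pi_iff]; intro h; linarith [h.1]),
      Real.log_mul (by norm_num) Real.pi_ne_zero,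
      show (4 : ℝ) = 2 ^ 2 by norm_num, Real.log_pow]
    have h2 : (2 * (Real.pi : ℂ)) ^ n = Complex.exp (n * (Real.log 2 + Real.log Real.pi)) := by
      rw [Complex.exp_nat_mul, Complex.exp_add, ← Complex.ofReal_exp, ← Complex.ofReal_exp,
        Real.exp_log (by norm_num), Real.exp_log Real.pi_pos]
      push_cast; rfl
    rw [h2, ← Complex.exp_add]
    congr 1
    simp only [finrank_euclideanSpace, Fintype.card_fin]
    push_cast
    ring
  · rw [Complex.I_sq]; push_cast; congr 1; ring

/-- Polynomially bounded functions are integrable against the oscillating Gaussian. -/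
theorem integrable_mul_wave {ν : ℂ} (hν : 0 < ν.re) (x : E n) {P : E n → ℂ} (hP : Continuous P)
    {C : ℝ} {k : ℕ} (hC : ∀ ξ, ‖P ξ‖ ≤ C * (1 + ‖ξ‖) ^ k) :
    Integrable (fun ξ => P ξ * wave ν x ξ) := by
  refine ((integrable_one_add_pow_mul_exp (n := n) k hν).const_mul C).mono'
    (hP.mul (continuous_wave ν x)).aestronglyMeasurable (Eventually.of_forall fun ξ => ?_)
  rw [norm_mul, norm_wave, ← mul_assoc]
  exact mul_le_mul_of_nonneg_right (hC ξ) (Real.exp_pos _).le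

/-- `∫ (iξ)^a exp (-ν ξ² + i x ξ) dξ` on the real line. -/
def waveMoment (ν : ℂ) (x : ℝ) (a : ℕ) : ℂ :=
  ∫ ξ : ℝ, (Complex.I * ξ) ^ a * Complex.exp (-ν * (ξ : ℂ) ^ 2 + Complex.I * (x * ξ))

theorem integrable_waveMoment {ν : ℂ} (hν : 0 < ν.re) (x : ℝ) (a : ℕ) :
    Integrable fun ξ : ℝ =>
      (Complex.I * ξ) ^ a * Complex.exp (-ν * (ξ : ℂ) ^ 2 + Complex.I * (x * ξ)) := by
  obtain ⟨C, hC, hle⟩ := one_add_pow_le_exp a (half_pos hν)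
  refine ((integrable_exp_neg_mul_sq (half_pos hν)).const_mul C).mono'
    (by fun_prop) (Eventually.of_forall fun ξ => ?_)
  have h1 : (-ν * (ξ : ℂ) ^ 2 + Complex.I * (x * ξ)).re = -ν.re * |ξ| ^ 2 := by
    rw [Complex.add_re, Complex.I_mul_re, ← Complex.ofReal_mul, Complex.ofReal_im,
      ← Complex.ofReal_pow, Complex.re_mul_ofReal]
    simp
  rw [norm_mul, norm_pow, norm_mul, Complex.norm_I, one_mul, Complex.norm_exp, h1,
    Complex.norm_real, Real.norm_eq_abs]
  calc |ξ| ^ a * Real.exp (-ν.re * |ξ| ^ 2)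
      ≤ (1 + |ξ|) ^ a * Real.exp (-ν.re * |ξ| ^ 2) := by gcongr; linarith
    _ ≤ C * Real.exp (ν.re / 2 * |ξ| ^ 2) * Real.exp (-ν.re * |ξ| ^ 2) := by
        gcongr; exact hle _ (abs_nonneg ξ)
    _ = _ := by rw [mul_assoc, ← Real.exp_add, sq_abs]; congr 2; ring

/-- Integration by parts in the moment integrals. For `a = 0` the first term vanishes, whatever the
value of the truncated difference `a - 1`. -/
theorem waveMoment_succ {ν : ℂ} (hν : 0 < ν.re) (x : ℝ) (a : ℕ) :
    (a : ℂ) * waveMoment ν x (a - 1) + x * waveMoment ν x a + 2 * ν * waveMoment ν x (a + 1) =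
      0 := by
  set e : ℝ → ℂ := fun ξ => Complex.exp (-ν * (ξ : ℂ) ^ 2 + Complex.I * (x * ξ)) with he
  have hd : ∀ ξ : ℝ, HasDerivAt (fun ξ : ℝ => (Complex.I * ξ) ^ a * e ξ)
      (Complex.I * ((a : ℂ) * ((Complex.I * ξ) ^ (a - 1) * e ξ) + x * ((Complex.I * ξ) ^ a * e ξ)
        + 2 * ν * ((Complex.I * ξ) ^ (a + 1) * e ξ))) ξ := by
    intro ξ
    have hid : HasDerivAt (fun ξ : ℝ => (ξ : ℂ)) 1 ξ := Complex.ofRealCLM.hasDerivAt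
    have h1 : HasDerivAt (fun ξ : ℝ => (Complex.I * ξ) ^ a)
        ((a : ℂ) * (Complex.I * ξ) ^ (a - 1) * (Complex.I * 1)) ξ :=
      (hid.const_mul Complex.I).pow a
    have h2 : HasDerivAt (fun ξ : ℝ => -ν * (ξ : ℂ) ^ 2 + Complex.I * (x * ξ))
        (-ν * (((2 : ℕ) : ℂ) * (ξ : ℂ) ^ (2 - 1) * 1) + Complex.I * (x * 1)) ξ :=
      ((hid.pow 2).const_mul (-ν)).add ((hid.const_mul (x : ℂ)).const_mul Complex.I)
    refine (h1.mul h2.cexp).congr_deriv ?_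
    simp only [he]
    rw [pow_succ (Complex.I * (ξ : ℂ)) a]
    have hI : Complex.I * Complex.I = -1 := Complex.I_mul_I
    push_cast
    linear_combination (-(2 * ν * (Complex.I * ξ) ^ a * ξ *
      Complex.exp (-ν * (ξ : ℂ) ^ 2 + Complex.I * (x * ξ)))) * hI
  have i1 := (integrable_waveMoment hν x (a - 1)).const_mul (a : ℂ)
  have i2 := (integrable_waveMoment hν x a).const_mul (x : ℂ)
  have i3 := (integrable_waveMoment hν x (a + 1)).const_mul (2 * ν)
  have i12 : Integrable (fun ξ : ℝ => (a : ℂ) * ((Complex.I * ξ) ^ (a - 1) * e ξ)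
      + x * ((Complex.I * ξ) ^ a * e ξ)) := i1.add i2
  have h0 := integral_eq_zero_of_hasDerivAt_of_integrable hd
    (((i1.add i2).add i3).const_mul Complex.I) (integrable_waveMoment hν x a)
  rw [integral_const_mul, integral_add i12 i3, integral_add i1 i2, integral_const_mul,
    integral_const_mul, integral_const_mul] at h0
  exact (mul_eq_zero.1 h0).resolve_left Complex.I_ne_zero

/-- The moments and the Hermite polynomials satisfy the same three-term recurrence. -/
theorem waveMoment_eq {ν : ℂ} (hν : 0 < ν.re) (x : ℝ) (a : ℕ) :
    waveMoment ν x a = ((-2 : ℂ) ^ a)⁻¹ * hermiteOne ν x a * waveMoment ν x 0 := by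
  have hν0 : ν ≠ 0 := by rintro rfl; simp at hν
  induction a using Nat.twoStepInduction with
  | zero => simp [hermiteOne_zero]
  | one =>
    have h := waveMoment_succ hν x 0
    simp only [Nat.cast_zero, zero_mul, zero_add] at h
    rw [hermiteOne_one]
    field_simp
    linear_combination h
  | more a ih1 ih2 =>
    have h := waveMoment_succ hν x (a + 1)
    simp only [Nat.add_sub_cancel, Nat.cast_add, Nat.cast_one] at h
    rw [ih1, ih2] at h
    rw [hermiteOne_succ hν0]
    have h2 : (-2 : ℂ) ^ a ≠ 0 := pow_ne_zero _ (by norm_num)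
    rw [pow_succ, mul_inv] at h
    rw [pow_succ, pow_succ, mul_inv, mul_inv]
    field_simp at h ⊢
    linear_combination h

/-- Fourier representation of `∂^α G_ν = (-2)^{-|α|} h_{ν,α} G_ν`. -/
theorem integral_prod_mul_wave {ν : ℂ} (hν : 0 < ν.re) (α : Fin n → ℕ) (x : E n) :
    ∫ ξ : E n, (∏ j, (Complex.I * (ξ j : ℂ)) ^ α j) * wave ν x ξ =
      (2 * (Real.pi : ℂ)) ^ n * (((-2 : ℂ) ^ length α)⁻¹ * (hermite ν α x * gaussian ν x)) := by
  have key : ∀ α : Fin n → ℕ, ∫ ξ : E n, (∏ j, (Complex.I * (ξ j : ℂ)) ^ α j) * wave ν x ξ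
      = ∏ j, waveMoment ν (x j) (α j) := by
    intro α
    simp only [waveMoment]
    rw [← integral_fintype_prod_volume_eq_prod (fun (j : Fin n) (ξ : ℝ) =>
      (Complex.I * (ξ : ℂ)) ^ α j * Complex.exp (-ν * (ξ : ℂ) ^ 2 + Complex.I * (x j * ξ))),
      ← (EuclideanSpace.volume_preserving_symm_measurableEquiv_toLp (Fin n)).integral_comp']
    refine integral_congr_ae (Eventually.of_forall fun ξ => ?_)
    simp only [Finset.prod_mul_distrib, wave]
    rw [← Complex.exp_sum]
    congr 2
    rw [← Complex.ofReal_pow, EuclideanSpace.norm_sq_eq, PiLp.inner_apply, Finset.sum_add_distrib,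
      ← Finset.mul_sum, ← Finset.mul_sum]
    push_cast
    congr 2
    · refine Finset.sum_congr rfl fun j _ => ?_
      rw [← Complex.ofReal_pow, Real.norm_eq_abs, sq_abs]
      simp
    · refine Finset.sum_congr rfl fun j _ => ?_
      simp [mul_comm]
  have h0 : ∏ j, waveMoment ν (x j) 0 = (2 * (Real.pi : ℂ)) ^ n * gaussian ν x := by
    rw [← integral_wave hν x]
    simpa using (key fun _ => 0).symm
  rw [key]
  simp only [waveMoment_eq hν (x _) (α _)]
  rw [Finset.prod_mul_distrib, Finset.prod_mul_distrib, h0, hermite_eq_prod, Finset.prod_inv_distrib,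
    Finset.prod_pow_eq_pow_sum, length]
  ring

/-! ### Taylor series of the heat kernel along parabolic curves -/

theorem hasSum_pow_div_factorial (a : ℂ) :
    HasSum (fun k : ℕ => a ^ k / (k.factorial : ℂ)) (Complex.exp a) := by
  rw [Complex.exp_eq_exp_ℂ]
  exact NormedSpace.expSeries_div_hasSum_exp a

theorem hasSum_pow_div_factorial_real (a : ℝ) :
    HasSum (fun k : ℕ => a ^ k / (k.factorial : ℝ)) (Real.exp a) := by
  rw [Real.exp_eq_exp_ℝ]
  exact NormedSpace.expSeries_div_hasSum_exp a

theorem hasSum_mul_complex {f g : ℕ → ℂ} {a b : ℂ} (hf : HasSum f a) (hg : HasSum g b) :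
    HasSum (fun p : ℕ × ℕ => f p.1 * g p.2) (a * b) :=
  hf.mul hg (summable_mul_of_summable_norm hf.summable.norm hg.summable.norm)

theorem hasSum_exp_mul_exp (a b : ℂ) :
    HasSum (fun p : ℕ × ℕ => a ^ p.1 / (p.1.factorial : ℂ) * (b ^ p.2 / (p.2.factorial : ℂ)))
      (Complex.exp a * Complex.exp b) := by
  have h := hasSum_mul_complex (hasSum_pow_div_factorial a) (hasSum_pow_div_factorial b)
  exact h

theorem hasSum_exp_mul_exp_real (a b : ℝ) :
    HasSum (fun p : ℕ × ℕ => a ^ p.1 / (p.1.factorial : ℝ) * (b ^ p.2 / (p.2.factorial : ℝ)))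
      (Real.exp a * Real.exp b) := by
  have h1 := hasSum_pow_div_factorial_real a
  have h2 := hasSum_pow_div_factorial_real b
  have h3 := summable_mul_of_summable_norm h1.summable.norm h2.summable.norm
  exact h1.mul h2 h3

theorem multiFactorial_ne_zero (β : Fin n → ℕ) : (multiFactorial β : ℂ) ≠ 0 := by
  rw [multiFactorial]
  exact_mod_cast Finset.prod_ne_zero_iff.2 fun j _ => Nat.factorial_ne_zero _

/-- The coefficient of `λ^{b+2c}` coming from the `b`-th order term in space and the `c`-th order
term in time in the expansion of `λ ↦ G_{(1-λ²σ)ν}(x - λη)`, as a Fourier integral. -/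
def heatCoeff (ν : ℂ) (σ : ℝ) (η x : E n) (b c : ℕ) : ℂ :=
  ((2 * (Real.pi : ℂ)) ^ n)⁻¹ * ∫ ξ : E n,
    ((-Complex.I * ((inner ℝ η ξ : ℝ) : ℂ)) ^ b / (b.factorial : ℂ) *
      (((σ : ℂ) * ν * (‖ξ‖ : ℂ) ^ 2) ^ c / (c.factorial : ℂ))) * wave ν x ξ

theorem two_pi_pow_ne_zero (n : ℕ) : (2 * (Real.pi : ℂ)) ^ n ≠ 0 :=
  pow_ne_zero _ (mul_ne_zero two_ne_zero (by exact_mod_cast Real.pi_ne_zero))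

/-- Expansion of `λ ↦ G_{(1-λ²σ)ν}(x - λη)` for small real `λ`: both exponentials in the Fourier
representation are expanded, and dominated convergence applies because `λ²σ|ν| ≤ Re ν / 2` leaves a
Gaussian factor. -/
theorem hasSum_heatCoeff {ν : ℂ} (hν : 0 < ν.re) {σ : ℝ} (hσ : 0 ≤ σ) (η x : E n) {l : ℝ}
    (hl : l ^ 2 * σ * ‖ν‖ ≤ ν.re / 2) :
    HasSum (fun p : ℕ × ℕ => (l : ℂ) ^ (p.1 + 2 * p.2) * heatCoeff ν σ η x p.1 p.2)
      (gaussian ((1 - (l : ℂ) ^ 2 * σ) * ν) (x - l • η)) := by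
  set A : E n → ℂ := fun ξ => -Complex.I * ((inner ℝ η ξ : ℝ) : ℂ) with hA
  set B : E n → ℂ := fun ξ => (σ : ℂ) * ν * (‖ξ‖ : ℂ) ^ 2 with hB
  have hAc : Continuous A := by simp only [hA]; fun_prop
  have hBc : Continuous B := by simp only [hB]; fun_prop
  have hAn : ∀ ξ, ‖A ξ‖ ≤ ‖η‖ * ‖ξ‖ := fun ξ => by
    simp only [hA, norm_mul, norm_neg, Complex.norm_I, one_mul, Complex.norm_real]
    exact norm_inner_le_norm η ξ
  have hBn : ∀ ξ, ‖B ξ‖ = σ * ‖ν‖ * ‖ξ‖ ^ 2 := fun ξ => by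
    simp only [hB, norm_mul, norm_pow, Complex.norm_real, norm_norm, Real.norm_of_nonneg hσ]
  have hz : (1 - (l : ℂ) ^ 2 * σ) * ν = ((1 - l ^ 2 * σ : ℝ) : ℂ) * ν := by push_cast; ring
  have hre : 0 < ((1 - (l : ℂ) ^ 2 * σ) * ν).re := by
    rw [hz, Complex.re_ofReal_mul]
    have h1 : l ^ 2 * σ * ν.re ≤ l ^ 2 * σ * ‖ν‖ := by gcongr; exact Complex.re_le_norm ν
    nlinarith
  have hwave : ∀ ξ, wave ((1 - (l : ℂ) ^ 2 * σ) * ν) (x - l • η) ξ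
      = (Complex.exp (l * A ξ) * Complex.exp ((l : ℂ) ^ 2 * B ξ)) * wave ν x ξ := by
    intro ξ
    simp only [wave, ← Complex.exp_add, inner_sub_left, real_inner_smul_left, hA, hB]
    congr 1
    push_cast
    ring
  set bound : ℕ × ℕ → E n → ℝ := fun p ξ =>
    ((|l| * (‖η‖ * ‖ξ‖)) ^ p.1 / (p.1.factorial : ℝ) *
      ((l ^ 2 * (σ * ‖ν‖ * ‖ξ‖ ^ 2)) ^ p.2 / (p.2.factorial : ℝ))) *
      Real.exp (-ν.re * ‖ξ‖ ^ 2) with hbound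
  have hbs : ∀ ξ, HasSum (fun p => bound p ξ)
      ((Real.exp (|l| * (‖η‖ * ‖ξ‖)) * Real.exp (l ^ 2 * (σ * ‖ν‖ * ‖ξ‖ ^ 2))) *
        Real.exp (-ν.re * ‖ξ‖ ^ 2)) := fun ξ =>
    (hasSum_exp_mul_exp_real _ _).mul_right _
  have hbi : Integrable (fun ξ => ∑' p, bound p ξ) := by
    simp only [fun ξ => (hbs ξ).tsum_eq]
    refine ((integrable_exp_neg_mul_sq_norm (n := n)
      (c := ν.re / 4) (by positivity)).const_mul (Real.exp ((|l| * ‖η‖) ^ 2 / ν.re))).mono'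
      (by fun_prop) (Eventually.of_forall fun ξ => ?_)
    rw [Real.norm_of_nonneg (by positivity), ← Real.exp_add, ← Real.exp_add, ← Real.exp_add]
    refine Real.exp_le_exp.2 ?_
    have h1 : l ^ 2 * σ * ‖ν‖ * ‖ξ‖ ^ 2 ≤ ν.re / 2 * ‖ξ‖ ^ 2 := by gcongr
    have h2 : 0 ≤ (ν.re / 2 * ‖ξ‖ - |l| * ‖η‖) ^ 2 / ν.re := by positivity
    have h3 : (ν.re / 2 * ‖ξ‖ - |l| * ‖η‖) ^ 2 / ν.re
        = ν.re / 4 * ‖ξ‖ ^ 2 - |l| * (‖η‖ * ‖ξ‖) + (|l| * ‖η‖) ^ 2 / ν.re := by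
      field_simp; ring
    linarith
  have hsum := hasSum_integral_of_dominated_convergence (μ := (volume : Measure (E n)))
    (F := fun (p : ℕ × ℕ) ξ => ((l * A ξ) ^ p.1 / (p.1.factorial : ℂ) *
      (((l : ℂ) ^ 2 * B ξ) ^ p.2 / (p.2.factorial : ℂ))) * wave ν x ξ)
    (f := fun ξ => wave ((1 - (l : ℂ) ^ 2 * σ) * ν) (x - l • η) ξ) bound
    (fun p => by
      have := continuous_wave ν x
      exact Continuous.aestronglyMeasurable (by fun_prop))
    (fun p => Eventually.of_forall fun ξ => by
      simp only [hbound, norm_mul, norm_div, norm_pow, norm_wave, Complex.norm_natCast, hBn,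
        Complex.norm_real, Real.norm_eq_abs, sq_abs]
      gcongr
      exact hAn ξ)
    (Eventually.of_forall fun ξ => (hbs ξ).summable) hbi
    (Eventually.of_forall fun ξ => by
      simp only [hwave]
      exact (hasSum_exp_mul_exp _ _).mul_right _)
  rw [integral_wave hre] at hsum
  have h := hsum.mul_left ((2 * (Real.pi : ℂ)) ^ n)⁻¹
  rw [← mul_assoc, inv_mul_cancel₀ (two_pi_pow_ne_zero n), one_mul] at h
  refine h.congr_fun ?_
  intro p
  rw [heatCoeff, ← mul_assoc, mul_comm ((l : ℂ) ^ _), mul_assoc, ← integral_const_mul]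
  congr 2
  ext ξ
  simp only [hA, hB, mul_pow, pow_add, pow_mul]
  ring

/-- The coefficient of `λ^j` in the expansion of `λ ↦ G_{(1-λ²σ)ν}(x - λη)`. -/
def heatSeriesCoeff (ν : ℂ) (σ : ℝ) (η x : E n) (j : ℕ) : ℂ :=
  ∑ c ∈ Finset.range (j / 2 + 1), heatCoeff ν σ η x (j - 2 * c) c

/-- The expansion grouped by powers of `λ`. -/
theorem hasSum_heatSeriesCoeff {ν : ℂ} (hν : 0 < ν.re) {σ : ℝ} (hσ : 0 ≤ σ) (η x : E n) {l : ℝ}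
    (hl : l ^ 2 * σ * ‖ν‖ ≤ ν.re / 2) :
    HasSum (fun j : ℕ => (l : ℂ) ^ j * heatSeriesCoeff ν σ η x j)
      (gaussian ((1 - (l : ℂ) ^ 2 * σ) * ν) (x - l • η)) := by
  refine ((hasSum_heatCoeff hν hσ η x hl).tsum_fiberwise fun p => p.1 + 2 * p.2).congr_fun ?_
  intro j
  have hfib : (fun p : ℕ × ℕ => p.1 + 2 * p.2) ⁻¹' {j} =
      ↑((Finset.range (j / 2 + 1)).image fun c => (j - 2 * c, c)) := by
    ext ⟨b, c⟩
    simp only [mem_preimage, mem_singleton_iff, Finset.coe_image, Set.mem_image, Finset.coe_range,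
      Set.mem_Iio, Prod.mk.injEq]
    constructor
    · intro h; exact ⟨c, by omega, by omega, rfl⟩
    · rintro ⟨c', h1, h2, rfl⟩; omega
  rw [hfib, Finset.tsum_subtype' _ (fun p : ℕ × ℕ =>
    (l : ℂ) ^ (p.1 + 2 * p.2) * heatCoeff ν σ η x p.1 p.2), Finset.sum_image, heatSeriesCoeff,
    Finset.mul_sum]
  · refine Finset.sum_congr rfl fun c hc => ?_
    rw [Finset.mem_range] at hc
    rw [show j - 2 * c + 2 * c = j by omega]
  · intro c _ c' _ h
    exact (Prod.mk.inj h).2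

/-- Multinomial theorem in multi-index notation. -/
theorem sum_pow_div_factorial (f : Fin n → ℂ) (k : ℕ) :
    (∑ j, f j) ^ k / (k.factorial : ℂ) =
      ∑ β ∈ indicesEq n k, (multiFactorial β : ℂ)⁻¹ * ∏ j, f j ^ β j := by
  have hset : Finset.piAntidiag Finset.univ k = indicesEq n k := by
    ext β; simp [Finset.mem_piAntidiag, mem_indicesEq, length]
  rw [Finset.sum_pow_eq_sum_piAntidiag, hset, Finset.sum_div]
  refine Finset.sum_congr rfl fun β hβ => ?_
  have h := Nat.multinomial_spec Finset.univ β
  rw [mem_indicesEq, length] at hβ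
  rw [hβ] at h
  have h1 := multiFactorial_ne_zero β
  have h2 : (k.factorial : ℂ) ≠ 0 := by exact_mod_cast Nat.factorial_ne_zero _
  have h3 : (multiFactorial β : ℂ) * (Nat.multinomial Finset.univ β : ℂ) = (k.factorial : ℂ) := by
    rw [multiFactorial]; exact_mod_cast h
  field_simp
  rw [← h3]; ring

theorem norm_monomial_le (β : Fin n → ℕ) (x : E n) : |monomial β x| ≤ ‖x‖ ^ length β := by
  rw [monomial, Finset.abs_prod, length, ← Finset.prod_pow_eq_pow_sum]
  refine Finset.prod_le_prod (fun j _ => abs_nonneg _) fun j _ => ?_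
  rw [abs_pow]
  gcongr
  exact PiLp.norm_apply_le x j

/-- The Fourier integrals are Hermite polynomials times the Gaussian. -/
theorem heatCoeff_eq {ν : ℂ} (hν : 0 < ν.re) (σ : ℝ) (η x : E n) (b c : ℕ) :
    heatCoeff ν σ η x b c = ∑ γ ∈ indicesEq n c, (-ν) ^ c / (multiFactorial γ : ℂ) * (σ : ℂ) ^ c *
      (((-2 : ℂ) ^ length (fun j => 2 * γ j))⁻¹ * (((2 : ℂ) ^ b)⁻¹ *
        ∑ β ∈ indicesEq n b, (multiFactorial β : ℂ)⁻¹ * (monomial β η : ℂ) *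
          (hermite ν ((fun j => 2 * γ j) + β) x * gaussian ν x))) := by
  have hin : ∀ ξ : E n, ((-Complex.I * ((inner ℝ η ξ : ℝ) : ℂ)) ^ b / (b.factorial : ℂ) *
      (((σ : ℂ) * ν * (‖ξ‖ : ℂ) ^ 2) ^ c / (c.factorial : ℂ))) * wave ν x ξ =
      ∑ γ ∈ indicesEq n c, ∑ β ∈ indicesEq n b,
        ((-ν) ^ c / (multiFactorial γ : ℂ) * (σ : ℂ) ^ c * ((-1) ^ b *
          (multiFactorial β : ℂ)⁻¹ * (monomial β η : ℂ))) *
        ((∏ j, (Complex.I * (ξ j : ℂ)) ^ ((fun j => 2 * γ j) + β) j) * wave ν x ξ) := by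
    intro ξ
    have h1 : (-Complex.I * ((inner ℝ η ξ : ℝ) : ℂ)) =
        ∑ j, (-1) * (η j : ℂ) * (Complex.I * ξ j) := by
      rw [PiLp.inner_apply]
      push_cast
      rw [Finset.mul_sum]
      refine Finset.sum_congr rfl fun j _ => ?_
      simp; ring
    have h2 : ((σ : ℂ) * ν * (‖ξ‖ : ℂ) ^ 2) = ∑ j, (σ : ℂ) * (-ν) * (Complex.I * ξ j) ^ 2 := by
      rw [← Complex.ofReal_pow, EuclideanSpace.norm_sq_eq]
      push_cast
      rw [Finset.mul_sum]
      refine Finset.sum_congr rfl fun j _ => ?_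
      rw [← Complex.ofReal_pow, Real.norm_eq_abs, sq_abs, mul_pow, Complex.I_sq]
      push_cast; ring
    rw [h1, h2, sum_pow_div_factorial, sum_pow_div_factorial, Finset.sum_mul_sum, Finset.sum_comm,
      Finset.sum_mul]
    refine Finset.sum_congr rfl fun γ hγ => ?_
    rw [Finset.sum_mul]
    refine Finset.sum_congr rfl fun β hβ => ?_
    rw [mem_indicesEq, length] at hγ hβ
    simp only [Finset.prod_mul_distrib, mul_pow, Finset.prod_pow_eq_pow_sum, hγ, hβ, Pi.add_apply,
      pow_add, monomial, pow_mul, Complex.ofReal_prod, Complex.ofReal_pow]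
    ring
  have hint : ∀ α : Fin n → ℕ,
      Integrable (fun ξ : E n => (∏ j, (Complex.I * (ξ j : ℂ)) ^ α j) * wave ν x ξ) := by
    intro α
    refine integrable_mul_wave hν x (C := 1) (k := length α) (by fun_prop) fun ξ => ?_
    have h1 : ‖∏ j, (Complex.I * (ξ j : ℂ)) ^ α j‖ = |monomial α ξ| := by
      simp [monomial, Finset.abs_prod]
    rw [h1, one_mul]
    refine (norm_monomial_le α ξ).trans ?_
    gcongr
    linarith [norm_nonneg ξ]
  rw [heatCoeff]
  simp only [hin]
  rw [integral_finsetSum _ fun γ _ => integrable_finsetSum _ fun β _ => (hint _).const_mul _,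
    Finset.mul_sum]
  refine Finset.sum_congr rfl fun γ hγ => ?_
  rw [integral_finsetSum _ fun β _ => (hint _).const_mul _]
  simp only [Finset.mul_sum]
  refine Finset.sum_congr rfl fun β hβ => ?_
  rw [integral_const_mul, integral_prod_mul_wave hν]
  have hlen : length ((fun j => 2 * γ j) + β) = length (fun j => 2 * γ j) + b := by
    rw [mem_indicesEq] at hβ
    rw [← hβ]; simp only [length, Pi.add_apply, Finset.sum_add_distrib]
  have h2b : ((-2 : ℂ) ^ b)⁻¹ = (-1) ^ b * ((2 : ℂ) ^ b)⁻¹ := by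
    rw [show (-2 : ℂ) = (-1) * 2 by norm_num, mul_pow, mul_inv, ← inv_pow]; norm_num
  have hb1 : ((-1 : ℂ) ^ b) * (-1) ^ b = 1 := by rw [← mul_pow]; norm_num
  rw [hlen, pow_add, mul_inv, h2b]
  have h0 := two_pi_pow_ne_zero n
  have h3 := multiFactorial_ne_zero β
  have h4 := multiFactorial_ne_zero γ
  generalize ((-2 : ℂ) ^ length fun j => 2 * γ j)⁻¹ = q
  field_simp
  linear_combination ((monomial β η : ℂ) * (-ν) ^ c * (σ : ℂ) ^ c * q *
    hermite ν ((fun j => 2 * γ j) + β) x * gaussian ν x) * hb1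

/-- The Taylor polynomial of parabolic order `m` of `(σ, η) ↦ G_{(1-σ)ν}(x - η)` at the origin. -/
def heatPoly (ν : ℂ) (m : ℕ) (σ : ℝ) (η x : E n) : ℂ :=
  ∑ γ ∈ indicesHalf n m, (-ν) ^ length γ / (multiFactorial γ : ℂ) * (σ : ℂ) ^ length γ *
    (((-2 : ℂ) ^ length (fun j => 2 * γ j))⁻¹ *
      ∑ k ∈ Finset.range (m - 2 * length γ + 1), ((2 : ℂ) ^ k)⁻¹ *
        ∑ β ∈ indicesEq n k, (multiFactorial β : ℂ)⁻¹ * (monomial β η : ℂ) *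
          (hermite ν ((fun j => 2 * γ j) + β) x * gaussian ν x))

/-- The Taylor polynomial of degree `m` in `λ`, evaluated at `λ = 1`. -/
theorem sum_heatSeriesCoeff {ν : ℂ} (hν : 0 < ν.re) (m : ℕ) (σ : ℝ) (η x : E n) :
    ∑ j ∈ Finset.range (m + 1), heatSeriesCoeff ν σ η x j = heatPoly ν m σ η x := by
  have h1 : ∑ j ∈ Finset.range (m + 1), heatSeriesCoeff ν σ η x j =
      ∑ c ∈ Finset.range (m / 2 + 1), ∑ b ∈ Finset.range (m - 2 * c + 1),
        heatCoeff ν σ η x b c := by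
    simp only [heatSeriesCoeff]
    rw [Finset.sum_sigma', Finset.sum_sigma']
    refine Finset.sum_bij' (fun p _ => ⟨p.2, p.1 - 2 * p.2⟩) (fun p _ => ⟨p.2 + 2 * p.1, p.1⟩)
      ?_ ?_ ?_ ?_ ?_
    · rintro ⟨j, c⟩ h
      simp only [Finset.mem_sigma, Finset.mem_range] at h ⊢
      omega
    · rintro ⟨c, b⟩ h
      simp only [Finset.mem_sigma, Finset.mem_range] at h ⊢
      omega
    · rintro ⟨j, c⟩ h
      simp only [Finset.mem_sigma, Finset.mem_range] at h
      simp only [Sigma.mk.injEq, heq_eq_eq, and_true]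
      omega
    · rintro ⟨c, b⟩ h
      simp
    · rintro ⟨j, c⟩ h
      rfl
  rw [h1, heatPoly, ← Finset.sum_fiberwise_of_maps_to (g := fun γ : Fin n → ℕ => length γ)
    (t := Finset.range (m / 2 + 1)) (fun γ hγ => by
      rw [mem_indicesHalf] at hγ; rw [Finset.mem_range]; omega)]
  refine Finset.sum_congr rfl fun c hc => ?_
  have hset : (indicesHalf n m).filter (fun γ => length γ = c) = indicesEq n c := by
    ext γ
    rw [Finset.mem_range] at hc
    rw [Finset.mem_filter, mem_indicesHalf, mem_indicesEq]
    omega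
  rw [hset]
  simp only [heatCoeff_eq hν]
  rw [Finset.sum_comm]
  refine Finset.sum_congr rfl fun γ hγ => ?_
  rw [mem_indicesEq] at hγ
  rw [hγ, ← Finset.mul_sum, ← Finset.mul_sum]

/-! ### Cauchy estimate for the Taylor remainder -/

/-- A power series expansion on a real neighbourhood of `0` determines its coefficients. -/
theorem coeff_eq_of_hasSum_real {F : ℝ → ℂ} {a b : ℕ → ℂ}
    (ha : ∀ᶠ l : ℝ in 𝓝 0, HasSum (fun j => (l : ℂ) ^ j * a j) (F l))
    (hb : ∀ᶠ l : ℝ in 𝓝 0, HasSum (fun j => (l : ℂ) ^ j * b j) (F l)) : a = b := by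
  have key : ∀ a : ℕ → ℂ, (∀ᶠ l : ℝ in 𝓝 0, HasSum (fun j => (l : ℂ) ^ j * a j) (F l)) →
      HasFPowerSeriesAt F
        (fun j => ContinuousMultilinearMap.mkPiRing ℝ (Fin j) (a j) :
          FormalMultilinearSeries ℝ ℝ ℂ) 0 := by
    intro a ha
    refine hasFPowerSeriesAt_iff.2 ?_
    filter_upwards [ha] with l hl
    rw [zero_add]
    refine hl.congr_fun fun j => ?_
    simp [FormalMultilinearSeries.coeff, ContinuousMultilinearMap.mkPiRing_apply]
  have h := (key a ha).eq_formalMultilinearSeries (key b hb)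
  funext j
  have hj := congrFun h j
  simpa using congrArg (fun q => q fun _ => (1 : ℝ)) hj

/-- The extension of `λ ↦ G_{(1-λ²σ)ν}(x - λη)` to complex `λ`: the norm `|x - λη|²` is replaced by
the corresponding polynomial in `λ`. It is holomorphic where `Re ((1 - λ²σ)ν) > 0`. -/
def gaussianCurve (ν : ℂ) (σ : ℝ) (η x : E n) (l : ℂ) : ℂ :=
  (4 * (Real.pi : ℂ) * ((1 - l ^ 2 * σ) * ν)) ^ (-(n : ℂ) / 2) *
    Complex.exp (-(((‖x‖ : ℂ) ^ 2 - 2 * l * ((inner ℝ x η : ℝ) : ℂ) + l ^ 2 * (‖η‖ : ℂ) ^ 2)) /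
      (4 * ((1 - l ^ 2 * σ) * ν)))

theorem gaussianCurve_ofReal (ν : ℂ) (σ : ℝ) (η x : E n) (l : ℝ) :
    gaussianCurve ν σ η x l = gaussian ((1 - (l : ℂ) ^ 2 * σ) * ν) (x - l • η) := by
  rw [gaussianCurve, gaussian, norm_sub_sq_real, real_inner_smul_right, norm_smul, mul_pow,
    Real.norm_eq_abs, sq_abs]
  push_cast
  congr 4
  ring

theorem differentiableAt_gaussianCurve {ν : ℂ} {σ : ℝ} (η x : E n) {l : ℂ}
    (h : 0 < ((1 - l ^ 2 * (σ : ℂ)) * ν).re) : DifferentiableAt ℂ (gaussianCurve ν σ η x) l := by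
  have hw0 : (1 - l ^ 2 * (σ : ℂ)) * ν ≠ 0 := by intro h0; rw [h0] at h; simp at h
  have hslit : 4 * (Real.pi : ℂ) * ((1 - l ^ 2 * (σ : ℂ)) * ν) ∈ Complex.slitPlane := by
    left
    rw [show 4 * (Real.pi : ℂ) * ((1 - l ^ 2 * (σ : ℂ)) * ν)
      = ((4 * Real.pi : ℝ) : ℂ) * ((1 - l ^ 2 * (σ : ℂ)) * ν) by push_cast; ring,
      Complex.re_ofReal_mul]
    have := Real.pi_pos
    positivity
  have h1 : DifferentiableAt ℂ
      (fun l : ℂ => 4 * (Real.pi : ℂ) * ((1 - l ^ 2 * (σ : ℂ)) * ν)) l := by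
    fun_prop
  have h2 : DifferentiableAt ℂ (fun l : ℂ => 4 * ((1 - l ^ 2 * (σ : ℂ)) * ν)) l := by
    fun_prop
  have h3 : DifferentiableAt ℂ (fun l : ℂ => -(((‖x‖ : ℂ) ^ 2 - 2 * l * ((inner ℝ x η : ℝ) : ℂ)
      + l ^ 2 * (‖η‖ : ℂ) ^ 2))) l := by
    fun_prop
  exact (h1.cpow_const hslit).mul (h3.div h2 (mul_ne_zero (by norm_num : (4 : ℂ) ≠ 0) hw0)).cexp

/-- For `w` close to `1`, `wν` stays in a sector of the right half plane. -/
theorem re_bounds {ν w : ℂ} (hν : 0 < ν.re) (hw : ‖1 - w‖ ≤ ν.re / (4 * ‖ν‖)) :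
    3 / 4 * ν.re ≤ (w * ν).re ∧ ‖w * ν‖ ≤ 2 * ‖ν‖ := by
  have hν0 : 0 < ‖ν‖ := norm_pos_iff.2 (by rintro rfl; simp at hν)
  have hle : ν.re ≤ ‖ν‖ := Complex.re_le_norm ν
  have h1 : ‖(1 - w) * ν‖ ≤ ν.re / 4 := by
    rw [norm_mul]
    calc _ ≤ ν.re / (4 * ‖ν‖) * ‖ν‖ := by gcongr
      _ = _ := by field_simp
  have h2 : w * ν = ν - (1 - w) * ν := by ring
  refine ⟨?_, ?_⟩
  · rw [h2, Complex.sub_re]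
    have := Complex.re_le_norm ((1 - w) * ν)
    linarith
  · rw [h2]
    have := norm_sub_le ν ((1 - w) * ν)
    linarith

/-- Gaussian bound for the complexified curve, uniform on the disc where `|λ|√σ` and `|λ||η|` are
small. -/
theorem exists_norm_gaussianCurve_le {ν : ℂ} (hν : 0 < ν.re) :
    ∃ r C c : ℝ, 0 < r ∧ r ≤ 1 ∧ 0 < C ∧ 0 < c ∧ ∀ (σ : ℝ) (η x : E n) (l : ℂ), 0 ≤ σ →
      ‖l‖ * √σ ≤ r → ‖l‖ * ‖η‖ ≤ r →
      DifferentiableAt ℂ (gaussianCurve ν σ η x) l ∧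
      ‖gaussianCurve ν σ η x l‖ ≤ C * Real.exp (-c * ‖x‖ ^ 2) := by
  have hν0 : 0 < ‖ν‖ := norm_pos_iff.2 (by rintro rfl; simp at hν)
  have hle : ν.re ≤ ‖ν‖ := Complex.re_le_norm ν
  set a := ν.re / (4 * ‖ν‖) with ha
  have ha0 : 0 < a := by positivity
  have ha1 : a ≤ 1 := by
    rw [ha, div_le_one (by positivity)]; linarith
  set c : ℝ := 3 / 4 * ν.re / (4 * (2 * ‖ν‖) ^ 2) with hc
  have hc0 : 0 < c := by positivity
  set d : ℝ := 1 / (3 * ν.re) with hd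
  have hd0 : 0 < d := by positivity
  refine ⟨√a, (3 * Real.pi * ν.re) ^ (-(n : ℝ) / 2) * Real.exp (2 * d ^ 2 / c + d), c / 2,
    Real.sqrt_pos.2 ha0, Real.sqrt_le_one.2 ha1, by positivity, by positivity, ?_⟩
  intro σ η x l hσ hlσ hlη
  have hr1 : √a ≤ 1 := Real.sqrt_le_one.2 ha1
  have hw : ‖1 - (1 - l ^ 2 * (σ : ℂ))‖ ≤ a := by
    rw [sub_sub_cancel, norm_mul, norm_pow, Complex.norm_real, Real.norm_of_nonneg hσ]
    calc ‖l‖ ^ 2 * σ = (‖l‖ * √σ) ^ 2 := by rw [mul_pow, Real.sq_sqrt hσ]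
      _ ≤ √a ^ 2 := by gcongr
      _ = a := Real.sq_sqrt ha0.le
  obtain ⟨hre, hnorm⟩ := re_bounds hν hw
  set w := (1 - l ^ 2 * (σ : ℂ)) * ν with hwdef
  have hwre : 0 < w.re := lt_of_lt_of_le (by positivity) hre
  have hw0 : w ≠ 0 := by intro h; rw [h] at hwre; simp at hwre
  have hwn : 3 / 4 * ν.re ≤ ‖w‖ := hre.trans (Complex.re_le_norm w)
  refine ⟨differentiableAt_gaussianCurve η x hwre, ?_⟩
  · have hn : (-(n : ℂ) / 2) = ((-(n : ℝ) / 2 : ℝ) : ℂ) := by push_cast; ring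
    rw [gaussianCurve, norm_mul, hn, Complex.norm_cpow_real, Complex.norm_exp, mul_assoc
      ((3 * Real.pi * ν.re) ^ _), ← Real.exp_add]
    have hpi := Real.pi_pos
    refine mul_le_mul ?_ (Real.exp_le_exp.2 ?_) (Real.exp_pos _).le (by positivity)
    · refine Real.rpow_le_rpow_of_nonpos (by positivity) ?_ ?_
      · rw [norm_mul, norm_mul, Complex.norm_real, Real.norm_of_nonneg hpi.le,
          Complex.norm_ofNat]
        nlinarith
      · have : (0 : ℝ) ≤ n := Nat.cast_nonneg n
        linarith
    · set q : ℂ := -2 * l * ((inner ℝ x η : ℝ) : ℂ) + l ^ 2 * (‖η‖ : ℂ) ^ 2 with hq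
      have hsplit : -(((‖x‖ : ℂ) ^ 2 - 2 * l * ((inner ℝ x η : ℝ) : ℂ) + l ^ 2 * (‖η‖ : ℂ) ^ 2)) /
          (4 * w) = -(((‖x‖ ^ 2 : ℝ) : ℂ) * (4 * w)⁻¹) - q * (4 * w)⁻¹ := by
        rw [hq, div_eq_mul_inv]; push_cast; ring
      rw [hsplit, Complex.sub_re, Complex.neg_re, Complex.re_ofReal_mul]
      have h1 : c ≤ ((4 * w)⁻¹).re := by
        rw [Complex.inv_re, Complex.normSq_eq_norm_sq, norm_mul, Complex.norm_ofNat]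
        have h4 : (4 * w).re = 4 * w.re := by simp
        rw [h4, hc, div_le_div_iff₀ (by positivity) (by positivity)]
        have h5 : ‖w‖ ^ 2 ≤ (2 * ‖ν‖) ^ 2 := by gcongr
        have h6 : 3 / 4 * ν.re * ‖w‖ ^ 2 ≤ w.re * (2 * ‖ν‖) ^ 2 := by gcongr
        nlinarith
      have h2 : ‖(4 * w)⁻¹‖ ≤ d := by
        rw [norm_inv, norm_mul, Complex.norm_ofNat, hd, one_div]
        exact inv_anti₀ (by positivity) (by linarith)
      have h3 : ‖q‖ ≤ 2 * ‖x‖ + 1 := by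
        have hlη1 : ‖l‖ * ‖η‖ ≤ 1 := hlη.trans hr1
        have h31 : ‖-2 * l * ((inner ℝ x η : ℝ) : ℂ)‖ ≤ 2 * ‖x‖ := by
          rw [norm_mul, norm_mul, norm_neg, Complex.norm_ofNat, Complex.norm_real]
          calc 2 * ‖l‖ * ‖(inner ℝ x η : ℝ)‖ ≤ 2 * ‖l‖ * (‖x‖ * ‖η‖) := by
                gcongr; exact norm_inner_le_norm x η
            _ = 2 * ‖x‖ * (‖l‖ * ‖η‖) := by ring
            _ ≤ 2 * ‖x‖ * 1 := by gcongr
            _ = _ := mul_one _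
        have h32 : ‖l ^ 2 * (‖η‖ : ℂ) ^ 2‖ ≤ 1 := by
          rw [← mul_pow, norm_pow, norm_mul, Complex.norm_real, norm_norm]
          exact pow_le_one₀ (by positivity) hlη1
        exact (norm_add_le _ _).trans (add_le_add h31 h32)
      have h4 : -(q * (4 * w)⁻¹).re ≤ (2 * ‖x‖ + 1) * d := by
        have := Complex.abs_re_le_norm (q * (4 * w)⁻¹)
        have h5 : ‖q * (4 * w)⁻¹‖ ≤ (2 * ‖x‖ + 1) * d := by
          rw [norm_mul]; gcongr
        linarith [neg_abs_le (q * (4 * w)⁻¹).re]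
      have h5 : ‖x‖ ^ 2 * c ≤ ‖x‖ ^ 2 * ((4 * w)⁻¹).re := by gcongr
      have h6 : 0 ≤ (c * ‖x‖ - 2 * d) ^ 2 / (2 * c) := by positivity
      have h7 : (c * ‖x‖ - 2 * d) ^ 2 / (2 * c) =
          c / 2 * ‖x‖ ^ 2 - 2 * ‖x‖ * d + 2 * d ^ 2 / c := by
        field_simp; ring
      nlinarith

/-- Remainder estimate for Taylor polynomials, by Cauchy's estimates on a disc of radius `L`. -/
theorem norm_sub_taylor_le {g : ℂ → ℂ} {L M : ℝ} (hL : 2 ≤ L)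
    (hd : ∀ z, ‖z‖ ≤ L → DifferentiableAt ℂ g z) (hM : ∀ z, ‖z‖ ≤ L → ‖g z‖ ≤ M) (m : ℕ) :
    ‖g 1 - ∑ j ∈ Finset.range (m + 1), (j.factorial : ℂ)⁻¹ * iteratedDeriv j g 0‖
      ≤ 2 * M * (L⁻¹) ^ (m + 1) := by
  have hL0 : 0 < L := by linarith
  have hdiff : DifferentiableOn ℂ g (Metric.closedBall 0 L) := fun z hz =>
    (hd z (by simpa using hz)).differentiableWithinAt
  have hsum := Complex.hasSum_taylorSeries_on_ball (hdiff.mono Metric.ball_subset_closedBall)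
    (z := 1) (by simp; linarith)
  simp only [sub_zero, one_pow, one_mul, smul_eq_mul] at hsum
  have hcoef : ∀ j, ‖(j.factorial : ℂ)⁻¹ * iteratedDeriv j g 0‖ ≤ M * (L⁻¹) ^ j := by
    intro j
    have h := Complex.norm_iteratedDeriv_le_of_forall_mem_sphere_norm_le j hL0
      (hdiff.diffContOnCl_ball (subset_refl _)) (C := M) (fun z hz => hM z (by
        rw [mem_sphere_zero_iff_norm] at hz; exact hz.le))
    rw [norm_mul, norm_inv, Complex.norm_natCast]
    have hj : (0 : ℝ) < j.factorial := by positivity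
    calc (j.factorial : ℝ)⁻¹ * ‖iteratedDeriv j g 0‖
        ≤ (j.factorial : ℝ)⁻¹ * (j.factorial * M / L ^ j) := by gcongr
      _ = _ := by rw [inv_pow]; field_simp
  have htail := (hasSum_nat_add_iff' (m + 1)).2 hsum
  have hM0 : 0 ≤ M := (norm_nonneg _).trans (hM 0 (by simpa using hL0.le))
  have hLi : L⁻¹ ≤ 1 / 2 := by rw [one_div]; gcongr
  have hgeom : HasSum (fun j => M * (L⁻¹) ^ (m + 1) * (1 / 2 : ℝ) ^ j) (M * (L⁻¹) ^ (m + 1) * 2) :=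
    hasSum_geometric_two.mul_left _
  calc _ ≤ M * (L⁻¹) ^ (m + 1) * 2 := by
        refine HasSum.norm_le_of_bounded htail hgeom fun j => ?_
        refine (hcoef _).trans ?_
        rw [add_comm j, pow_add, ← mul_assoc]
        gcongr
    _ = _ := by ring

/-- The Gaussian kernel differs from its parabolic Taylor polynomial of order `m` by a term of
order `m + 1`, with a Gaussian bound in `x`. -/
theorem exists_norm_gaussian_sub_heatPoly_le {ν : ℂ} (hν : 0 < ν.re) (m : ℕ) :
    ∃ r C c : ℝ, 0 < r ∧ r ≤ 1 / 2 ∧ 0 < C ∧ 0 < c ∧ ∀ (σ : ℝ) (η x : E n), 0 ≤ σ →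
      √σ + ‖η‖ < r →
      ‖gaussian ((1 - σ) * ν) (x - η) - heatPoly ν m σ η x‖
        ≤ C * (√σ + ‖η‖) ^ (m + 1) * Real.exp (-c * ‖x‖ ^ 2) := by
  obtain ⟨r, C, c, hr0, hr1, hC, hc, hcurve⟩ := exists_norm_gaussianCurve_le (n := n) hν
  refine ⟨r / 2, 2 * C * (r⁻¹) ^ (m + 1), c, by positivity, by linarith, by positivity, hc, ?_⟩
  intro σ η x hσ hlt
  set g := gaussianCurve ν σ η x with hg
  have hsq := Real.sqrt_nonneg σ
  have hη := norm_nonneg η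
  -- `ρ` is a strictly positive upper bound of the parabolic distance
  have key : ∀ ρ : ℝ, √σ + ‖η‖ < ρ → ρ ≤ r / 2 →
      ‖gaussian ((1 - σ) * ν) (x - η) - heatPoly ν m σ η x‖
        ≤ 2 * C * (r⁻¹) ^ (m + 1) * ρ ^ (m + 1) * Real.exp (-c * ‖x‖ ^ 2) := by
    intro ρ hρ hρr
    have hρ0 : 0 < ρ := by linarith
    have hb : ∀ l : ℂ, ‖l‖ ≤ r / ρ → ‖l‖ * √σ ≤ r ∧ ‖l‖ * ‖η‖ ≤ r := by
      intro l hl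
      have h1 : ‖l‖ * ρ ≤ r := by rwa [le_div_iff₀ hρ0] at hl
      constructor
      · refine le_trans ?_ h1
        gcongr; linarith
      · refine le_trans ?_ h1
        gcongr; linarith
    have hL : 2 ≤ r / ρ := by rw [le_div_iff₀ hρ0]; linarith
    have htay := norm_sub_taylor_le (g := g) hL
      (fun z hz => (hcurve σ η x z hσ (hb z hz).1 (hb z hz).2).1)
      (fun z hz => (hcurve σ η x z hσ (hb z hz).1 (hb z hz).2).2) m
    have hdiff : DifferentiableOn ℂ g (Metric.ball 0 (r / ρ)) := fun z hz => by
      have hz' : ‖z‖ ≤ r / ρ := by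
        rw [mem_ball_zero_iff] at hz; exact hz.le
      exact (hcurve σ η x z hσ (hb z hz').1 (hb z hz').2).1.differentiableWithinAt
    have hcoef : (fun j => (j.factorial : ℂ)⁻¹ * iteratedDeriv j g 0)
        = heatSeriesCoeff ν σ η x := by
      refine coeff_eq_of_hasSum_real (F := fun l => g l) ?_ ?_
      · have : ∀ᶠ l : ℝ in 𝓝 0, |l| < r / ρ :=
          (continuous_abs.tendsto 0).eventually_lt_const (by simpa using by positivity)
        filter_upwards [this] with l hl
        have h := Complex.hasSum_taylorSeries_on_ball hdiff (z := (l : ℂ)) (by simpa using hl)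
        refine h.congr_fun fun j => ?_
        simp only [sub_zero, smul_eq_mul]; ring
      · have hcont : Continuous fun l : ℝ => l ^ 2 * σ * ‖ν‖ := by fun_prop
        have : ∀ᶠ l : ℝ in 𝓝 0, l ^ 2 * σ * ‖ν‖ < ν.re / 2 :=
          (hcont.tendsto 0).eventually_lt_const (by simpa using hν)
        filter_upwards [this] with l hl
        rw [hg, gaussianCurve_ofReal]
        exact hasSum_heatSeriesCoeff hν hσ η x hl.le
    have hg1 : g 1 = gaussian ((1 - σ) * ν) (x - η) := by
      have := gaussianCurve_ofReal ν σ η x 1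
      simpa using this
    have hs : ∑ j ∈ Finset.range (m + 1), (j.factorial : ℂ)⁻¹ * iteratedDeriv j g 0
        = heatPoly ν m σ η x := by
      rw [← sum_heatSeriesCoeff hν]
      exact Finset.sum_congr rfl fun j _ => congrFun hcoef j
    rw [hg1, hs] at htay
    refine htay.trans (le_of_eq ?_)
    rw [inv_div, div_pow, inv_pow]
    field_simp
  -- `ρ` decreases to `√σ + ‖η‖`, which may vanish and is therefore not used as a radius itself
  have hlim : Tendsto (fun ρ : ℝ => 2 * C * (r⁻¹) ^ (m + 1) * ρ ^ (m + 1) *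
      Real.exp (-c * ‖x‖ ^ 2)) (𝓝[>] (√σ + ‖η‖))
      (𝓝 (2 * C * (r⁻¹) ^ (m + 1) * (√σ + ‖η‖) ^ (m + 1) * Real.exp (-c * ‖x‖ ^ 2))) := by
    have hcont : Continuous fun ρ : ℝ => 2 * C * (r⁻¹) ^ (m + 1) * ρ ^ (m + 1) *
      Real.exp (-c * ‖x‖ ^ 2) := by fun_prop
    exact (hcont.tendsto _).mono_left nhdsWithin_le_nhds
  refine ge_of_tendsto hlim ?_
  filter_upwards [Ioo_mem_nhdsGT hlt] with ρ hρ
  exact key ρ hρ.1 hρ.2.le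

/-! ### Kernel bounds for the remainder -/

/-- A finite sum of functions dominated by multiples of `B` is dominated by a multiple of `B`. -/
theorem exists_norm_sum_le {ι Z : Type*} (s : Finset ι) {F : ι → Z → ℂ} {B : Z → ℝ}
    (h : ∀ i ∈ s, ∃ C : ℝ, ∀ z, ‖F i z‖ ≤ C * B z) :
    ∃ C : ℝ, ∀ z, ‖∑ i ∈ s, F i z‖ ≤ C * B z := by
  classical
  choose! C hC using h
  refine ⟨∑ i ∈ s, C i, fun z => ?_⟩
  rw [Finset.sum_mul]
  exact norm_sum_le_of_le _ fun i hi => hC i hi z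

theorem continuous_monomial (β : Fin n → ℕ) : Continuous (monomial β : E n → ℝ) := by
  unfold monomial
  fun_prop

theorem continuous_hermite (ν : ℂ) (α : Fin n → ℕ) : Continuous (hermite ν α : E n → ℂ) := by
  unfold hermite
  have := fun β : Fin n → ℕ => continuous_monomial β
  fun_prop

theorem exists_norm_hermite_le (ν : ℂ) (α : Fin n → ℕ) :
    ∃ C : ℝ, ∀ x : E n, ‖hermite ν α x‖ ≤ C * (1 + ‖x‖) ^ length α := by
  refine exists_norm_sum_le (Z := E n) (indicesTwoLe α)
    (F := fun β x => (-1) ^ length β * (multiFactorial α : ℂ)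
      / ((multiFactorial β : ℂ) * (multiFactorial (fun j => α j - 2 * β j) : ℂ))
      * (ν ^ length (fun j => α j - β j))⁻¹
      * (monomial (fun j => α j - 2 * β j) x : ℂ)) fun β hβ => ?_
  refine ⟨‖(-1) ^ length β * (multiFactorial α : ℂ)
      / ((multiFactorial β : ℂ) * (multiFactorial (fun j => α j - 2 * β j) : ℂ))
      * (ν ^ length (fun j => α j - β j))⁻¹‖, fun x => ?_⟩
  rw [norm_mul]
  refine mul_le_mul_of_nonneg_left ?_ (norm_nonneg _)
  rw [Complex.norm_real, Real.norm_eq_abs]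
  calc _ ≤ ‖x‖ ^ length (fun j => α j - 2 * β j) := norm_monomial_le _ _
    _ ≤ (1 + ‖x‖) ^ length (fun j => α j - 2 * β j) := by gcongr; linarith
    _ ≤ (1 + ‖x‖) ^ length α := by
        refine pow_le_pow_right₀ (by linarith [norm_nonneg x]) ?_
        exact Finset.sum_le_sum fun j _ => Nat.sub_le _ _

theorem exists_norm_hermite_mul_gaussian_le {ν : ℂ} (hν : 0 < ν.re) :
    ∃ c : ℝ, 0 < c ∧ ∀ α : Fin n → ℕ, ∃ C : ℝ, ∀ x : E n,
      ‖hermite ν α x * gaussian ν x‖ ≤ C * Real.exp (-c * ‖x‖ ^ 2) := by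
  have hr := inv_four_mul_re_pos hν
  set d := ((4 * ν)⁻¹).re with hd
  refine ⟨d / 2, half_pos hr, fun α => ?_⟩
  obtain ⟨C, hC⟩ := exists_norm_hermite_le ν α
  obtain ⟨D, hD0, hD⟩ := one_add_pow_le_exp (length α) (half_pos hr)
  refine ⟨|C| * D * ‖4 * (Real.pi : ℂ) * ν‖ ^ (-(n : ℝ) / 2), fun x => ?_⟩
  rw [norm_mul, norm_gaussian, ← hd]
  calc _ ≤ (|C| * (D * Real.exp (d / 2 * ‖x‖ ^ 2))) *
        (‖4 * (Real.pi : ℂ) * ν‖ ^ (-(n : ℝ) / 2) * Real.exp (-‖x‖ ^ 2 * d)) := by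
        gcongr
        refine (hC x).trans ?_
        gcongr
        · exact le_abs_self C
        · exact hD _ (norm_nonneg x)
    _ = |C| * D * ‖4 * (Real.pi : ℂ) * ν‖ ^ (-(n : ℝ) / 2) *
        (Real.exp (d / 2 * ‖x‖ ^ 2) * Real.exp (-‖x‖ ^ 2 * d)) := by ring
    _ = _ := by rw [← Real.exp_add]; congr 2; ring

theorem integrable_hermite_mul_gaussian {ν : ℂ} (hν : 0 < ν.re) (α : Fin n → ℕ) :
    Integrable (fun x : E n => hermite ν α x * gaussian ν x) := by
  obtain ⟨c, hc, h⟩ := exists_norm_hermite_mul_gaussian_le (n := n) hν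
  obtain ⟨C, hC⟩ := h α
  exact ((integrable_exp_neg_mul_sq_norm hc).const_mul C).mono'
    ((continuous_hermite ν α).mul (continuous_gaussian ν)).aestronglyMeasurable
    (Eventually.of_forall hC)

theorem exists_norm_heatPoly_le {ν : ℂ} (hν : 0 < ν.re) (m : ℕ) :
    ∃ C c : ℝ, 0 < c ∧ ∀ (σ : ℝ) (η x : E n), 0 ≤ σ →
      ‖heatPoly ν m σ η x‖ ≤ C * ((1 + (√σ + ‖η‖)) ^ m * Real.exp (-c * ‖x‖ ^ 2)) := by
  obtain ⟨c, hc, hH⟩ := exists_norm_hermite_mul_gaussian_le (n := n) hν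
  have key : ∃ C : ℝ, ∀ z : {σ : ℝ // 0 ≤ σ} × E n × E n,
      ‖∑ γ ∈ indicesHalf n m, ∑ k ∈ Finset.range (m - 2 * length γ + 1), ∑ β ∈ indicesEq n k,
        (-ν) ^ length γ / (multiFactorial γ : ℂ) * (z.1.1 : ℂ) ^ length γ *
        (((-2 : ℂ) ^ length (fun j => 2 * γ j))⁻¹ * (((2 : ℂ) ^ k)⁻¹ *
        ((multiFactorial β : ℂ)⁻¹ * (monomial β z.2.1 : ℂ) *
          (hermite ν ((fun j => 2 * γ j) + β) z.2.2 * gaussian ν z.2.2))))‖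
        ≤ C * ((1 + (√z.1.1 + ‖z.2.1‖)) ^ m * Real.exp (-c * ‖z.2.2‖ ^ 2)) := by
    refine exists_norm_sum_le _ fun γ hγ => exists_norm_sum_le _ fun k hk =>
      exists_norm_sum_le _ fun β hβ => ?_
    obtain ⟨C, hC⟩ := hH ((fun j => 2 * γ j) + β)
    refine ⟨‖(-ν) ^ length γ / (multiFactorial γ : ℂ)‖ *
      ‖((-2 : ℂ) ^ length (fun j => 2 * γ j))⁻¹‖ * ‖((2 : ℂ) ^ k)⁻¹‖ *
      ‖(multiFactorial β : ℂ)⁻¹‖ * |C|, ?_⟩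
    rintro ⟨⟨σ, hσ⟩, η, x⟩
    rw [mem_indicesHalf] at hγ
    rw [mem_indicesEq] at hβ
    rw [Finset.mem_range] at hk
    have hρ1 : 1 ≤ 1 + (√σ + ‖η‖) := by linarith [Real.sqrt_nonneg σ, norm_nonneg η]
    have h1 : σ ^ length γ * ‖η‖ ^ k ≤ (1 + (√σ + ‖η‖)) ^ m := by
      calc σ ^ length γ * ‖η‖ ^ k = √σ ^ (2 * length γ) * ‖η‖ ^ k := by
            rw [pow_mul, Real.sq_sqrt hσ]
        _ ≤ (1 + (√σ + ‖η‖)) ^ (2 * length γ) * (1 + (√σ + ‖η‖)) ^ k := by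
            gcongr
            · linarith [norm_nonneg η]
            · linarith [Real.sqrt_nonneg σ]
        _ = (1 + (√σ + ‖η‖)) ^ (2 * length γ + k) := (pow_add _ _ _).symm
        _ ≤ _ := pow_le_pow_right₀ hρ1 (by omega)
    have h2 : ‖(monomial β η : ℂ)‖ ≤ ‖η‖ ^ k := by
      rw [Complex.norm_real, Real.norm_eq_abs, ← hβ]; exact norm_monomial_le β η
    have h3 := hC x
    simp only [norm_mul, norm_pow, Complex.norm_real, Real.norm_of_nonneg hσ] at h2 h3 ⊢
    set e := Real.exp (-c * ‖x‖ ^ 2)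
    have h4 : ‖hermite ν ((fun j => 2 * γ j) + β) x‖ * ‖gaussian ν x‖ ≤ |C| * e :=
      h3.trans (by gcongr; exact le_abs_self C)
    calc _ ≤ ‖(-ν) ^ length γ / (multiFactorial γ : ℂ)‖ * σ ^ length γ *
          (‖((-2 : ℂ) ^ length (fun j => 2 * γ j))⁻¹‖ * (‖((2 : ℂ) ^ k)⁻¹‖ *
          (‖(multiFactorial β : ℂ)⁻¹‖ * ‖η‖ ^ k * (|C| * e)))) := by
          gcongr
      _ = ‖(-ν) ^ length γ / (multiFactorial γ : ℂ)‖ *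
          ‖((-2 : ℂ) ^ length (fun j => 2 * γ j))⁻¹‖ * ‖((2 : ℂ) ^ k)⁻¹‖ *
          ‖(multiFactorial β : ℂ)⁻¹‖ * |C| * ((σ ^ length γ * ‖η‖ ^ k) * e) := by
          ring
      _ ≤ _ := by gcongr
  obtain ⟨C, hC⟩ := key
  refine ⟨C, c, hc, fun σ η x hσ => ?_⟩
  refine le_trans (le_of_eq ?_) (hC (⟨σ, hσ⟩, η, x))
  simp only [heatPoly, Finset.mul_sum]

/-- Before the cut-off the Gaussians have a common Gaussian bound. -/
theorem norm_gaussian_of_lt_half {ν : ℂ} (hν : 0 < ν.re) {σ : ℝ} (hσ : 0 ≤ σ) (h : σ < 1 / 2)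
    (x : E n) : ‖gaussian ((1 - σ) * ν) x‖ ≤
      ‖2 * (Real.pi : ℂ) * ν‖ ^ (-(n : ℝ) / 2) * Real.exp (-((4 * ν)⁻¹).re * ‖x‖ ^ 2) := by
  have hr := inv_four_mul_re_pos hν
  have hν0 : ν ≠ 0 := by rintro rfl; simp at hν
  have h1 : (1 - (σ : ℂ)) * ν = ((1 - σ : ℝ) : ℂ) * ν := by push_cast; rfl
  rw [norm_gaussian, h1]
  have h2 : (4 * (((1 - σ : ℝ) : ℂ) * ν))⁻¹ = (((1 - σ)⁻¹ : ℝ) : ℂ) * (4 * ν)⁻¹ := by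
    push_cast
    rw [mul_inv, mul_inv, mul_inv]; ring
  rw [h2, Complex.re_ofReal_mul]
  have hpi := Real.pi_pos
  have hνn : 0 < ‖ν‖ := norm_pos_iff.2 hν0
  gcongr ?_ * Real.exp ?_
  · refine Real.rpow_le_rpow_of_nonpos ?_ ?_ ?_
    · simp [hν0, Real.pi_ne_zero]
    · simp only [norm_mul, Complex.norm_ofNat, Complex.norm_real, Real.norm_of_nonneg hpi.le,
        Real.norm_of_nonneg (by linarith : 0 ≤ 1 - σ)]
      have : 0 ≤ Real.pi * ‖ν‖ := by positivity
      nlinarith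
    · have : (0 : ℝ) ≤ n := Nat.cast_nonneg n
      linarith
  · have h3 : 1 ≤ (1 - σ)⁻¹ := (one_le_inv₀ (by linarith)).2 (by linarith)
    have h4 : 0 ≤ ‖x‖ ^ 2 * ((4 * ν)⁻¹).re := by positivity
    nlinarith

/-- The kernel `1_{σ < 1/2} G_{(1-σ)ν}(x - η)` minus its parabolic Taylor polynomial. -/
def heatRem (ν : ℂ) (m : ℕ) (σ : ℝ) (η x : E n) : ℂ :=
  (if σ < 1 / 2 then gaussian ((1 - σ) * ν) (x - η) else 0) - heatPoly ν m σ η x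

/-- Bounds for the remainder kernel in `L^∞` and in `L¹` with respect to `x`. For `√σ + |η|` small
they come from the Taylor expansion, otherwise each term of the difference is bounded separately. -/
theorem exists_heatRem_le {ν : ℂ} (hν : 0 < ν.re) (m : ℕ) :
    ∃ C : ℝ, 0 ≤ C ∧ ∀ (σ : ℝ) (η : E n), 0 ≤ σ →
      (∀ x, ‖heatRem ν m σ η x‖ₑ ≤
        ENNReal.ofReal (C * ((√σ + ‖η‖) ^ m * min 1 (√σ + ‖η‖)))) ∧
      ∫⁻ x, ‖heatRem ν m σ η x‖ₑ ≤
        ENNReal.ofReal (C * ((√σ + ‖η‖) ^ m * min 1 (√σ + ‖η‖))) := by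
  obtain ⟨r, C₁, c₁, hr0, hr1, hC₁, hc₁, h₁⟩ := exists_norm_gaussian_sub_heatPoly_le (n := n) hν m
  obtain ⟨C₂, c₂, hc₂, h₂⟩ := exists_norm_heatPoly_le (n := n) hν m
  have hc₃ := inv_four_mul_re_pos hν
  set c₃ := ((4 * ν)⁻¹).re
  set C₃ := ‖2 * (Real.pi : ℂ) * ν‖ ^ (-(n : ℝ) / 2)
  have hC₃ : 0 ≤ C₃ := by positivity
  set I : ℝ → ℝ := fun c => ∫ x : E n, Real.exp (-c * ‖x‖ ^ 2) with hI
  have hI0 : ∀ c, 0 ≤ I c := fun c => integral_nonneg fun x => (Real.exp_pos _).le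
  -- all three kernels are bounded by sums of (translated) Gaussians
  have hpt : ∀ (σ : ℝ) (η x : E n), 0 ≤ σ → ‖heatRem ν m σ η x‖ ≤
      ((C₁ * Real.exp (-c₁ * ‖x‖ ^ 2) + r⁻¹ * (|C₂| * (1 + r⁻¹) ^ m * Real.exp (-c₂ * ‖x‖ ^ 2)
        + C₃ * (r⁻¹) ^ m * Real.exp (-c₃ * ‖x - η‖ ^ 2))) *
        ((√σ + ‖η‖) ^ m * min 1 (√σ + ‖η‖))) := by
    intro σ η x hσ
    set ρ := √σ + ‖η‖ with hρ
    have hsq := Real.sqrt_nonneg σ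
    have hηn := norm_nonneg η
    have hρ0 : 0 ≤ ρ := by positivity
    rcases lt_or_ge ρ r with hlt | hge
    · have hσ2 : σ < 1 / 2 := by
        have : √σ < 1 / 2 := by linarith
        nlinarith [Real.sq_sqrt hσ]
      rw [heatRem, if_pos hσ2, min_eq_right (by linarith), ← pow_succ]
      calc _ ≤ C₁ * ρ ^ (m + 1) * Real.exp (-c₁ * ‖x‖ ^ 2) := h₁ σ η x hσ hlt
        _ = C₁ * Real.exp (-c₁ * ‖x‖ ^ 2) * ρ ^ (m + 1) := by ring
        _ ≤ _ := by
          gcongr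
          have : 0 ≤ r⁻¹ * (|C₂| * (1 + r⁻¹) ^ m * Real.exp (-c₂ * ‖x‖ ^ 2)
            + C₃ * (r⁻¹) ^ m * Real.exp (-c₃ * ‖x - η‖ ^ 2)) := by positivity
          linarith
    · have hri : 1 ≤ r⁻¹ * ρ := by
        rw [← div_eq_inv_mul, le_div_iff₀ hr0]; linarith
      have hmin : 1 ≤ r⁻¹ * min 1 ρ := by
        rw [← div_eq_inv_mul, le_div_iff₀ hr0, one_mul]
        exact le_min (by linarith) hge
      have hA : ‖heatPoly ν m σ η x‖ ≤
          |C₂| * (1 + r⁻¹) ^ m * Real.exp (-c₂ * ‖x‖ ^ 2) * ρ ^ m := by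
        refine (h₂ σ η x hσ).trans ?_
        calc C₂ * ((1 + ρ) ^ m * Real.exp (-c₂ * ‖x‖ ^ 2))
            ≤ |C₂| * (((1 + r⁻¹) * ρ) ^ m * Real.exp (-c₂ * ‖x‖ ^ 2)) := by
              gcongr
              · exact le_abs_self _
              · linarith
          _ = _ := by rw [mul_pow]; ring
      have hB : ‖(if σ < 1 / 2 then gaussian ((1 - σ) * ν) (x - η) else 0 : ℂ)‖ ≤
          C₃ * (r⁻¹) ^ m * Real.exp (-c₃ * ‖x - η‖ ^ 2) * ρ ^ m := by
        have h5 : 1 ≤ (r⁻¹) ^ m * ρ ^ m := by rw [← mul_pow]; exact one_le_pow₀ hri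
        split_ifs with h
        · calc _ ≤ C₃ * Real.exp (-c₃ * ‖x - η‖ ^ 2) := norm_gaussian_of_lt_half hν hσ h _
            _ ≤ C₃ * Real.exp (-c₃ * ‖x - η‖ ^ 2) * ((r⁻¹) ^ m * ρ ^ m) :=
                le_mul_of_one_le_right (by positivity) h5
            _ = _ := by ring
        · rw [norm_zero]; positivity
      rw [heatRem]
      calc _ ≤ _ := norm_sub_le _ _
        _ ≤ (|C₂| * (1 + r⁻¹) ^ m * Real.exp (-c₂ * ‖x‖ ^ 2)
            + C₃ * (r⁻¹) ^ m * Real.exp (-c₃ * ‖x - η‖ ^ 2)) * ρ ^ m := by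
            rw [add_mul]; linarith
        _ ≤ (|C₂| * (1 + r⁻¹) ^ m * Real.exp (-c₂ * ‖x‖ ^ 2)
            + C₃ * (r⁻¹) ^ m * Real.exp (-c₃ * ‖x - η‖ ^ 2)) * ρ ^ m * (r⁻¹ * min 1 ρ) :=
            le_mul_of_one_le_right (by positivity) hmin
        _ = (r⁻¹ * (|C₂| * (1 + r⁻¹) ^ m * Real.exp (-c₂ * ‖x‖ ^ 2)
            + C₃ * (r⁻¹) ^ m * Real.exp (-c₃ * ‖x - η‖ ^ 2))) * (ρ ^ m * min 1 ρ) := by ring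
        _ ≤ _ := by
            have : 0 ≤ C₁ * Real.exp (-c₁ * ‖x‖ ^ 2) := by positivity
            have h6 : 0 ≤ ρ ^ m * min 1 ρ := by positivity
            gcongr
            linarith
  set D₁ := C₁ + r⁻¹ * (|C₂| * (1 + r⁻¹) ^ m + C₃ * (r⁻¹) ^ m) with hD₁
  set D₂ := C₁ * I c₁ + r⁻¹ * (|C₂| * (1 + r⁻¹) ^ m * I c₂ + C₃ * (r⁻¹) ^ m * I c₃) with hD₂
  have hD₁0 : 0 ≤ D₁ := by positivity
  have hD₂0 : 0 ≤ D₂ := by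
    have := hI0 c₁; have := hI0 c₂; have := hI0 c₃
    positivity
  refine ⟨max D₁ D₂, le_max_of_le_left hD₁0, fun σ η hσ => ⟨fun x => ?_, ?_⟩⟩
  · have hw : 0 ≤ (√σ + ‖η‖) ^ m * min 1 (√σ + ‖η‖) := by positivity
    rw [← ofReal_norm]
    refine ENNReal.ofReal_le_ofReal ((hpt σ η x hσ).trans ?_)
    refine mul_le_mul_of_nonneg_right (le_trans ?_ (le_max_left _ _)) hw
    have he : ∀ (c : ℝ) (y : E n), 0 < c → Real.exp (-c * ‖y‖ ^ 2) ≤ 1 := fun c y hc =>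
      Real.exp_le_one_iff.2 (by have : 0 ≤ c * ‖y‖ ^ 2 := by positivity
                                linarith)
    rw [hD₁]
    have e1 := he c₁ x hc₁
    have e2 := he c₂ x hc₂
    have e3 := he c₃ (x - η) hc₃
    have g1 := mul_le_of_le_one_right hC₁.le e1
    have g2 := mul_le_of_le_one_right (by positivity : 0 ≤ |C₂| * (1 + r⁻¹) ^ m) e2
    have g3 := mul_le_of_le_one_right (by positivity : 0 ≤ C₃ * (r⁻¹) ^ m) e3
    exact add_le_add g1 (mul_le_mul_of_nonneg_left (add_le_add g2 g3) (by positivity))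
  · have hw : 0 ≤ (√σ + ‖η‖) ^ m * min 1 (√σ + ‖η‖) := by positivity
    have i1 := (integrable_exp_neg_mul_sq_norm (n := n) hc₁).const_mul C₁
    have i2 := (integrable_exp_neg_mul_sq_norm (n := n) hc₂).const_mul (|C₂| * (1 + r⁻¹) ^ m)
    have i3 := ((integrable_exp_neg_mul_sq_norm (n := n) hc₃).comp_sub_right η).const_mul
      (C₃ * (r⁻¹) ^ m)
    have i4 : Integrable (fun x : E n => r⁻¹ * (|C₂| * (1 + r⁻¹) ^ m * Real.exp (-c₂ * ‖x‖ ^ 2)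
        + C₃ * (r⁻¹) ^ m * Real.exp (-c₃ * ‖x - η‖ ^ 2))) := (i2.add i3).const_mul _
    have i5 : Integrable (fun x : E n => (C₁ * Real.exp (-c₁ * ‖x‖ ^ 2) +
        r⁻¹ * (|C₂| * (1 + r⁻¹) ^ m * Real.exp (-c₂ * ‖x‖ ^ 2)
        + C₃ * (r⁻¹) ^ m * Real.exp (-c₃ * ‖x - η‖ ^ 2))) *
        ((√σ + ‖η‖) ^ m * min 1 (√σ + ‖η‖))) := (i1.add i4).mul_const _
    calc ∫⁻ x, ‖heatRem ν m σ η x‖ₑ ≤ ∫⁻ x, ENNReal.ofReal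
          ((C₁ * Real.exp (-c₁ * ‖x‖ ^ 2) + r⁻¹ * (|C₂| * (1 + r⁻¹) ^ m * Real.exp (-c₂ * ‖x‖ ^ 2)
          + C₃ * (r⁻¹) ^ m * Real.exp (-c₃ * ‖x - η‖ ^ 2))) *
          ((√σ + ‖η‖) ^ m * min 1 (√σ + ‖η‖))) := by
          refine lintegral_mono fun x => ?_
          rw [← ofReal_norm]
          exact ENNReal.ofReal_le_ofReal (hpt σ η x hσ)
      _ = ENNReal.ofReal (D₂ * ((√σ + ‖η‖) ^ m * min 1 (√σ + ‖η‖))) := by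
          rw [← ofReal_integral_eq_lintegral_ofReal i5
            (Eventually.of_forall fun x => by
              show 0 ≤ (C₁ * Real.exp (-c₁ * ‖x‖ ^ 2) + r⁻¹ * (|C₂| * (1 + r⁻¹) ^ m *
                Real.exp (-c₂ * ‖x‖ ^ 2) + C₃ * (r⁻¹) ^ m * Real.exp (-c₃ * ‖x - η‖ ^ 2))) *
                ((√σ + ‖η‖) ^ m * min 1 (√σ + ‖η‖))
              positivity)]
          congr 1
          rw [integral_mul_const, integral_add i1 i4, integral_const_mul, integral_const_mul,
            integral_add i2 i3, integral_const_mul, integral_const_mul,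
            integral_sub_right_eq_self (fun x : E n => Real.exp (-c₃ * ‖x‖ ^ 2)) η]
      _ ≤ _ := by
          refine ENNReal.ofReal_le_ofReal (mul_le_mul_of_nonneg_right (le_max_right _ _) hw)

/-! ### The remainder kernel -/

theorem semigroup_eq_kerOp (ν : ℂ) {τ : ℝ} (hτ : τ ≠ 0) (φ : E n → ℂ) :
    semigroup ν τ φ = kerOp (fun x y => gaussian ((τ : ℂ) * ν) (x - y)) φ := by
  ext x
  rw [semigroup, if_neg hτ, convolution_eq_swap, kerOp]
  rfl

theorem measurable_gaussian_sub (z : ℂ) :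
    Measurable (Function.uncurry fun x y : E n => gaussian z (x - y)) := by
  have h : Continuous fun q : E n × E n => gaussian z (q.1 - q.2) :=
    (continuous_gaussian z).comp (continuous_fst.sub continuous_snd)
  exact h.measurable

/-- The kernel of the heat operator at time `t - s`, cut off at `s < t/2`, minus its parabolic
Taylor polynomial at `(s, y) = (0, 0)`. -/
def remKer (ν : ℂ) (m : ℕ) (t s : ℝ) (x y : E n) : ℂ :=
  ((t ^ (-(n : ℝ) / 2) : ℝ) : ℂ) *
    heatRem ν m (s / t) (t ^ (-(1 / 2) : ℝ) • y) (t ^ (-(1 / 2) : ℝ) • x)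

theorem continuous_heatPoly (ν : ℂ) (m : ℕ) (σ : ℝ) :
    Continuous fun q : E n × E n => heatPoly ν m σ q.2 q.1 := by
  have h1 := fun β : Fin n → ℕ => continuous_monomial β
  have h2 := fun α : Fin n → ℕ => continuous_hermite ν α
  have h3 := continuous_gaussian (n := n) ν
  unfold heatPoly
  fun_prop

theorem continuous_heatRem (ν : ℂ) (m : ℕ) (σ : ℝ) :
    Continuous fun q : E n × E n => heatRem ν m σ q.2 q.1 := by
  unfold heatRem
  refine Continuous.sub ?_ (continuous_heatPoly ν m _)
  split_ifs
  · exact (continuous_gaussian _).comp (continuous_fst.sub continuous_snd)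
  · exact continuous_const

theorem continuous_rescale {R : E n → E n → ℂ} (hR : Continuous fun q : E n × E n => R q.2 q.1)
    (c : ℂ) (k : ℝ) : Continuous (Function.uncurry fun x y : E n => c * R (k • y) (k • x)) := by
  have h : Continuous fun q : E n × E n => (k • q.1, k • q.2) := by fun_prop
  exact continuous_const.mul (hR.comp h)

theorem continuous_remKer (ν : ℂ) (m : ℕ) (t s : ℝ) :
    Continuous (Function.uncurry (remKer (n := n) ν m t s)) :=
  continuous_rescale (continuous_heatRem ν m (s / t)) _ _

/-- Parabolic scaling turns the bounds for `heatRem` into an operator bound. The powers of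
`√s + ‖y‖` are separated into a part depending on `s` and a part depending on `y`. -/
theorem exists_scaledNorm_remKer_le {ν : ℂ} (hν : 0 < ν.re) (m : ℕ) :
    ∃ C : ℝ, 0 ≤ C ∧ ∀ (t s : ℝ) (φ : E n → ℂ), 0 < t → 0 ≤ s → AEStronglyMeasurable φ volume →
      ENNReal.ofReal (t ^ ((m : ℝ) / 2)) * scaledNorm t (kerOp (remKer ν m t s) φ) ≤
        ∫⁻ y, ENNReal.ofReal (C * (√s ^ m * min 1 (t ^ (-(1 / 2) : ℝ) * √s) +
          ‖y‖ ^ m * min 1 (t ^ (-(1 / 2) : ℝ) * ‖y‖))) * ‖φ y‖ₑ := by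
  obtain ⟨C, hC, hb⟩ := exists_heatRem_le (n := n) hν m
  refine ⟨C * 2 ^ (m + 1), by positivity, fun t s φ ht hs hφ => ?_⟩
  set k := t ^ (-(1 / 2) : ℝ) with hk
  have hk0 : 0 < k := by positivity
  have hst : 0 ≤ s / t := by positivity
  have hsq : √(s / t) = k * √s := by
    rw [Real.sqrt_div hs, hk, Real.rpow_neg ht.le, ← Real.sqrt_eq_rpow]
    field_simp
  have htk : t ^ ((m : ℝ) / 2) * k ^ m = 1 := by
    rw [hk, ← Real.rpow_natCast, ← Real.rpow_mul ht.le, ← Real.rpow_add ht]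
    convert Real.rpow_zero t using 2
    ring
  -- `ρ` is the parabolic distance of `(s/t, y/√t)` to the origin
  set ρ : E n → ℝ := fun y => k * (√s + ‖y‖) with hρ
  have hρ' : ∀ y : E n, √(s / t) + ‖k • y‖ = ρ y := fun y => by
    rw [hsq, norm_smul, Real.norm_of_nonneg hk0.le, hρ]; ring
  have hρ0 : ∀ y, 0 ≤ ρ y := fun y => by positivity
  have hnn : ENNReal.ofReal (t ^ ((n : ℝ) / 2)) * ENNReal.ofReal (t ^ (-(n : ℝ) / 2)) = 1 := by
    rw [← ENNReal.ofReal_mul (by positivity), ← Real.rpow_add ht]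
    rw [show (n : ℝ) / 2 + -(n : ℝ) / 2 = 0 by ring]
    simp
  have hpref : ‖((t ^ (-(n : ℝ) / 2) : ℝ) : ℂ)‖ₑ = ENNReal.ofReal (t ^ (-(n : ℝ) / 2)) := by
    rw [← ofReal_norm, Complex.norm_real, Real.norm_of_nonneg (by positivity)]
  have hmain : scaledNorm t (kerOp (remKer ν m t s) φ) ≤
      ∫⁻ y, ENNReal.ofReal (C * (ρ y ^ m * min 1 (ρ y))) * ‖φ y‖ₑ := by
    refine scaledNorm_kerOp_le (continuous_remKer ν m t s).measurable hφ (fun y => ?_)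
      (fun y x => ?_)
    · simp only [remKer, enorm_mul, hpref]
      rw [lintegral_const_mul' _ _ ENNReal.ofReal_ne_top,
        lintegral_dilation ht (fun x => ‖heatRem ν m (s / t) (k • y) x‖ₑ), ← hρ' y]
      exact (hb (s / t) (k • y) hst).2
    · simp only [remKer, enorm_mul, hpref]
      rw [← mul_assoc, hnn, one_mul, ← hρ' y]
      exact (hb (s / t) (k • y) hst).1 _
  calc _ ≤ ENNReal.ofReal (t ^ ((m : ℝ) / 2)) *
        ∫⁻ y, ENNReal.ofReal (C * (ρ y ^ m * min 1 (ρ y))) * ‖φ y‖ₑ := by gcongr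
    _ = ∫⁻ y, ENNReal.ofReal (t ^ ((m : ℝ) / 2) * (C * (ρ y ^ m * min 1 (ρ y)))) * ‖φ y‖ₑ := by
        rw [← lintegral_const_mul' _ _ ENNReal.ofReal_ne_top]
        refine lintegral_congr fun y => ?_
        rw [← mul_assoc, ← ENNReal.ofReal_mul (by positivity)]
    _ ≤ _ := by
        refine lintegral_mono fun y => mul_le_mul_left (ENNReal.ofReal_le_ofReal ?_) _
        have h1 : t ^ ((m : ℝ) / 2) * (C * (ρ y ^ m * min 1 (ρ y)))
            = C * ((√s + ‖y‖) ^ m * min 1 (ρ y)) := by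
          rw [hρ]
          simp only [mul_pow]
          linear_combination (C * (√s + ‖y‖) ^ m * min 1 (k * (√s + ‖y‖))) * htk
        rw [h1, mul_assoc]
        refine mul_le_mul_of_nonneg_left ?_ hC
        -- bound the sum `√s + ‖y‖` by twice the larger term
        have hm : ∀ a b : ℝ, 0 ≤ a → a ≤ b →
            (b + a) ^ m * min 1 (k * (b + a)) ≤ 2 ^ (m + 1) * (b ^ m * min 1 (k * b)) := by
          intro a b ha hab
          have hb0 : 0 ≤ b := ha.trans hab
          have h2 : min 1 (k * (b + a)) ≤ 2 * min 1 (k * b) := by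
            rw [mul_min_of_nonneg _ _ (by norm_num : (0 : ℝ) ≤ 2)]
            refine min_le_min (by norm_num) ?_
            have : k * a ≤ k * b := by gcongr
            linarith
          calc _ ≤ (2 * b) ^ m * (2 * min 1 (k * b)) := by
                gcongr
                · linarith
            _ = _ := by rw [mul_pow, pow_succ]; ring
        have hs0 := Real.sqrt_nonneg s
        have hy0 := norm_nonneg y
        have p1 : 0 ≤ √s ^ m * min 1 (k * √s) := by positivity
        have p2 : 0 ≤ ‖y‖ ^ m * min 1 (k * ‖y‖) := by positivity
        rcases le_total (√s) ‖y‖ with h | h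
        · have := hm (√s) ‖y‖ hs0 h
          rw [add_comm ‖y‖] at this
          refine this.trans ?_
          gcongr
          linarith
        · refine (hm ‖y‖ (√s) hy0 h).trans ?_
          gcongr
          linarith

/-- The integral kernel of the operator `φ ↦ Λ_{α,N}(t; φ)`. -/
def lamKer (ν : ℂ) (α : Fin n → ℕ) (N : ℕ) (t : ℝ) (x y : E n) : ℂ :=
  ((-2 : ℂ) ^ length α)⁻¹ * ((t ^ (-(length α : ℝ) / 2) : ℝ) : ℂ) *
    ∑ k ∈ Finset.range (N + 1), ((2 : ℂ) ^ k)⁻¹ * ((t ^ (-(k : ℝ) / 2) : ℝ) : ℂ) *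
      ∑ β ∈ indicesEq n k, ((multiFactorial β : ℂ)⁻¹ * (monomial β y : ℂ)) *
        dilation t (fun y => hermite ν (α + β) y * gaussian ν y) x

/-- Integrating the kernel `lamKer` against `φ` produces the moments of `φ`. -/
theorem integral_lamKer (ν : ℂ) (α : Fin n → ℕ) {N : ℕ} (t : ℝ) {φ : E n → ℂ}
    (hφ : MemWeightedL1 N φ) (x : E n) :
    Integrable (fun y => lamKer ν α N t x y * φ y) ∧
    ∫ y, lamKer ν α N t x y * φ y = Lam ν α N t φ x := by
  have h1 : ∀ y, lamKer ν α N t x y * φ y =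
      ((-2 : ℂ) ^ length α)⁻¹ * ((t ^ (-(length α : ℝ) / 2) : ℝ) : ℂ) *
      ∑ k ∈ Finset.range (N + 1), ((2 : ℂ) ^ k)⁻¹ * ((t ^ (-(k : ℝ) / 2) : ℝ) : ℂ) *
        ∑ β ∈ indicesEq n k, ((multiFactorial β : ℂ)⁻¹ * dilation t
          (fun y => hermite ν (α + β) y * gaussian ν y) x) * ((monomial β y : ℂ) * φ y) := by
    intro y
    rw [lamKer, mul_assoc, Finset.sum_mul]
    congr 1
    refine Finset.sum_congr rfl fun k _ => ?_
    rw [mul_assoc, Finset.sum_mul]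
    congr 1
    refine Finset.sum_congr rfl fun β _ => ?_
    ring
  have hi : ∀ k ∈ Finset.range (N + 1), ∀ β ∈ indicesEq n k,
      Integrable (fun y => ((multiFactorial β : ℂ)⁻¹ * dilation t
          (fun y => hermite ν (α + β) y * gaussian ν y) x) * ((monomial β y : ℂ) * φ y)) := by
    intro k hk β hβ
    rw [mem_indicesEq] at hβ
    rw [Finset.mem_range] at hk
    exact (hφ.2 β (by omega)).const_mul _
  have hi2 : ∀ k ∈ Finset.range (N + 1), Integrable (fun y =>
      ((2 : ℂ) ^ k)⁻¹ * ((t ^ (-(k : ℝ) / 2) : ℝ) : ℂ) *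
        ∑ β ∈ indicesEq n k, ((multiFactorial β : ℂ)⁻¹ * dilation t
          (fun y => hermite ν (α + β) y * gaussian ν y) x) * ((monomial β y : ℂ) * φ y)) :=
    fun k hk => (integrable_finsetSum _ (hi k hk)).const_mul _
  simp only [h1]
  refine ⟨(integrable_finsetSum _ hi2).const_mul _, ?_⟩
  rw [integral_const_mul, integral_finsetSum _ hi2, Lam]
  congr 1
  refine Finset.sum_congr rfl fun k hk => ?_
  rw [integral_const_mul, integral_finsetSum _ (hi k hk)]
  congr 1
  refine Finset.sum_congr rfl fun β hβ => ?_
  rw [integral_const_mul, moment]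
  ring

theorem monomial_smul (β : Fin n → ℕ) (r : ℝ) (y : E n) :
    monomial β (r • y) = r ^ length β * monomial β y := by
  simp only [monomial, length, PiLp.smul_apply, smul_eq_mul, mul_pow, Finset.prod_mul_distrib,
    Finset.prod_pow_eq_pow_sum]

/-- In the original variables the Taylor polynomial consists of the kernels of the `Λ_{2γ,m-2|γ|}`. -/
theorem remKer_eq {ν : ℂ} (hν : 0 < ν.re) (m : ℕ) {t : ℝ} (ht : 0 < t) (s : ℝ) (x y : E n) :
    remKer ν m t s x y =
      (if s < t / 2 then gaussian (((t - s : ℝ) : ℂ) * ν) (x - y) else 0) -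
      ∑ γ ∈ indicesHalf n m, (-ν) ^ length γ / (multiFactorial γ : ℂ) * (s : ℂ) ^ length γ *
        lamKer ν (fun j => 2 * γ j) (m - 2 * length γ) t x y := by
  have htc : (t : ℂ) ≠ 0 := by exact_mod_cast ht.ne'
  rw [remKer, heatRem, mul_sub]
  congr 1
  · have hiff : s / t < 1 / 2 ↔ s < t / 2 := by
      rw [div_lt_iff₀ ht]
      constructor <;> intro h <;> linarith
    by_cases h : s < t / 2
    · rw [if_pos (hiff.2 h), if_pos h, ← smul_sub, ← gaussian_mul ht]
      · congr 1
        push_cast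
        field_simp
      · have h0 : ν ≠ 0 := by rintro rfl; simp at hν
        refine mul_ne_zero ?_ h0
        have : s / t < 1 := by linarith [hiff.2 h]
        rw [sub_ne_zero]
        exact_mod_cast this.ne'
    · rw [if_neg (fun h' => h (hiff.1 h')), if_neg h, mul_zero]
  · rw [heatPoly, Finset.mul_sum]
    refine Finset.sum_congr rfl fun γ _ => ?_
    rw [lamKer]
    have h1 : ((t ^ (-(length (fun j => 2 * γ j) : ℝ) / 2) : ℝ) : ℂ) = ((t : ℂ) ^ length γ)⁻¹ := by
      have : (length (fun j => 2 * γ j) : ℝ) = 2 * (length γ : ℝ) := by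
        simp only [length, ← Finset.mul_sum]; push_cast; ring
      rw [this, show -(2 * (length γ : ℝ)) / 2 = -(length γ : ℝ) by ring, Real.rpow_neg ht.le,
        Real.rpow_natCast]
      push_cast; rfl
    have h2 : ∀ k : ℕ, ((t ^ (-(1 / 2) : ℝ)) ^ k : ℝ) = t ^ (-(k : ℝ) / 2) := fun k => by
      rw [← Real.rpow_natCast, ← Real.rpow_mul ht.le]
      congr 1; ring
    have h3 : ∑ k ∈ Finset.range (m - 2 * length γ + 1), ((2 : ℂ) ^ k)⁻¹ *
          ((t ^ (-(k : ℝ) / 2) : ℝ) : ℂ) *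
          ∑ β ∈ indicesEq n k, ((multiFactorial β : ℂ)⁻¹ * (monomial β y : ℂ)) *
            dilation t (fun y => hermite ν ((fun j => 2 * γ j) + β) y * gaussian ν y) x =
        ((t ^ (-(n : ℝ) / 2) : ℝ) : ℂ) * ∑ k ∈ Finset.range (m - 2 * length γ + 1),
          ((2 : ℂ) ^ k)⁻¹ * ∑ β ∈ indicesEq n k, (multiFactorial β : ℂ)⁻¹ *
          (monomial β (t ^ (-(1 / 2) : ℝ) • y) : ℂ) *
          (hermite ν ((fun j => 2 * γ j) + β) (t ^ (-(1 / 2) : ℝ) • x) *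
            gaussian ν (t ^ (-(1 / 2) : ℝ) • x)) := by
      rw [Finset.mul_sum]
      refine Finset.sum_congr rfl fun k _ => ?_
      rw [Finset.mul_sum, Finset.mul_sum, Finset.mul_sum]
      refine Finset.sum_congr rfl fun β hβ => ?_
      rw [mem_indicesEq] at hβ
      rw [monomial_smul, hβ, h2, dilation]
      push_cast
      ring
    rw [h1, h3]
    generalize ∑ k ∈ Finset.range (m - 2 * length γ + 1),
          ((2 : ℂ) ^ k)⁻¹ * ∑ β ∈ indicesEq n k, (multiFactorial β : ℂ)⁻¹ *
          (monomial β (t ^ (-(1 / 2) : ℝ) • y) : ℂ) *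
          (hermite ν ((fun j => 2 * γ j) + β) (t ^ (-(1 / 2) : ℝ) • x) *
            gaussian ν (t ^ (-(1 / 2) : ℝ) • x)) = S
    rw [Complex.ofReal_div, div_pow]
    field_simp

theorem MemWeightedL1.mono {k m : ℕ} {φ : E n → ℂ} (h : MemWeightedL1 m φ) (hk : k ≤ m) :
    MemWeightedL1 k φ :=
  ⟨h.1, fun α hα => h.2 α (hα.trans hk)⟩

theorem exists_norm_gaussian_le (z : ℂ) (hz : 0 < z.re) :
    ∃ C : ℝ, ∀ x : E n, ‖gaussian z x‖ ≤ C := by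
  refine ⟨‖4 * (Real.pi : ℂ) * z‖ ^ (-(n : ℝ) / 2), fun x => ?_⟩
  rw [norm_gaussian]
  refine mul_le_of_le_one_right (by positivity) (Real.exp_le_one_iff.2 ?_)
  have := inv_four_mul_re_pos hz
  have : 0 ≤ ‖x‖ ^ 2 * ((4 * z)⁻¹).re := by positivity
  linarith

/-- The remainder operator is the cut-off heat operator minus the parabolic Taylor profile. -/
theorem kerOp_remKer_eq {ν : ℂ} (hν : 0 < ν.re) {m : ℕ} {t : ℝ} (ht : 0 < t) (s : ℝ)
    {φ : E n → ℂ} (hφ : MemWeightedL1 m φ) (x : E n) :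
    kerOp (remKer ν m t s) φ x =
      (if s < t / 2 then semigroup ν (t - s) φ x else 0) -
      ∑ γ ∈ indicesHalf n m, (-ν) ^ length γ / (multiFactorial γ : ℂ) * (s : ℂ) ^ length γ *
        Lam ν (fun j => 2 * γ j) (m - 2 * length γ) t φ x := by
  have hL : ∀ γ : Fin n → ℕ, MemWeightedL1 (m - 2 * length γ) φ := fun γ =>
    hφ.mono (Nat.sub_le _ _)
  have hint : ∀ γ ∈ indicesHalf n m, Integrable (fun y =>
      (-ν) ^ length γ / (multiFactorial γ : ℂ) * (s : ℂ) ^ length γ *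
        (lamKer ν (fun j => 2 * γ j) (m - 2 * length γ) t x y * φ y)) := fun γ _ =>
    (integral_lamKer ν _ t (hL γ) x).1.const_mul _
  have hsum : ∫ y, ∑ γ ∈ indicesHalf n m,
      (-ν) ^ length γ / (multiFactorial γ : ℂ) * (s : ℂ) ^ length γ *
        (lamKer ν (fun j => 2 * γ j) (m - 2 * length γ) t x y * φ y) =
      ∑ γ ∈ indicesHalf n m, (-ν) ^ length γ / (multiFactorial γ : ℂ) * (s : ℂ) ^ length γ *
        Lam ν (fun j => 2 * γ j) (m - 2 * length γ) t φ x := by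
    rw [integral_finsetSum _ hint]
    refine Finset.sum_congr rfl fun γ _ => ?_
    rw [integral_const_mul, (integral_lamKer ν _ t (hL γ) x).2]
  have hG : Integrable (fun y =>
      (if s < t / 2 then gaussian (((t - s : ℝ) : ℂ) * ν) (x - y) else 0) * φ y) ∧
      ∫ y, (if s < t / 2 then gaussian (((t - s : ℝ) : ℂ) * ν) (x - y) else 0) * φ y =
        (if s < t / 2 then semigroup ν (t - s) φ x else 0) := by
    by_cases h : s < t / 2
    · simp only [if_pos h]
      have hts : 0 < t - s := by linarith
      obtain ⟨C, hC⟩ := exists_norm_gaussian_le (n := n) (((t - s : ℝ) : ℂ) * ν)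
        (by rw [Complex.re_ofReal_mul]; positivity)
      refine ⟨integrable_bdd_mul (C := C) ?_ (fun y => hC _) hφ.1, ?_⟩
      · exact ((continuous_gaussian _).comp (continuous_const.sub continuous_id)).measurable
      · rw [semigroup_eq_kerOp ν hts.ne', kerOp]
    · simp [if_neg h]
  rw [kerOp, ← hG.2, ← hsum, ← integral_sub hG.1 (integrable_finsetSum _ hint)]
  refine integral_congr_ae (Eventually.of_forall fun y => ?_)
  simp only [remKer_eq hν m ht, sub_mul, Finset.sum_mul, mul_assoc]

/-- At `s = 0` only the term without time derivatives survives. -/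
theorem kerOp_remKer_zero {ν : ℂ} (hν : 0 < ν.re) {m : ℕ} {t : ℝ} (ht : 0 < t)
    {φ : E n → ℂ} (hφ : MemWeightedL1 m φ) (x : E n) :
    kerOp (remKer ν m t 0) φ x = semigroup ν t φ x - Lam ν 0 m t φ x := by
  rw [kerOp_remKer_eq hν ht 0 hφ, if_pos (by positivity), sub_zero]
  congr 1
  rw [Finset.sum_eq_single 0]
  · simp only [length, multiFactorial, Pi.zero_apply, Finset.sum_const_zero, pow_zero,
      Nat.factorial_zero, Finset.prod_const_one, mul_zero, Nat.sub_zero, Nat.cast_one, div_one,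
      one_mul]
    rfl
  · intro γ _ hγ
    have : length γ ≠ 0 := by
      intro h
      apply hγ
      funext j
      have := le_length γ j
      simp only [Pi.zero_apply]
      omega
    simp [this]
  · intro h
    exact absurd (mem_indicesHalf.2 (by simp [length])) h

/-! ### The nonlinear term as a damped source -/

theorem IsPowerNonlinearity.continuous {p : ℝ} (hp : 1 < p) {f : ℂ → ℂ}
    (hf : IsPowerNonlinearity p f) : Continuous f := by
  obtain ⟨_, K, hK, h⟩ := hf
  rw [continuous_iff_continuousAt]
  intro η
  rw [ContinuousAt, tendsto_iff_norm_sub_tendsto_zero]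
  have hlim : Tendsto (fun ξ : ℂ => K * (‖ξ‖ ^ (p - 1) + ‖η‖ ^ (p - 1)) * ‖ξ - η‖) (𝓝 η) (𝓝 0) := by
    have hc : Continuous fun ξ : ℂ => K * (‖ξ‖ ^ (p - 1) + ‖η‖ ^ (p - 1)) * ‖ξ - η‖ := by
      have : Continuous fun ξ : ℂ => ‖ξ‖ ^ (p - 1) :=
        continuous_norm.rpow_const fun _ => Or.inr (by linarith)
      fun_prop
    simpa using hc.tendsto η
  exact squeeze_zero (fun _ => norm_nonneg _) (fun ξ => h ξ η) hlim

/-- Lipschitz bounds of `f` on balls. -/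
theorem IsPowerNonlinearity.norm_le {p : ℝ} (hp : 1 < p) {f : ℂ → ℂ}
    (hf : IsPowerNonlinearity p f) : ∃ K : ℝ, 0 < K ∧
      (∀ (ξ : ℂ) (M : ℝ), ‖ξ‖ ≤ M → ‖f ξ‖ ≤ K * M ^ (p - 1) * ‖ξ‖) ∧
      ∀ (ξ η : ℂ) (M : ℝ), ‖ξ‖ ≤ M → ‖η‖ ≤ M → ‖f ξ - f η‖ ≤ 2 * K * M ^ (p - 1) * ‖ξ - η‖ := by
  obtain ⟨h0, K, hK, h⟩ := hf
  have hp1 : 0 ≤ p - 1 := by linarith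
  refine ⟨K, hK, fun ξ M hM => ?_, fun ξ η M hξ hη => ?_⟩
  · have := h ξ 0
    rw [h0, sub_zero, sub_zero, norm_zero, Real.zero_rpow (by linarith), add_zero] at this
    exact this.trans (by gcongr)
  · calc _ ≤ K * (‖ξ‖ ^ (p - 1) + ‖η‖ ^ (p - 1)) * ‖ξ - η‖ := h ξ η
      _ ≤ K * (M ^ (p - 1) + M ^ (p - 1)) * ‖ξ - η‖ := by gcongr
      _ = _ := by ring

theorem coeFn_nonlin {p : ℝ} (hp : 1 < p) {f : ℂ → ℂ} (hf : IsPowerNonlinearity p f) {v : L1 n}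
    {M : ℝ} (hM : ∀ᵐ x, ‖v x‖ ≤ M) :
    Integrable (fun x => f (v x)) ∧ nonlin f v =ᵐ[volume] fun x => f (v x) := by
  obtain ⟨K, hK, h1, _⟩ := hf.norm_le hp
  have hi : Integrable (fun x => f (v x)) := by
    refine ((integrable_coe v).norm.const_mul (K * M ^ (p - 1))).mono'
      ((hf.continuous hp).comp_aestronglyMeasurable (Lp.aestronglyMeasurable v)) ?_
    filter_upwards [hM] with x hx
    exact h1 _ _ hx
  exact ⟨hi, coeFn_toL1 hi⟩

theorem norm_nonlin_sub_le {p : ℝ} (hp : 1 < p) {f : ℂ → ℂ} (hf : IsPowerNonlinearity p f) :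
    ∃ K : ℝ, 0 < K ∧ ∀ (v w : L1 n) (M : ℝ), (∀ᵐ x, ‖v x‖ ≤ M) → (∀ᵐ x, ‖w x‖ ≤ M) →
      ‖nonlin f v - nonlin f w‖ ≤ 2 * K * M ^ (p - 1) * ‖v - w‖ := by
  obtain ⟨K, hK, _, h2⟩ := hf.norm_le hp
  refine ⟨K, hK, fun v w M hv hw => Lp.norm_le_mul_norm_of_ae_le_mul ?_⟩
  filter_upwards [hv, hw, (coeFn_nonlin hp hf hv).2, (coeFn_nonlin hp hf hw).2,
    Lp.coeFn_sub v w, Lp.coeFn_sub (nonlin f v) (nonlin f w)] with x h3 h4 h5 h6 h7 h8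
  rw [h7, h8, Pi.sub_apply, Pi.sub_apply, h5, h6]
  exact h2 _ _ M h3 h4

/-- `u` solves the linear inhomogeneous heat equation with datum `u₀` and source `F`, in mild form,
and the source is dominated by `u` with a coefficient decaying like `t^{-θ}`. -/
structure IsDampedMildSolution (ν : ℂ) (θ A : ℝ) (u₀ : E n → ℂ) (u F : ℝ → L1 n) : Prop where
  continuousOn_u : ContinuousOn u (Ici 0)
  continuousOn_F : ContinuousOn F (Ioi 0)
  norm_u_le : ∀ t, 0 ≤ t → ‖u t‖ ≤ A
  pos : 0 ≤ A
  integral_eq : ∀ t, 0 < t →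
    u t = toL1 (semigroup ν t u₀) + ∫ s in (0 : ℝ)..t, toL1 (semigroup ν (t - s) (F s))
  norm_F_le : ∀ t, 0 < t → ∀ᵐ x, ‖F t x‖ ≤ A * (1 + t) ^ (-θ) * ‖u t x‖
  norm_F_le_top : ∀ t, 0 < t → ∀ᵐ x, ‖F t x‖ ≤ A * (1 + t) ^ (-θ - (n : ℝ) / 2)

/-- Decay of the sup norm of a decaying bounded solution. -/
theorem exists_ae_norm_le {u : ℝ → L1 n} (hX : MemX u) (hdecay : Decays u) :
    ∃ M : ℝ, 0 < M ∧ ∀ t, 0 < t → ∀ᵐ x, ‖u t x‖ ≤ M * (1 + t) ^ (-((n : ℝ) / 2)) := by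
  obtain ⟨C, hC⟩ := hdecay
  obtain ⟨C', hC'⟩ := hX.bounded_top
  refine ⟨2 ^ ((n : ℝ) / 2) * (C + C' + 1), by positivity, fun t ht => ?_⟩
  have h1 := hC ∞ le_top t ht
  have h2 := hC' t ht
  rw [decayExponent, ENNReal.inv_top, ENNReal.toReal_zero, sub_zero, mul_one] at h1
  have hne : eLpNorm (u t) ∞ volume ≠ ∞ := (h2.trans_lt ENNReal.coe_lt_top).ne
  set a := (eLpNorm (u t) ∞ volume).toReal with ha
  have h3 : t ^ ((n : ℝ) / 2) * a ≤ C := by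
    have := ENNReal.toReal_mono ENNReal.coe_ne_top h1
    rwa [ENNReal.toReal_mul, ENNReal.toReal_ofReal (by positivity), ENNReal.coe_toReal] at this
  have h4 : a ≤ C' := by
    have := ENNReal.toReal_mono ENNReal.coe_ne_top h2
    rwa [ENNReal.coe_toReal] at this
  have ha0 : 0 ≤ a := ENNReal.toReal_nonneg
  have h5 : (1 + t) ^ ((n : ℝ) / 2) * a ≤ 2 ^ ((n : ℝ) / 2) * (C + C' + 1) := by
    have hC0 : (0 : ℝ) ≤ C := C.2
    have hC0' : (0 : ℝ) ≤ C' := C'.2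
    rcases le_total t 1 with h | h
    · have h21 : 1 + t ≤ 2 := by linarith
      have h22 : a ≤ C + C' + 1 := by linarith
      gcongr
    · calc (1 + t) ^ ((n : ℝ) / 2) * a ≤ (2 * t) ^ ((n : ℝ) / 2) * a := by gcongr; linarith
        _ = 2 ^ ((n : ℝ) / 2) * (t ^ ((n : ℝ) / 2) * a) := by
            rw [Real.mul_rpow (by norm_num) ht.le, mul_assoc]
        _ ≤ _ := by gcongr; linarith
  have h6 : ∀ᵐ x, ‖u t x‖ ≤ a := by
    filter_upwards [enorm_ae_le_eLpNormEssSup (u t) volume] with x hx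
    rw [← eLpNorm_exponent_top, ← ENNReal.ofReal_toReal hne, ← ofReal_norm] at hx
    exact (ENNReal.ofReal_le_ofReal_iff ha0).1 hx
  filter_upwards [h6] with x hx
  refine hx.trans ?_
  rw [Real.rpow_neg (by linarith), ← div_eq_mul_inv, le_div_iff₀ (by positivity), mul_comm]
  exact h5

/-- The nonlinear term of a decaying global solution is a damped source with
`θ = (n/2)(p - 1)`. -/
theorem IsGlobalSolution.exists_isDamped {ν : ℂ} {p : ℝ} (hp : 1 < p) {f : ℂ → ℂ}
    (hf : IsPowerNonlinearity p f) {u₀ : E n → ℂ} {u : ℝ → L1 n}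
    (hu : IsGlobalSolution ν f u₀ u) (hdecay : Decays u) :
    ∃ A : ℝ, IsDampedMildSolution ν ((n : ℝ) / 2 * (p - 1)) A u₀ u fun s => nonlin f (u s) := by
  obtain ⟨M, hM, hMu⟩ := exists_ae_norm_le hu.memX hdecay
  obtain ⟨K, hK, h1, _⟩ := hf.norm_le hp
  obtain ⟨K', hK', h2⟩ := norm_nonlin_sub_le (n := n) hp hf
  obtain ⟨B, hB⟩ := hu.memX.bounded_L1
  have hB0 : 0 ≤ B := (norm_nonneg _).trans (hB 0 le_rfl)
  set A₁ := K * M ^ (p - 1) with hA₁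
  have hA₁0 : 0 ≤ A₁ := by positivity
  have hF : ∀ t, 0 < t → ∀ᵐ x, ‖nonlin f (u t) x‖ ≤
      A₁ * (1 + t) ^ (-((n : ℝ) / 2 * (p - 1))) * ‖u t x‖ := by
    intro t ht
    filter_upwards [hMu t ht, (coeFn_nonlin hp hf (hMu t ht)).2] with x hx hx2
    rw [hx2]
    refine (h1 _ _ hx).trans (le_of_eq ?_)
    rw [Real.mul_rpow hM.le (by positivity), ← Real.rpow_mul (by linarith), neg_mul, ← mul_assoc]
  refine ⟨A₁ + B + A₁ * M, ⟨hu.memX.continuousOn_L1, ?_, fun t ht => ?_, by positivity,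
    hu.integral_eq, fun t ht => ?_, fun t ht => ?_⟩⟩
  · intro t ht
    have hM' : ∀ s, 0 < s → ∀ᵐ x, ‖u s x‖ ≤ M := fun s hs => by
      filter_upwards [hMu s hs] with x hx
      refine hx.trans (mul_le_of_le_one_right hM.le ?_)
      refine Real.rpow_le_one_of_one_le_of_nonpos (by linarith) ?_
      have : (0 : ℝ) ≤ n := Nat.cast_nonneg n
      linarith
    have hc : ContinuousWithinAt u (Ioi 0) t :=
      (hu.memX.continuousOn_L1 t (mem_Ici.2 (mem_Ioi.1 ht).le)).mono Ioi_subset_Ici_self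
    rw [ContinuousWithinAt, tendsto_iff_norm_sub_tendsto_zero] at hc ⊢
    have hlim := hc.const_mul (2 * K' * M ^ (p - 1))
    rw [mul_zero] at hlim
    refine squeeze_zero' (Eventually.of_forall fun _ => norm_nonneg _) ?_ hlim
    filter_upwards [self_mem_nhdsWithin] with s hs
    exact h2 _ _ M (hM' s hs) (hM' t ht)
  · have := hB t ht
    have : 0 ≤ A₁ * M := by positivity
    linarith
  · filter_upwards [hF t ht] with x hx
    refine hx.trans ?_
    have : 0 ≤ A₁ * M := by positivity
    gcongr
    linarith
  · filter_upwards [hF t ht, hMu t ht] with x hx hx2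
    calc _ ≤ A₁ * (1 + t) ^ (-((n : ℝ) / 2 * (p - 1))) * (M * (1 + t) ^ (-((n : ℝ) / 2))) := by
          refine hx.trans ?_
          gcongr
      _ = (A₁ * M) * (1 + t) ^ (-((n : ℝ) / 2 * (p - 1)) - (n : ℝ) / 2) := by
          rw [show -((n : ℝ) / 2 * (p - 1)) - (n : ℝ) / 2
            = -((n : ℝ) / 2 * (p - 1)) + -((n : ℝ) / 2) by ring, Real.rpow_add (by linarith)]
          ring
      _ ≤ _ := by
          gcongr
          linarith

/-! ### The heat semigroup on weighted `L¹` -/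

theorem mul_re_pos {ν : ℂ} (hν : 0 < ν.re) {τ : ℝ} (hτ : 0 < τ) : 0 < ((τ : ℂ) * ν).re := by
  rw [Complex.re_ofReal_mul]; positivity

/-- Weighted mass of the Gaussian. -/
theorem lintegral_weight_gaussian_le {ν : ℂ} (hν : 0 < ν.re) (j : ℕ) :
    ∃ C : ℝ, 0 ≤ C ∧ ∀ τ : ℝ, 0 < τ →
      ∫⁻ x : E n, ENNReal.ofReal ((1 + ‖x‖) ^ j) * ‖gaussian ((τ : ℂ) * ν) x‖ₑ ≤
        ENNReal.ofReal (C * (1 + τ) ^ ((j : ℝ) / 2)) := by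
  have hi := integrable_one_add_pow_mul_gaussian (n := n) j hν
  have hν0 : ν ≠ 0 := by rintro rfl; simp at hν
  have hpos : ∀ x : E n, 0 ≤ (1 + ‖x‖) ^ j * ‖gaussian ν x‖ := fun x => by positivity
  refine ⟨∫ x : E n, (1 + ‖x‖) ^ j * ‖gaussian ν x‖, integral_nonneg hpos, fun τ hτ => ?_⟩
  set k := τ ^ (-(1 / 2) : ℝ) with hk
  have hk0 : 0 < k := by positivity
  have hτk : √τ * k = 1 := by
    rw [hk, Real.sqrt_eq_rpow, ← Real.rpow_add hτ]; simp
  have hpref : ‖((τ ^ (-(n : ℝ) / 2) : ℝ) : ℂ)‖ₑ = ENNReal.ofReal (τ ^ (-(n : ℝ) / 2)) := by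
    rw [← ofReal_norm, Complex.norm_real, Real.norm_of_nonneg (by positivity)]
  have hroot : (1 + τ) ^ ((j : ℝ) / 2) = √(1 + τ) ^ j := by
    rw [Real.sqrt_eq_rpow, ← Real.rpow_natCast, ← Real.rpow_mul (by linarith)]
    congr 1; ring
  calc ∫⁻ x : E n, ENNReal.ofReal ((1 + ‖x‖) ^ j) * ‖gaussian ((τ : ℂ) * ν) x‖ₑ
      = ∫⁻ x : E n, ENNReal.ofReal (τ ^ (-(n : ℝ) / 2)) *
          (ENNReal.ofReal ((1 + √τ * ‖k • x‖) ^ j) * ‖gaussian ν (k • x)‖ₑ) := by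
        refine lintegral_congr fun x => ?_
        rw [gaussian_mul hτ hν0, enorm_mul, hpref, norm_smul, Real.norm_of_nonneg hk0.le,
          ← mul_assoc (√τ), hτk, one_mul]
        ring
    _ = ∫⁻ x : E n, ENNReal.ofReal ((1 + √τ * ‖x‖) ^ j) * ‖gaussian ν x‖ₑ := by
        rw [lintegral_const_mul' _ _ ENNReal.ofReal_ne_top]
        exact lintegral_dilation hτ
          (fun x : E n => ENNReal.ofReal ((1 + √τ * ‖x‖) ^ j) * ‖gaussian ν x‖ₑ)
    _ ≤ ∫⁻ x : E n, ENNReal.ofReal ((1 + τ) ^ ((j : ℝ) / 2)) *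
          ENNReal.ofReal ((1 + ‖x‖) ^ j * ‖gaussian ν x‖) := by
        refine lintegral_mono fun x => ?_
        rw [← ofReal_norm, ← ENNReal.ofReal_mul (by positivity),
          ← ENNReal.ofReal_mul (by positivity)]
        refine ENNReal.ofReal_le_ofReal ?_
        rw [← mul_assoc, hroot, ← mul_pow]
        have h1 : 1 ≤ √(1 + τ) := Real.one_le_sqrt.2 (by linarith)
        have h2 : √τ ≤ √(1 + τ) := Real.sqrt_le_sqrt (by linarith)
        have h3 : √τ * ‖x‖ ≤ √(1 + τ) * ‖x‖ := by gcongr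
        have h4 : 1 + √τ * ‖x‖ ≤ √(1 + τ) * (1 + ‖x‖) := by rw [mul_add, mul_one]; linarith
        gcongr
    _ = _ := by
        rw [lintegral_const_mul' _ _ ENNReal.ofReal_ne_top,
          ← ofReal_integral_eq_lintegral_ofReal hi (Eventually.of_forall hpos),
          ← ENNReal.ofReal_mul (by positivity), mul_comm]

/-- The truncated weight `min (1 + |x|) R ^ j`. -/
def truncWeight (j : ℕ) (R : ℝ) (x : E n) : ℝ := min (1 + ‖x‖) R ^ j

theorem truncWeight_nonneg (j : ℕ) {R : ℝ} (hR : 0 ≤ R) (x : E n) : 0 ≤ truncWeight j R x := by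
  unfold truncWeight; positivity

theorem continuous_truncWeight (j : ℕ) (R : ℝ) : Continuous (truncWeight j R : E n → ℝ) := by
  unfold truncWeight; fun_prop

theorem measurable_truncWeight (j : ℕ) (R : ℝ) :
    Measurable fun x : E n => ((truncWeight j R x : ℝ) : ℂ) :=
  Complex.measurable_ofReal.comp (continuous_truncWeight j R).measurable

theorem truncWeight_le_pow (j : ℕ) {R : ℝ} (hR : 0 ≤ R) (x : E n) :
    truncWeight j R x ≤ (1 + ‖x‖) ^ j := by
  unfold truncWeight
  gcongr
  exact min_le_left _ _

theorem truncWeight_le (j : ℕ) {R : ℝ} (hR : 0 ≤ R) (x : E n) : truncWeight j R x ≤ R ^ j := by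
  unfold truncWeight
  gcongr
  exact min_le_right _ _

theorem norm_truncWeight_le (j : ℕ) {R : ℝ} (hR : 0 ≤ R) (x : E n) :
    ‖((truncWeight j R x : ℝ) : ℂ)‖ ≤ R ^ j := by
  rw [Complex.norm_real, Real.norm_of_nonneg (truncWeight_nonneg j hR x)]
  exact truncWeight_le j hR x

/-- The truncated weights are moderate with respect to `(1 + |x|)^j`, uniformly in `R`. -/
theorem truncWeight_le_mul (j : ℕ) {R : ℝ} (hR : 0 ≤ R) (x y : E n) :
    truncWeight j R x ≤ (1 + ‖x - y‖) ^ j * truncWeight j R y := by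
  unfold truncWeight
  rw [← mul_pow]
  gcongr
  rw [mul_min_of_nonneg _ _ (by positivity)]
  refine min_le_min ?_ (le_mul_of_one_le_left hR (by linarith [norm_nonneg (x - y)]))
  have h1 : ‖x‖ ≤ ‖x - y‖ + ‖y‖ := by simpa using norm_add_le (x - y) y
  nlinarith [norm_nonneg (x - y), norm_nonneg y, mul_nonneg (norm_nonneg (x - y)) (norm_nonneg y)]

/-- Moderateness of the weight transfers the weighted mass of the Gaussian to its translates. -/
theorem lintegral_truncWeight_gaussian_le {ν : ℂ} {j : ℕ} {C τ R : ℝ}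
    (hC : ∫⁻ x : E n, ENNReal.ofReal ((1 + ‖x‖) ^ j) * ‖gaussian ((τ : ℂ) * ν) x‖ₑ ≤
        ENNReal.ofReal C) (hR : 0 ≤ R) (y : E n) :
    ∫⁻ x : E n, ENNReal.ofReal (truncWeight j R x) * ‖gaussian ((τ : ℂ) * ν) (x - y)‖ₑ ≤
      ENNReal.ofReal C * ENNReal.ofReal (truncWeight j R y) := by
  calc _ ≤ ∫⁻ x : E n, (ENNReal.ofReal ((1 + ‖x - y‖) ^ j) *
        ‖gaussian ((τ : ℂ) * ν) (x - y)‖ₑ) * ENNReal.ofReal (truncWeight j R y) := by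
        refine lintegral_mono fun x => ?_
        calc _ ≤ ENNReal.ofReal ((1 + ‖x - y‖) ^ j * truncWeight j R y) *
              ‖gaussian ((τ : ℂ) * ν) (x - y)‖ₑ :=
              mul_le_mul_left (ENNReal.ofReal_le_ofReal (truncWeight_le_mul j hR x y)) _
          _ = _ := by
              rw [ENNReal.ofReal_mul (by positivity)]; ring
    _ = (∫⁻ x : E n, ENNReal.ofReal ((1 + ‖x - y‖) ^ j) *
        ‖gaussian ((τ : ℂ) * ν) (x - y)‖ₑ) * ENNReal.ofReal (truncWeight j R y) :=
        lintegral_mul_const' _ _ ENNReal.ofReal_ne_top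
    _ = (∫⁻ x : E n, ENNReal.ofReal ((1 + ‖x‖) ^ j) *
        ‖gaussian ((τ : ℂ) * ν) x‖ₑ) * ENNReal.ofReal (truncWeight j R y) := by
        rw [lintegral_sub_right_eq_self (fun x : E n => ENNReal.ofReal ((1 + ‖x‖) ^ j) *
          ‖gaussian ((τ : ℂ) * ν) x‖ₑ) y]
    _ ≤ _ := by gcongr

/-- The Gaussians `G_{τν}`, `τ > 0`, have uniformly bounded mass. -/
theorem exists_lintegral_gaussian_le {ν : ℂ} (hν : 0 < ν.re) :
    ∃ C : ℝ≥0, ∀ τ : ℝ, 0 < τ → ∀ y : E n,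
      ∫⁻ x : E n, ‖gaussian ((τ : ℂ) * ν) (x - y)‖ₑ ≤ C := by
  obtain ⟨C, hC, h⟩ := lintegral_weight_gaussian_le (n := n) hν 0
  refine ⟨C.toNNReal, fun τ hτ y => ?_⟩
  have h1 := h τ hτ
  simp only [pow_zero, ENNReal.ofReal_one, one_mul, Nat.cast_zero, zero_div, Real.rpow_zero,
    mul_one] at h1
  rw [lintegral_sub_right_eq_self (fun x : E n => ‖gaussian ((τ : ℂ) * ν) x‖ₑ) y]
  exact h1

theorem integrable_semigroup {ν : ℂ} (hν : 0 < ν.re) {τ : ℝ} (hτ : 0 < τ) {φ : E n → ℂ}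
    (hφ : Integrable φ) : Integrable (semigroup ν τ φ) := by
  obtain ⟨C, hC⟩ := exists_lintegral_gaussian_le (n := n) hν
  rw [semigroup_eq_kerOp ν hτ.ne']
  exact integrable_kerOp (measurable_gaussian_sub _) hφ (hC τ hτ)

theorem enorm_mulL {b : E n → ℂ} {C : ℝ} (hb : Measurable b) (hC : ∀ x, ‖b x‖ ≤ C) (v : L1 n) :
    ‖mulL b C hb hC v‖ₑ = ∫⁻ x, ‖b x‖ₑ * ‖v x‖ₑ := by
  rw [mulL_apply, enorm_toL1 (integrable_bdd_mul hb hC (integrable_coe v))]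
  simp only [enorm_mul]

/-- Multiplication by the truncated weight on `L¹`. -/
def truncL (j : ℕ) (R : ℝ) (hR : 0 ≤ R) : L1 n →L[ℂ] L1 n :=
  mulL (fun x => ((truncWeight j R x : ℝ) : ℂ)) (R ^ j) (measurable_truncWeight j R)
    (norm_truncWeight_le j hR)

theorem enorm_truncL (j : ℕ) {R : ℝ} (hR : 0 ≤ R) (v : L1 n) :
    ‖truncL j R hR v‖ₑ = ∫⁻ x, ENNReal.ofReal (truncWeight j R x) * ‖v x‖ₑ := by
  rw [truncL, enorm_mulL]
  refine lintegral_congr fun x => ?_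
  rw [← ofReal_norm, Complex.norm_real, Real.norm_of_nonneg (truncWeight_nonneg j hR x)]

/-- Weighted bound for the heat semigroup, uniform in the truncation. -/
theorem exists_norm_truncL_semigroup_le {ν : ℂ} (hν : 0 < ν.re) (j : ℕ) :
    ∃ C : ℝ, 0 ≤ C ∧ ∀ (τ R : ℝ) (hR : 0 ≤ R) (φ : E n → ℂ), 0 < τ → Integrable φ →
      ‖truncL j R hR (toL1 (semigroup ν τ φ))‖ ≤
        C * (1 + τ) ^ ((j : ℝ) / 2) * ‖truncL j R hR (toL1 φ)‖ := by
  obtain ⟨C, hC0, hC⟩ := lintegral_weight_gaussian_le (n := n) hν j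
  refine ⟨C, hC0, fun τ R hR φ hτ hφ => ?_⟩
  have hD : 0 ≤ C * (1 + τ) ^ ((j : ℝ) / 2) := by positivity
  rw [← toReal_enorm, ← toReal_enorm, ← ENNReal.toReal_ofReal hD, ← ENNReal.toReal_mul]
  refine ENNReal.toReal_mono (ENNReal.mul_ne_top ENNReal.ofReal_ne_top enorm_ne_top) ?_
  rw [enorm_truncL, enorm_truncL]
  have h1 : ∀ ψ : E n → ℂ, Integrable ψ → ∫⁻ x, ENNReal.ofReal (truncWeight j R x) * ‖toL1 ψ x‖ₑ
      = ∫⁻ x, ENNReal.ofReal (truncWeight j R x) * ‖ψ x‖ₑ := fun ψ hψ =>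
    lintegral_congr_ae ((coeFn_toL1 hψ).mono fun x hx => by simp only [hx])
  rw [h1 _ (integrable_semigroup hν hτ hφ), h1 _ hφ, semigroup_eq_kerOp ν hτ.ne']
  refine (lintegral_kerOp_le (measurable_gaussian_sub _)
    (continuous_truncWeight j R).measurable.ennreal_ofReal hφ.1
    (lintegral_truncWeight_gaussian_le (hC τ hτ) hR)).trans (le_of_eq ?_)
  rw [← lintegral_const_mul' _ _ ENNReal.ofReal_ne_top]
  simp only [mul_assoc]

/-- The heat semigroup is uniformly bounded on `L¹` and on `L^∞`. -/
theorem exists_norm_semigroup_le {ν : ℂ} (hν : 0 < ν.re) :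
    ∃ C : ℝ≥0, (∀ (τ : ℝ) (φ : E n → ℂ), 0 < τ → Integrable φ →
      ‖toL1 (semigroup ν τ φ)‖ₑ ≤ C * ∫⁻ x, ‖φ x‖ₑ) ∧
      ∀ (τ : ℝ) (φ : E n → ℂ) (M : ℝ≥0∞), 0 < τ → (∀ᵐ x, ‖φ x‖ₑ ≤ M) →
        ∀ x, ‖semigroup ν τ φ x‖ₑ ≤ C * M := by
  obtain ⟨C, hC⟩ := exists_lintegral_gaussian_le (n := n) hν
  refine ⟨C, fun τ φ hτ hφ => ?_, fun τ φ M hτ hM x => ?_⟩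
  · rw [enorm_toL1 (integrable_semigroup hν hτ hφ), ← eLpNorm_one_eq_lintegral_enorm,
      semigroup_eq_kerOp ν hτ.ne', ← lintegral_const_mul' _ _ ENNReal.coe_ne_top]
    exact eLpNorm_one_kerOp_le (measurable_gaussian_sub _) hφ.1 (hC τ hτ)
  · rw [semigroup_eq_kerOp ν hτ.ne', kerOp]
    calc _ ≤ ∫⁻ y, ‖gaussian ((τ : ℂ) * ν) (x - y) * φ y‖ₑ := enorm_integral_le_lintegral_enorm _
      _ ≤ ∫⁻ y, ‖gaussian ((τ : ℂ) * ν) (x - y)‖ₑ * M := by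
          refine lintegral_mono_ae ?_
          filter_upwards [hM] with y hy
          rw [enorm_mul]
          gcongr
      _ = (∫⁻ y, ‖gaussian ((τ : ℂ) * ν) (x - y)‖ₑ) * M := by
          refine lintegral_mul_const'' _ ?_
          exact ((continuous_gaussian _).comp
            (continuous_const.sub continuous_id)).measurable.enorm.aemeasurable
      _ ≤ C * M := by
          gcongr
          rw [lintegral_sub_left_eq_self (fun y : E n => ‖gaussian ((τ : ℂ) * ν) y‖ₑ) x]
          simpa using hC τ hτ 0

/-! ### Continuity of the Duhamel integrand -/

theorem kerOp_sub {k : E n → E n → ℂ} {φ ψ : E n → ℂ} (x : E n)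
    (hφ : Integrable fun y => k x y * φ y) (hψ : Integrable fun y => k x y * ψ y) :
    kerOp k (fun y => φ y - ψ y) x = kerOp k φ x - kerOp k ψ x := by
  rw [kerOp, kerOp, kerOp, ← integral_sub hφ hψ]
  simp only [mul_sub]

theorem integrable_gaussian_sub_mul {z : ℂ} (hz : 0 < z.re) {φ : E n → ℂ} (hφ : Integrable φ)
    (x : E n) : Integrable fun y => gaussian z (x - y) * φ y := by
  obtain ⟨C, hC⟩ := exists_norm_gaussian_le (n := n) z hz
  exact integrable_bdd_mul ((continuous_gaussian _).comp
    (continuous_const.sub continuous_id)).measurable (fun y => hC _) hφ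

theorem toL1_semigroup_sub {ν : ℂ} (hν : 0 < ν.re) {τ : ℝ} (hτ : 0 < τ) (v w : L1 n) :
    toL1 (semigroup ν τ v) - toL1 (semigroup ν τ w) = toL1 (semigroup ν τ (v - w : L1 n)) := by
  rw [← toL1_sub (integrable_semigroup hν hτ (integrable_coe v))
    (integrable_semigroup hν hτ (integrable_coe w))]
  congr 1
  ext x
  simp only [semigroup_eq_kerOp ν hτ.ne']
  rw [kerOp_congr (Lp.coeFn_sub v w)]
  exact (kerOp_sub x (integrable_gaussian_sub_mul (mul_re_pos hν hτ) (integrable_coe v) x)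
    (integrable_gaussian_sub_mul (mul_re_pos hν hτ) (integrable_coe w) x)).symm

/-- `τ ↦ G_{τν}` is continuous from `(0, ∞)` to `L¹`. -/
theorem tendsto_lintegral_gaussian_sub {ν : ℂ} (hν : 0 < ν.re) {τ₀ : ℝ} (hτ₀ : 0 < τ₀) :
    Tendsto (fun τ : ℝ => ∫⁻ x : E n, ‖gaussian ((τ : ℂ) * ν) x - gaussian ((τ₀ : ℂ) * ν) x‖ₑ)
      (𝓝 τ₀) (𝓝 0) := by
  have hν0 : ν ≠ 0 := by rintro rfl; simp at hν
  have hd := inv_four_mul_re_pos hν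
  set d := ((4 * ν)⁻¹).re with hdd
  have hc : 0 < d / (2 * τ₀) := by positivity
  set B : ℝ := ‖4 * (Real.pi : ℂ) * (((τ₀ / 2 : ℝ) : ℂ) * ν)‖ ^ (-(n : ℝ) / 2) with hB
  have hbound : ∀ τ : ℝ, τ₀ / 2 < τ → τ < 2 * τ₀ → ∀ x : E n,
      ‖gaussian ((τ : ℂ) * ν) x‖ ≤ B * Real.exp (-(d / (2 * τ₀)) * ‖x‖ ^ 2) := by
    intro τ h1 h2 x
    have hτ : 0 < τ := by linarith
    have hre : ((4 * ((τ : ℂ) * ν))⁻¹).re = τ⁻¹ * d := by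
      rw [hdd, show (4 * ((τ : ℂ) * ν))⁻¹ = ((τ⁻¹ : ℝ) : ℂ) * (4 * ν)⁻¹ by
        push_cast; rw [mul_inv, mul_inv, mul_inv]; ring, Complex.re_ofReal_mul]
    rw [norm_gaussian, hre, hB]
    refine mul_le_mul ?_ (Real.exp_le_exp.2 ?_) (Real.exp_pos _).le (by positivity)
    · refine Real.rpow_le_rpow_of_nonpos ?_ ?_ ?_
      · refine norm_pos_iff.2 (mul_ne_zero (by simp [Real.pi_ne_zero]) (mul_ne_zero ?_ hν0))
        exact_mod_cast (by positivity : τ₀ / 2 ≠ 0)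
      · simp only [norm_mul, Complex.norm_real, Real.norm_of_nonneg hτ.le,
          Real.norm_of_nonneg (by positivity : 0 ≤ τ₀ / 2)]
        gcongr
      · have : (0 : ℝ) ≤ n := Nat.cast_nonneg n
        linarith
    · have h3 : (2 * τ₀)⁻¹ ≤ τ⁻¹ := by gcongr
      have h4 : ‖x‖ ^ 2 * ((2 * τ₀)⁻¹ * d) ≤ ‖x‖ ^ 2 * (τ⁻¹ * d) := by gcongr
      rw [div_eq_inv_mul]
      linarith
  have hlim : ∀ x : E n, Tendsto
      (fun τ : ℝ => ‖gaussian ((τ : ℂ) * ν) x - gaussian ((τ₀ : ℂ) * ν) x‖ₑ) (𝓝 τ₀) (𝓝 0) := by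
    intro x
    have hcont : ContinuousAt (fun τ : ℝ => gaussian ((τ : ℂ) * ν) x) τ₀ := by
      have hne : 4 * ((τ₀ : ℂ) * ν) ≠ 0 := by
        have : (τ₀ : ℂ) ≠ 0 := by exact_mod_cast hτ₀.ne'
        simp [this, hν0]
      have h1 : ContinuousAt
          (fun τ : ℝ => (4 * (Real.pi : ℂ) * ((τ : ℂ) * ν)) ^ (-(n : ℂ) / 2)) τ₀ := by
        refine ContinuousAt.cpow (by fun_prop) continuousAt_const ?_
        left
        rw [show 4 * (Real.pi : ℂ) * ((τ₀ : ℂ) * ν) = ((4 * Real.pi * τ₀ : ℝ) : ℂ) * ν by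
          push_cast; ring, Complex.re_ofReal_mul]
        have := Real.pi_pos
        positivity
      have h2 : ContinuousAt (fun τ : ℝ => -((‖x‖ ^ 2 : ℝ) : ℂ) / (4 * ((τ : ℂ) * ν))) τ₀ :=
        ContinuousAt.div continuousAt_const (by fun_prop) hne
      exact h1.mul h2.cexp
    have h3 := (hcont.tendsto.sub_const (gaussian ((τ₀ : ℂ) * ν) x)).enorm
    simpa using h3
  have hev : ∀ᶠ τ in 𝓝 τ₀, τ₀ / 2 < τ ∧ τ < 2 * τ₀ :=
    (eventually_gt_nhds (by linarith)).and (eventually_lt_nhds (by linarith))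
  have := tendsto_lintegral_filter_of_dominated_convergence (μ := (volume : Measure (E n)))
    (l := 𝓝 τ₀)
    (F := fun (τ : ℝ) x => ‖gaussian ((τ : ℂ) * ν) x - gaussian ((τ₀ : ℂ) * ν) x‖ₑ)
    (f := fun _ => 0)
    (fun x => ENNReal.ofReal (2 * (B * Real.exp (-(d / (2 * τ₀)) * ‖x‖ ^ 2))))
    (Eventually.of_forall fun τ =>
      ((continuous_gaussian _).sub (continuous_gaussian _)).measurable.enorm)
    (by
      filter_upwards [hev] with τ hτ
      refine Eventually.of_forall fun x => ?_
      rw [← ofReal_norm]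
      refine ENNReal.ofReal_le_ofReal ((norm_sub_le _ _).trans ?_)
      have h1 := hbound τ hτ.1 hτ.2 x
      have h2 := hbound τ₀ (by linarith) (by linarith) x
      linarith)
    (by
      have hi := ((integrable_exp_neg_mul_sq_norm (n := n) hc).const_mul B).const_mul 2
      exact hi.lintegral_lt_top.ne)
    (Eventually.of_forall hlim)
  simpa using this

section DampedSolution

variable {ν : ℂ} {θ A : ℝ} {u₀ : E n → ℂ} {u F : ℝ → L1 n}

theorem IsDampedMildSolution.norm_F_L1_le (h : IsDampedMildSolution ν θ A u₀ u F) {t : ℝ}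
    (ht : 0 < t) : ‖F t‖ ≤ A * A * (1 + t) ^ (-θ) := by
  calc ‖F t‖ ≤ A * (1 + t) ^ (-θ) * ‖u t‖ := Lp.norm_le_mul_norm_of_ae_le_mul (h.norm_F_le t ht)
    _ ≤ A * (1 + t) ^ (-θ) * A := by
        have := h.norm_u_le t ht.le
        have := h.pos
        gcongr
    _ = _ := by ring

/-- The Duhamel integrand is continuous on `(0, t)`. -/
theorem IsDampedMildSolution.continuousOn_duhamel (hν : 0 < ν.re)
    (h : IsDampedMildSolution ν θ A u₀ u F) (t : ℝ) :
    ContinuousOn (fun s => toL1 (semigroup ν (t - s) (F s))) (Ioo 0 t) := by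
  obtain ⟨C, hC, _⟩ := exists_norm_semigroup_le (n := n) hν
  intro s₀ hs₀
  have hτ₀ : 0 < t - s₀ := by linarith [hs₀.2]
  rw [ContinuousWithinAt, tendsto_iff_edist_tendsto_0]
  simp only [edist_eq_enorm_sub]
  have hF : Tendsto (fun s => ‖F s - F s₀‖ₑ) (𝓝[Ioo 0 t] s₀) (𝓝 0) := by
    have h1 : ContinuousWithinAt F (Ioo 0 t) s₀ :=
      (h.continuousOn_F s₀ hs₀.1).mono Ioo_subset_Ioi_self
    have h2 := (h1.sub (continuousWithinAt_const (b := F s₀))).enorm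
    simpa [ContinuousWithinAt] using h2
  have hG : Tendsto (fun s : ℝ => ∫⁻ x : E n,
      ‖gaussian (((t - s : ℝ) : ℂ) * ν) x - gaussian (((t - s₀ : ℝ) : ℂ) * ν) x‖ₑ)
      (𝓝[Ioo 0 t] s₀) (𝓝 0) := by
    have h1 : Tendsto (fun s : ℝ => t - s) (𝓝[Ioo 0 t] s₀) (𝓝 (t - s₀)) :=
      ((continuous_const.sub continuous_id).tendsto s₀).mono_left nhdsWithin_le_nhds
    exact (tendsto_lintegral_gaussian_sub hν hτ₀).comp h1
  have hlim : Tendsto (fun s : ℝ => C * ‖F s - F s₀‖ₑ + (∫⁻ x : E n,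
      ‖gaussian (((t - s : ℝ) : ℂ) * ν) x - gaussian (((t - s₀ : ℝ) : ℂ) * ν) x‖ₑ) * ‖F s₀‖ₑ)
      (𝓝[Ioo 0 t] s₀) (𝓝 0) := by
    have h1 := ENNReal.Tendsto.const_mul hF (Or.inr (ENNReal.coe_ne_top (r := C)))
    have h2 := ENNReal.Tendsto.mul_const hG (Or.inr (enorm_ne_top (x := F s₀)))
    simpa using h1.add h2
  refine tendsto_of_tendsto_of_tendsto_of_le_of_le' tendsto_const_nhds hlim
    (Eventually.of_forall fun _ => bot_le) ?_
  filter_upwards [self_mem_nhdsWithin] with s hs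
  have hτ : 0 < t - s := by linarith [hs.2]
  -- vary the source first, then the time of the semigroup
  have hsplit : toL1 (semigroup ν (t - s) (F s)) - toL1 (semigroup ν (t - s₀) (F s₀)) =
      toL1 (semigroup ν (t - s) (F s - F s₀ : L1 n)) +
      (toL1 (semigroup ν (t - s) (F s₀)) - toL1 (semigroup ν (t - s₀) (F s₀))) := by
    rw [← toL1_semigroup_sub hν hτ]; abel
  rw [hsplit]
  refine (enorm_add_le _ _).trans (add_le_add ?_ ?_)
  · rw [enorm_eq_lintegral (F s - F s₀)]
    exact hC _ _ hτ (integrable_coe _)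
  · have hi₁ := integrable_semigroup hν hτ (integrable_coe (F s₀))
    have hi₂ := integrable_semigroup hν hτ₀ (integrable_coe (F s₀))
    have hi₃ : Integrable (fun x => semigroup ν (t - s) (F s₀) x -
        semigroup ν (t - s₀) (F s₀) x) := hi₁.sub hi₂
    rw [← toL1_sub hi₁ hi₂, enorm_toL1 hi₃, enorm_eq_lintegral (F s₀),
      ← lintegral_const_mul'' _ (Lp.aestronglyMeasurable (F s₀)).enorm]
    have hker : ∀ x, semigroup ν (t - s) (F s₀) x - semigroup ν (t - s₀) (F s₀) x =
        kerOp (fun x y => gaussian (((t - s : ℝ) : ℂ) * ν) (x - y)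
          - gaussian (((t - s₀ : ℝ) : ℂ) * ν) (x - y)) (F s₀) x := by
      intro x
      rw [semigroup_eq_kerOp ν hτ.ne', semigroup_eq_kerOp ν hτ₀.ne', kerOp, kerOp, kerOp,
        ← integral_sub (integrable_gaussian_sub_mul (mul_re_pos hν hτ) (integrable_coe _) x)
          (integrable_gaussian_sub_mul (mul_re_pos hν hτ₀) (integrable_coe _) x)]
      simp only [sub_mul]
    simp only [hker]
    rw [← eLpNorm_one_eq_lintegral_enorm]
    refine eLpNorm_one_kerOp_le ((measurable_gaussian_sub _).sub (measurable_gaussian_sub _))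
      (Lp.aestronglyMeasurable _) fun y => le_of_eq ?_
    exact lintegral_sub_right_eq_self (fun x : E n =>
      ‖gaussian (((t - s : ℝ) : ℂ) * ν) x - gaussian (((t - s₀ : ℝ) : ℂ) * ν) x‖ₑ) y

theorem IsDampedMildSolution.integrableOn_duhamel (hν : 0 < ν.re) (hθ : 0 ≤ θ)
    (h : IsDampedMildSolution ν θ A u₀ u F) (t : ℝ) :
    IntegrableOn (fun s => toL1 (semigroup ν (t - s) (F s))) (Ioc 0 t) := by
  obtain ⟨C, hC, _⟩ := exists_norm_semigroup_le (n := n) hν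
  rw [integrableOn_Ioc_iff_integrableOn_Ioo]
  refine Integrable.of_bound
    ((h.continuousOn_duhamel hν t).aestronglyMeasurable measurableSet_Ioo) (C * (A * A)) ?_
  refine (ae_restrict_iff' measurableSet_Ioo).2 (Eventually.of_forall fun s hs => ?_)
  have h1 := hC (t - s) (F s) (by linarith [hs.2]) (integrable_coe _)
  rw [← enorm_eq_lintegral] at h1
  have h2 := ENNReal.toReal_mono (ENNReal.mul_ne_top ENNReal.coe_ne_top enorm_ne_top) h1
  rw [ENNReal.toReal_mul, toReal_enorm, toReal_enorm, ENNReal.coe_toReal] at h2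
  refine h2.trans ?_
  gcongr
  refine (h.norm_F_L1_le hs.1).trans (mul_le_of_le_one_right (mul_nonneg h.pos h.pos) ?_)
  exact Real.rpow_le_one_of_one_le_of_nonpos (by linarith [hs.1]) (by linarith)

end DampedSolution

/-! ### Weighted decay of the source -/

theorem norm_pow_le_sum (j : ℕ) (hn : 0 < n) (x : E n) :
    ‖x‖ ^ j ≤ √n ^ j * ∑ i, |x i| ^ j := by
  have : Nonempty (Fin n) := ⟨⟨0, hn⟩⟩
  obtain ⟨i, -, hi⟩ := Finset.exists_max_image Finset.univ (fun i => |x i|) Finset.univ_nonempty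
  have h1 : ‖x‖ ≤ √n * |x i| := by
    rw [EuclideanSpace.norm_eq, ← Real.sqrt_sq_eq_abs, ← Real.sqrt_mul (Nat.cast_nonneg n)]
    refine Real.sqrt_le_sqrt ?_
    calc ∑ k, ‖x k‖ ^ 2 ≤ ∑ _k : Fin n, (x i) ^ 2 := by
          refine Finset.sum_le_sum fun k hk => ?_
          rw [Real.norm_eq_abs, ← sq_abs (x i)]
          have := hi k hk
          gcongr
      _ = _ := by simp
  calc ‖x‖ ^ j ≤ (√n * |x i|) ^ j := by gcongr
    _ = √n ^ j * |x i| ^ j := mul_pow _ _ _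
    _ ≤ _ := by
      gcongr
      exact Finset.single_le_sum (f := fun i => |x i| ^ j) (fun _ _ => by positivity)
        (Finset.mem_univ i)

/-- Coordinate monomials control the radial weight. -/
theorem MemWeightedL1.integrable_weight (hn : 0 < n) {m : ℕ} {φ : E n → ℂ} (h : MemWeightedL1 m φ)
    {j : ℕ} (hj : j ≤ m) : Integrable fun x => (((1 + ‖x‖) ^ j : ℝ) : ℂ) * φ x := by
  have h1 : ∀ i : Fin n, Integrable fun x => ((x i ^ j : ℝ) : ℂ) * φ x := by
    intro i
    have h2 := h.2 (Pi.single i j) (by simpa [length, Finset.sum_pi_single'] using hj)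
    have h3 : ∀ x : E n, monomial (Pi.single i j) x = x i ^ j := by
      intro x
      rw [monomial, Finset.prod_eq_single i]
      · simp
      · intro k _ hk
        simp [hk]
      · simp
    simpa only [h3] using h2
  have h2 : Integrable fun x => 2 ^ (j - 1) * (‖φ x‖ +
      √n ^ j * ∑ i, ‖((x i ^ j : ℝ) : ℂ) * φ x‖) := by
    refine (h.1.norm.add (Integrable.const_mul ?_ _)).const_mul _
    exact integrable_finsetSum _ fun i _ => (h1 i).norm
  refine h2.mono' ?_ (Eventually.of_forall fun x => ?_)
  · exact (Complex.continuous_ofReal.comp (by fun_prop)).aestronglyMeasurable.mul h.1.1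
  · rw [norm_mul, Complex.norm_real, Real.norm_of_nonneg (by positivity)]
    have h3 := add_pow_le zero_le_one (norm_nonneg x) j
    rw [one_pow] at h3
    have h4 := norm_pow_le_sum j hn x
    calc (1 + ‖x‖) ^ j * ‖φ x‖ ≤ (2 ^ (j - 1) * (1 + √n ^ j * ∑ i, |x i| ^ j)) * ‖φ x‖ := by
          gcongr
          exact h3.trans (by gcongr)
      _ = _ := by
          simp only [norm_mul, Complex.norm_real, norm_pow, Real.norm_eq_abs, ← Finset.sum_mul]
          ring

section DampedSolution

variable {ν : ℂ} {θ A : ℝ} {u₀ : E n → ℂ} {u F : ℝ → L1 n}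

theorem integrableOn_one_add_rpow {a : ℝ} (ha : a < -1) :
    IntegrableOn (fun s : ℝ => (1 + s) ^ a) (Ioi 0) := by
  have := integrableOn_add_rpow_Ioi_of_lt (m := 1) (c := 0) ha (by norm_num)
  simpa only [add_comm] using this

/-- Multiplication by the weight preserves the pointwise domination of the source. -/
theorem IsDampedMildSolution.norm_truncL_F_le (h : IsDampedMildSolution ν θ A u₀ u F) (j : ℕ)
    {R : ℝ} (hR : 0 ≤ R) {t : ℝ} (ht : 0 < t) :
    ‖truncL j R hR (F t)‖ ≤ A * (1 + t) ^ (-θ) * ‖truncL j R hR (u t)‖ := by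
  refine Lp.norm_le_mul_norm_of_ae_le_mul ?_
  filter_upwards [h.norm_F_le t ht, coeFn_mulL (measurable_truncWeight j R)
    (norm_truncWeight_le j hR) (F t),
    coeFn_mulL (measurable_truncWeight j R) (norm_truncWeight_le j hR) (u t)] with x h1 h2 h3
  rw [truncL, h2, h3, norm_mul, norm_mul]
  calc _ ≤ ‖((truncWeight j R x : ℝ) : ℂ)‖ * (A * (1 + t) ^ (-θ) * ‖u t x‖) := by gcongr
    _ = _ := by ring

/-- Weighted `L¹` bound, uniform in the truncation of the weight, by Grönwall's inequality:
the coefficient `(1 + s)^{j/2 - θ}` is integrable. -/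
theorem IsDampedMildSolution.exists_norm_truncL_le (hν : 0 < ν.re)
    (h : IsDampedMildSolution ν θ A u₀ u F) (hu₀ : Integrable u₀) {j : ℕ}
    (hj : Integrable fun x => (((1 + ‖x‖) ^ j : ℝ) : ℂ) * u₀ x) (hθ : 1 + (j : ℝ) / 2 < θ) :
    ∃ C : ℝ, 0 ≤ C ∧ ∀ (R : ℝ) (hR : 0 ≤ R) (t : ℝ), 0 < t →
      ‖truncL j R hR (u t)‖ ≤ C * (1 + t) ^ ((j : ℝ) / 2) := by
  obtain ⟨C₀, hC₀, hsg⟩ := exists_norm_truncL_semigroup_le (n := n) hν j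
  have hA := h.pos
  have hj0 : (0 : ℝ) ≤ j := Nat.cast_nonneg j
  set W : ℝ := (∫⁻ x, ‖(((1 + ‖x‖) ^ j : ℝ) : ℂ) * u₀ x‖ₑ).toReal with hW
  have hW0 : 0 ≤ W := ENNReal.toReal_nonneg
  set a : ℝ := (j : ℝ) / 2 - θ with ha
  set I : ℝ := ∫ s in Ioi (0 : ℝ), (1 + s) ^ a with hI
  have hint : IntegrableOn (fun s : ℝ => (1 + s) ^ a) (Ioi 0) :=
    integrableOn_one_add_rpow (by rw [ha]; linarith)
  refine ⟨C₀ * W * Real.exp (C₀ * A * I), by positivity, fun R hR t₁ ht₁ => ?_⟩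
  have hwt : ‖truncL j R hR (toL1 u₀)‖ ≤ W := by
    rw [← toReal_enorm, hW]
    refine ENNReal.toReal_mono hj.2.ne ?_
    rw [enorm_truncL]
    refine lintegral_mono_ae ((coeFn_toL1 hu₀).mono fun x hx => ?_)
    rw [hx, enorm_mul, ← ofReal_norm (((1 + ‖x‖) ^ j : ℝ) : ℂ), Complex.norm_real,
      Real.norm_of_nonneg (by positivity)]
    gcongr
    exact truncWeight_le_pow j hR x
  -- the normalized weighted norm, extended to negative times so as to be continuous
  set N : ℝ → ℝ := fun s => ‖truncL j R hR (u (max s 0))‖ * (1 + |s|) ^ (-((j : ℝ) / 2)) with hN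
  set b : ℝ → ℝ := fun s => C₀ * A * (1 + |s|) ^ a with hb
  have hNc : Continuous N := by
    have h1 : Continuous fun s => u (max s 0) :=
      h.continuousOn_u.comp_continuous (by fun_prop) fun s => le_max_right s 0
    refine ((truncL j R hR).continuous.comp h1).norm.mul ?_
    exact Continuous.rpow_const (by fun_prop) fun s => Or.inl (by positivity)
  have hbc : Continuous b := continuous_const.mul
    (Continuous.rpow_const (by fun_prop) fun s => Or.inl (by positivity))
  have hb0 : ∀ s, 0 ≤ b s := fun s => by simp only [hb]; positivity
  have key : ∀ t, 0 < t → N t ≤ C₀ * W + ∫ s in (0 : ℝ)..t, b s * N s := by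
    intro t ht
    have hii : IntervalIntegrable (fun s => toL1 (semigroup ν (t - s) (F s))) volume 0 t :=
      (intervalIntegrable_iff_integrableOn_Ioc_of_le ht.le).2
        (h.integrableOn_duhamel hν (by linarith) t)
    have hbN : IntervalIntegrable (fun s => (1 + t) ^ ((j : ℝ) / 2) * (b s * N s)) volume 0 t :=
      (continuous_const.mul (hbc.mul hNc)).intervalIntegrable _ _
    have hduh : ‖truncL j R hR (∫ s in (0 : ℝ)..t, toL1 (semigroup ν (t - s) (F s)))‖ ≤
        ∫ s in (0 : ℝ)..t, (1 + t) ^ ((j : ℝ) / 2) * (b s * N s) := by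
      have hcomm := ((truncL j R hR).restrictScalars ℝ).intervalIntegral_comp_comm hii
      simp only [ContinuousLinearMap.coe_restrictScalars'] at hcomm
      rw [← hcomm]
      refine intervalIntegral.norm_integral_le_of_norm_le ht.le ?_ hbN
      filter_upwards [(Set.countable_singleton t).ae_notMem volume] with s hst hs
      have hlt : s < t := lt_of_le_of_ne hs.2 hst
      have hs0 := hs.1
      calc _ ≤ C₀ * (1 + (t - s)) ^ ((j : ℝ) / 2) * ‖truncL j R hR (F s)‖ := by
            have := hsg (t - s) R hR (F s) (by linarith) (integrable_coe _)
            rwa [toL1_coe] at this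
        _ ≤ C₀ * (1 + t) ^ ((j : ℝ) / 2) * (A * (1 + s) ^ (-θ) * ‖truncL j R hR (u s)‖) := by
            gcongr
            · linarith
            · exact h.norm_truncL_F_le j hR hs0
        _ = _ := by
            simp only [hb, hN, abs_of_pos hs0, max_eq_left hs0.le]
            have : (1 + s) ^ (-θ) = (1 + s) ^ a * (1 + s) ^ (-((j : ℝ) / 2)) := by
              rw [← Real.rpow_add (by linarith), ha]; congr 1; ring
            rw [this]; ring
    have hmain : ‖truncL j R hR (u t)‖ ≤ (1 + t) ^ ((j : ℝ) / 2) *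
        (C₀ * W + ∫ s in (0 : ℝ)..t, b s * N s) := by
      rw [h.integral_eq t ht, map_add]
      refine (norm_add_le _ _).trans ?_
      rw [intervalIntegral.integral_const_mul] at hduh
      rw [mul_add]
      refine add_le_add ((hsg t R hR u₀ ht hu₀).trans ?_) hduh
      calc _ ≤ C₀ * (1 + t) ^ ((j : ℝ) / 2) * W := by gcongr
        _ = _ := by ring
    simp only [hN, abs_of_pos ht, max_eq_left ht.le]
    rw [Real.rpow_neg (by linarith), ← div_eq_mul_inv, div_le_iff₀ (by positivity), mul_comm]
    exact hmain
  have hgr := gronwall_integral hNc hbc hb0 key ht₁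
  have hbI : ∫ s in (0 : ℝ)..t₁, b s ≤ C₀ * A * I := by
    simp only [hb]
    rw [intervalIntegral.integral_const_mul]
    gcongr
    rw [intervalIntegral.integral_of_le ht₁.le, hI]
    calc ∫ s in Ioc 0 t₁, (1 + |s|) ^ a = ∫ s in Ioc 0 t₁, (1 + s) ^ a :=
          setIntegral_congr_fun measurableSet_Ioc fun s hs => by simp only [abs_of_pos hs.1]
      _ ≤ _ := setIntegral_mono_set hint
          ((ae_restrict_iff' measurableSet_Ioi).2 (Eventually.of_forall fun s (hs : 0 < s) => by
            simp only [Pi.zero_apply]; positivity))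
          (LE.le.eventuallyLE Ioc_subset_Ioi_self)
  have h5 : N t₁ ≤ C₀ * W * Real.exp (C₀ * A * I) := hgr.trans (by gcongr)
  simp only [hN, abs_of_pos ht₁, max_eq_left ht₁.le] at h5
  rwa [Real.rpow_neg (by linarith), ← div_eq_mul_inv, div_le_iff₀ (by positivity)] at h5

/-- The truncated weighted norms increase to the weighted norm. -/
theorem lintegral_weight_le_of_truncL {j : ℕ} {v : L1 n} {C : ℝ}
    (h : ∀ (R : ℝ) (hR : 0 ≤ R), ‖truncL j R hR v‖ ≤ C) :
    ∫⁻ x, ENNReal.ofReal ((1 + ‖x‖) ^ j) * ‖v x‖ₑ ≤ ENNReal.ofReal C := by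
  have hlim := lintegral_tendsto_of_tendsto_of_monotone (μ := (volume : Measure (E n)))
    (f := fun (k : ℕ) x => ENNReal.ofReal (truncWeight j k x) * ‖v x‖ₑ)
    (F := fun x => ENNReal.ofReal ((1 + ‖x‖) ^ j) * ‖v x‖ₑ)
    (fun k => (continuous_truncWeight j k).measurable.ennreal_ofReal.aemeasurable.mul
      (Lp.aestronglyMeasurable v).enorm)
    (Eventually.of_forall fun x k l hkl => by
      simp only [truncWeight]
      gcongr)
    (Eventually.of_forall fun x => by
      refine tendsto_const_nhds.congr' ?_
      filter_upwards [eventually_ge_atTop ⌈1 + ‖x‖⌉₊] with k hk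
      rw [truncWeight, min_eq_left ((Nat.le_ceil _).trans (Nat.cast_le.2 hk))])
  refine le_of_tendsto hlim (Eventually.of_forall fun k => ?_)
  have h1 := h k (Nat.cast_nonneg k)
  rw [← enorm_truncL j (Nat.cast_nonneg k), ← ofReal_norm]
  exact ENNReal.ofReal_le_ofReal h1

/-- Weighted decay of the source. -/
theorem IsDampedMildSolution.exists_lintegral_weight_F_le (hν : 0 < ν.re)
    (h : IsDampedMildSolution ν θ A u₀ u F) (hu₀ : Integrable u₀) {j : ℕ}
    (hj : Integrable fun x => (((1 + ‖x‖) ^ j : ℝ) : ℂ) * u₀ x) (hθ : 1 + (j : ℝ) / 2 < θ) :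
    ∃ C : ℝ, 0 ≤ C ∧ ∀ t : ℝ, 0 < t →
      ∫⁻ x, ENNReal.ofReal ((1 + ‖x‖) ^ j) * ‖F t x‖ₑ ≤
        ENNReal.ofReal (C * (1 + t) ^ ((j : ℝ) / 2 - θ)) := by
  obtain ⟨C, hC, hu⟩ := h.exists_norm_truncL_le hν hu₀ hj hθ
  have hA := h.pos
  refine ⟨A * C, by positivity, fun t ht => lintegral_weight_le_of_truncL fun R hR => ?_⟩
  refine (h.norm_truncL_F_le j hR ht).trans ?_
  calc _ ≤ A * (1 + t) ^ (-θ) * (C * (1 + t) ^ ((j : ℝ) / 2)) := by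
        gcongr
        exact hu R hR t ht
    _ = _ := by
        rw [sub_eq_add_neg, Real.rpow_add (by linarith)]; ring

end DampedSolution

/-! ### Bochner integrals in weighted spaces -/

/-- The class in `L¹` of `(1 + |x|)^j v`, when this function is integrable. -/
def weighted (j : ℕ) (v : L1 n) : L1 n := toL1 fun x => (((1 + ‖x‖) ^ j : ℝ) : ℂ) * v x

theorem enorm_weight (j : ℕ) (x : E n) :
    ‖(((1 + ‖x‖) ^ j : ℝ) : ℂ)‖ₑ = ENNReal.ofReal ((1 + ‖x‖) ^ j) := by
  rw [← ofReal_norm, Complex.norm_real, Real.norm_of_nonneg (by positivity)]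

theorem measurable_weight (j : ℕ) : Measurable fun x : E n => (((1 + ‖x‖) ^ j : ℝ) : ℂ) :=
  (Complex.continuous_ofReal.comp (by fun_prop)).measurable

theorem integrable_weight_mul {j : ℕ} {v : L1 n}
    (h : ∫⁻ x, ENNReal.ofReal ((1 + ‖x‖) ^ j) * ‖v x‖ₑ < ∞) :
    Integrable fun x => (((1 + ‖x‖) ^ j : ℝ) : ℂ) * v x := by
  refine ⟨(measurable_weight j).aestronglyMeasurable.mul (Lp.aestronglyMeasurable v), ?_⟩
  simpa only [HasFiniteIntegral, enorm_mul, enorm_weight] using h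

theorem enorm_weighted {j : ℕ} {v : L1 n}
    (h : Integrable fun x => (((1 + ‖x‖) ^ j : ℝ) : ℂ) * v x) :
    ‖weighted j v‖ₑ = ∫⁻ x, ENNReal.ofReal ((1 + ‖x‖) ^ j) * ‖v x‖ₑ := by
  rw [weighted, enorm_toL1 h]
  simp only [enorm_mul, enorm_weight]

theorem measurable_div_weight {b : E n → ℂ} (hb : Measurable b) (j : ℕ) :
    Measurable fun x => b x / (((1 + ‖x‖) ^ j : ℝ) : ℂ) :=
  hb.div (measurable_weight j)

theorem norm_div_weight_le {b : E n → ℂ} {j : ℕ} (hbj : ∀ x, ‖b x‖ ≤ (1 + ‖x‖) ^ j) (x : E n) :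
    ‖b x / (((1 + ‖x‖) ^ j : ℝ) : ℂ)‖ ≤ 1 := by
  rw [norm_div, Complex.norm_real, Real.norm_of_nonneg (by positivity),
    div_le_one (by positivity)]
  exact hbj x

/-- Multiplication by `b` factors through the weighted class. -/
theorem div_weight_mul_weighted {j : ℕ} {v : L1 n}
    (h : Integrable fun x => (((1 + ‖x‖) ^ j : ℝ) : ℂ) * v x) (b : E n → ℂ) :
    (fun x => b x / (((1 + ‖x‖) ^ j : ℝ) : ℂ) * weighted j v x) =ᵐ[volume] fun x => b x * v x := by
  filter_upwards [coeFn_toL1 h] with x hx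
  have hne : (((1 + ‖x‖) ^ j : ℝ) : ℂ) ≠ 0 := by
    exact_mod_cast (by positivity : (1 + ‖x‖) ^ j ≠ 0)
  rw [weighted, hx, ← mul_assoc, div_mul_cancel₀ _ hne]

/-- Truncations converge to the weighted class in `L¹`. -/
theorem tendsto_truncL_weighted {j : ℕ} {v : L1 n}
    (h : Integrable fun x => (((1 + ‖x‖) ^ j : ℝ) : ℂ) * v x) :
    Tendsto (fun k : ℕ => truncL j (k : ℝ) (Nat.cast_nonneg k) v) atTop (𝓝 (weighted j v)) := by
  rw [tendsto_iff_edist_tendsto_0]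
  simp only [edist_eq_enorm_sub]
  have hti : ∀ k : ℕ, Integrable fun x => ((truncWeight j k x : ℝ) : ℂ) * v x := fun k =>
    integrable_bdd_mul (measurable_truncWeight j k) (norm_truncWeight_le j (Nat.cast_nonneg k))
      (integrable_coe v)
  have heq : ∀ k : ℕ, ‖truncL j (k : ℝ) (Nat.cast_nonneg k) v - weighted j v‖ₑ =
      ∫⁻ x, ‖((truncWeight j k x : ℝ) : ℂ) * v x - (((1 + ‖x‖) ^ j : ℝ) : ℂ) * v x‖ₑ := by
    intro k
    have hd : Integrable fun x => ((truncWeight j k x : ℝ) : ℂ) * v x -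
        (((1 + ‖x‖) ^ j : ℝ) : ℂ) * v x := (hti k).sub h
    rw [truncL, mulL_apply, weighted, ← toL1_sub (hti k) h, enorm_toL1 hd]
  simp only [heq]
  have := tendsto_lintegral_of_dominated_convergence' (μ := (volume : Measure (E n)))
    (F := fun (k : ℕ) x =>
      ‖((truncWeight j k x : ℝ) : ℂ) * v x - (((1 + ‖x‖) ^ j : ℝ) : ℂ) * v x‖ₑ)
    (f := fun _ => 0) (fun x => ‖(((1 + ‖x‖) ^ j : ℝ) : ℂ) * v x‖ₑ)
    (fun k => ((hti k).1.sub h.1).enorm)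
    (fun k => Eventually.of_forall fun x => by
      simp only
      rw [← sub_mul, enorm_mul, enorm_mul, ← Complex.ofReal_sub, ← ofReal_norm, Complex.norm_real,
        enorm_weight, Real.norm_eq_abs, abs_sub_comm, abs_of_nonneg (sub_nonneg.2
          (truncWeight_le_pow j (Nat.cast_nonneg k) x))]
      gcongr
      linarith [truncWeight_nonneg j (Nat.cast_nonneg (α := ℝ) k) x])
    h.2.ne
    (Eventually.of_forall fun x => by
      refine tendsto_const_nhds.congr' ?_
      filter_upwards [eventually_ge_atTop ⌈1 + ‖x‖⌉₊] with k hk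
      rw [truncWeight, min_eq_left ((Nat.le_ceil _).trans (Nat.cast_le.2 hk)), sub_self, enorm_zero])
  simpa using this

/-- Measurability of the weighted family, as a limit of bounded multipliers applied to `G`. -/
theorem aestronglyMeasurable_weighted {ι : Type*} [MeasurableSpace ι] {μ : Measure ι} {j : ℕ}
    {G : ι → L1 n} (hG : AEStronglyMeasurable G μ)
    (hw : ∀ᵐ s ∂μ, Integrable fun x => (((1 + ‖x‖) ^ j : ℝ) : ℂ) * G s x) :
    AEStronglyMeasurable (fun s => weighted j (G s)) μ :=
  aestronglyMeasurable_of_tendsto_ae atTop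
    (fun k : ℕ => (truncL j (k : ℝ) (Nat.cast_nonneg k)).continuous.comp_aestronglyMeasurable hG)
    (hw.mono fun _ hs => tendsto_truncL_weighted hs)

/-- A family that is Bochner integrable in the weighted space is integrable in `L¹`, and pairing
its integral with a function dominated by the weight commutes with integration. -/
theorem integrable_of_weighted {ι : Type*} [MeasurableSpace ι] {μ : Measure ι} {j : ℕ}
    {G : ι → L1 n} (hw : ∀ᵐ s ∂μ, Integrable fun x => (((1 + ‖x‖) ^ j : ℝ) : ℂ) * G s x)
    (hi : Integrable (fun s => weighted j (G s)) μ) :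
    Integrable G μ ∧ ∀ b : E n → ℂ, Measurable b → (∀ x, ‖b x‖ ≤ (1 + ‖x‖) ^ j) →
      Integrable (fun x => b x * (∫ s, G s ∂μ : L1 n) x) ∧
      Integrable (fun s => ∫ x, b x * G s x) μ ∧
      ∫ x, b x * (∫ s, G s ∂μ : L1 n) x = ∫ s, (∫ x, b x * G s x) ∂μ := by
  have h1 : ∀ x : E n, ‖(1 : ℂ)‖ ≤ (1 + ‖x‖) ^ j := fun x => by
    rw [norm_one]; exact one_le_pow₀ (by linarith [norm_nonneg x])
  -- `L` divides by the weight, which recovers `G` from its weighted version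
  set L : L1 n →L[ℂ] L1 n := mulL (fun x => 1 / (((1 + ‖x‖) ^ j : ℝ) : ℂ)) 1
    (measurable_div_weight measurable_const j) (norm_div_weight_le h1) with hL
  have hLG : (fun s => L (weighted j (G s))) =ᵐ[μ] G := by
    filter_upwards [hw] with s hs
    apply Lp.ext
    filter_upwards [coeFn_mulL (measurable_div_weight (b := fun _ : E n => (1 : ℂ))
      measurable_const j) (norm_div_weight_le h1) (weighted j (G s)),
      div_weight_mul_weighted hs fun _ => 1] with x h2 h3
    rw [hL, h2, h3, one_mul]
  have hG : Integrable G μ := (L.integrable_comp hi).congr hLG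
  refine ⟨hG, fun b hb hbj => ?_⟩
  have hint : ∫ s, G s ∂μ = L (∫ s, weighted j (G s) ∂μ) := by
    have h2 := (L.restrictScalars ℝ).integral_comp_comm hi
    simp only [ContinuousLinearMap.coe_restrictScalars'] at h2
    rw [← h2]
    exact integral_congr_ae hLG.symm
  have hae : (fun x => b x * (∫ s, G s ∂μ : L1 n) x) =ᵐ[volume]
      fun x => b x / (((1 + ‖x‖) ^ j : ℝ) : ℂ) * (∫ s, weighted j (G s) ∂μ : L1 n) x := by
    rw [hint]
    filter_upwards [coeFn_mulL (measurable_div_weight (b := fun _ : E n => (1 : ℂ))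
      measurable_const j) (norm_div_weight_le h1) (∫ s, weighted j (G s) ∂μ)] with x hx
    rw [hL, hx]
    ring
  have hm := measurable_div_weight hb j
  have hC := norm_div_weight_le hbj
  obtain ⟨h3, h4⟩ := integral_mul_integral hm hC hi
  have hae2 : (fun s => ∫ x, b x / (((1 + ‖x‖) ^ j : ℝ) : ℂ) * weighted j (G s) x) =ᵐ[μ]
      fun s => ∫ x, b x * G s x := by
    filter_upwards [hw] with s hs
    exact integral_congr_ae (div_weight_mul_weighted hs b)
  refine ⟨(integrable_bdd_mul hm hC (integrable_coe _)).congr hae.symm, h3.congr hae2, ?_⟩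
  rw [integral_congr_ae hae, h4, integral_congr_ae hae2]

section DampedSolution

variable {ν : ℂ} {θ A : ℝ} {u₀ : E n → ℂ} {u F : ℝ → L1 n}

theorem weighted_smul (j : ℕ) (c : ℂ) {v : L1 n}
    (h : Integrable fun x => (((1 + ‖x‖) ^ j : ℝ) : ℂ) * v x) :
    Integrable (fun x => (((1 + ‖x‖) ^ j : ℝ) : ℂ) * (c • v : L1 n) x) ∧
      weighted j (c • v) = c • weighted j v := by
  have hae : (fun x => (((1 + ‖x‖) ^ j : ℝ) : ℂ) * (c • v : L1 n) x) =ᵐ[volume]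
      fun x => c * ((((1 + ‖x‖) ^ j : ℝ) : ℂ) * v x) := by
    filter_upwards [Lp.coeFn_smul c v] with x hx
    rw [hx, Pi.smul_apply, smul_eq_mul]; ring
  exact ⟨(h.const_mul c).congr hae.symm, by rw [weighted, toL1_congr hae, toL1_smul c h]; rfl⟩

/-- The families `s^k F(s)` are integrable in the weighted space with weight exponent `j` as long
as `k + j / 2 < θ - 1`. -/
theorem IsDampedMildSolution.integrableOn_weighted (hν : 0 < ν.re)
    (h : IsDampedMildSolution ν θ A u₀ u F) (hu₀ : Integrable u₀) {j : ℕ}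
    (hj : Integrable fun x => (((1 + ‖x‖) ^ j : ℝ) : ℂ) * u₀ x) {k : ℕ}
    (hθ : 1 + (k : ℝ) + (j : ℝ) / 2 < θ) :
    (∀ᵐ s : ℝ ∂(volume.restrict (Ioi (0 : ℝ))), Integrable fun x =>
      (((1 + ‖x‖) ^ j : ℝ) : ℂ) * (((s : ℂ) ^ k) • F s : L1 n) x) ∧
    IntegrableOn (fun s : ℝ => weighted j (((s : ℂ) ^ k) • F s)) (Ioi 0) := by
  have hk0 : (0 : ℝ) ≤ k := Nat.cast_nonneg k
  obtain ⟨C, hC, hF⟩ := h.exists_lintegral_weight_F_le hν hu₀ hj (by linarith)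
  have hw : ∀ s : ℝ, 0 < s → Integrable fun x => (((1 + ‖x‖) ^ j : ℝ) : ℂ) * F s x := fun s hs =>
    integrable_weight_mul ((hF s hs).trans_lt ENNReal.ofReal_lt_top)
  have hae : ∀ᵐ s : ℝ ∂(volume.restrict (Ioi (0 : ℝ))), Integrable fun x =>
      (((1 + ‖x‖) ^ j : ℝ) : ℂ) * (((s : ℂ) ^ k) • F s : L1 n) x :=
    (ae_restrict_iff' measurableSet_Ioi).2 (Eventually.of_forall fun s hs =>
      (weighted_smul j _ (hw s hs)).1)
  refine ⟨hae, ?_⟩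
  have hmeas : AEStronglyMeasurable (fun s : ℝ => ((s : ℂ) ^ k) • F s)
      (volume.restrict (Ioi 0)) :=
    (ContinuousOn.smul (f := fun s : ℝ => (s : ℂ) ^ k) (by fun_prop)
      h.continuousOn_F).aestronglyMeasurable measurableSet_Ioi
  have hint : IntegrableOn (fun s : ℝ => C * (1 + s) ^ ((k : ℝ) + ((j : ℝ) / 2 - θ))) (Ioi 0) :=
    (integrableOn_one_add_rpow (by linarith)).const_mul C
  refine hint.mono' (aestronglyMeasurable_weighted hmeas hae)
    ((ae_restrict_iff' measurableSet_Ioi).2 (Eventually.of_forall fun s (hs : 0 < s) => ?_))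
  rw [(weighted_smul j _ (hw s hs)).2, norm_smul, norm_pow, Complex.norm_real,
    Real.norm_of_nonneg hs.le]
  have h1 : ‖weighted j (F s)‖ ≤ C * (1 + s) ^ ((j : ℝ) / 2 - θ) := by
    have h2 := hF s hs
    rw [← enorm_weighted (hw s hs), ← ofReal_norm] at h2
    exact (ENNReal.ofReal_le_ofReal_iff (by positivity)).1 h2
  calc s ^ k * ‖weighted j (F s)‖ ≤ (1 + s) ^ k * (C * (1 + s) ^ ((j : ℝ) / 2 - θ)) := by
        gcongr
        linarith
    _ = _ := by rw [Real.rpow_add (by linarith), Real.rpow_natCast]; ring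

/-- The time moments `∫₀^∞ s^k F(s) ds` lie in the weighted space, and their spatial moments are
computed under the time integral. -/
theorem IsDampedMildSolution.time_moment (hν : 0 < ν.re)
    (h : IsDampedMildSolution ν θ A u₀ u F) (hn : 0 < n) {m : ℕ} (hu₀ : MemWeightedL1 m u₀)
    (hθ : 1 + (m : ℝ) / 2 < θ) {k : ℕ} (hk : 2 * k ≤ m) :
    IntegrableOn (fun s : ℝ => ((s : ℂ) ^ k) • F s) (Ioi 0) ∧
    MemWeightedL1 (m - 2 * k) (∫ s in Ioi (0 : ℝ), ((s : ℂ) ^ k) • F s : L1 n) ∧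
    ∀ β : Fin n → ℕ, length β ≤ m - 2 * k →
      IntegrableOn (fun s : ℝ => moment β (((s : ℂ) ^ k) • F s : L1 n)) (Ioi 0) ∧
      moment β (∫ s in Ioi (0 : ℝ), ((s : ℂ) ^ k) • F s : L1 n) =
        ∫ s in Ioi (0 : ℝ), moment β (((s : ℂ) ^ k) • F s : L1 n) := by
  set j := m - 2 * k with hj
  have hjm : (k : ℝ) + (j : ℝ) / 2 = (m : ℝ) / 2 := by
    have : (2 * k + j : ℕ) = m := by omega
    rw [← this]; push_cast; ring
  obtain ⟨h1, h2⟩ := h.integrableOn_weighted hν hu₀.1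
    (hu₀.integrable_weight hn (by omega : j ≤ m)) (k := k) (by linarith)
  obtain ⟨h3, h4⟩ := integrable_of_weighted h1 h2
  have hmon : ∀ β : Fin n → ℕ, length β ≤ j → ∀ x : E n,
      ‖((monomial β x : ℝ) : ℂ)‖ ≤ (1 + ‖x‖) ^ j := fun β hβ x => by
    rw [Complex.norm_real, Real.norm_eq_abs]
    calc |monomial β x| ≤ ‖x‖ ^ length β := norm_monomial_le β x
      _ ≤ (1 + ‖x‖) ^ length β := by gcongr; linarith
      _ ≤ _ := pow_le_pow_right₀ (by linarith [norm_nonneg x]) hβ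
  have hmeas : ∀ β : Fin n → ℕ, Measurable fun x : E n => ((monomial β x : ℝ) : ℂ) := fun β =>
    (Complex.continuous_ofReal.comp (continuous_monomial β)).measurable
  refine ⟨h3, ⟨integrable_coe _, fun α hα => (h4 _ (hmeas α) (hmon α hα)).1⟩, fun β hβ => ?_⟩
  obtain ⟨-, h5, h6⟩ := h4 _ (hmeas β) (hmon β hβ)
  refine ⟨h5.const_mul _, ?_⟩
  simp only [moment]
  rw [h6, integral_const_mul]

end DampedSolution

/-! ### Limits of the error terms -/

/-- Dominated convergence for the error weights `ρ^m min(1, ερ)`. -/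
theorem tendsto_lintegral_errorWeight {ι : Type*} [MeasurableSpace ι] {μ : Measure ι} (m : ℕ)
    {ρ : ι → ℝ} (hρ : Measurable ρ) (hρ0 : ∀ᵐ i ∂μ, 0 ≤ ρ i) {g : ι → ℝ≥0∞}
    (hg : AEMeasurable g μ) (hi : ∫⁻ i, ENNReal.ofReal (ρ i ^ m) * g i ∂μ ≠ ∞)
    (hg' : ∀ᵐ i ∂μ, g i ≠ ∞) :
    Tendsto (fun ε : ℝ => ∫⁻ i, ENNReal.ofReal (ρ i ^ m * min 1 (|ε| * ρ i)) * g i ∂μ)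
      (𝓝 0) (𝓝 0) := by
  refine tendsto_of_seq_tendsto fun ε hε => ?_
  have := tendsto_lintegral_of_dominated_convergence' (μ := μ)
    (F := fun (k : ℕ) i => ENNReal.ofReal (ρ i ^ m * min 1 (|ε k| * ρ i)) * g i)
    (f := fun _ => 0) (fun i => ENNReal.ofReal (ρ i ^ m) * g i)
    (fun k => ((hρ.pow_const m).mul
      (measurable_const.min (hρ.const_mul _))).ennreal_ofReal.aemeasurable.mul hg)
    (fun k => by
      filter_upwards [hρ0] with i hi
      gcongr
      exact mul_le_of_le_one_right (by positivity) (min_le_left _ _))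
    hi
    (by
      filter_upwards [hg'] with i hgi
      have h1 : Tendsto (fun k => ρ i ^ m * min 1 (|ε k| * ρ i)) atTop (𝓝 0) := by
        have h2 : Continuous fun r : ℝ => ρ i ^ m * min 1 (|r| * ρ i) := by fun_prop
        have h3 := (h2.tendsto 0).comp hε
        simpa [Function.comp_def] using h3
      have h4 := ENNReal.Tendsto.mul_const (ENNReal.tendsto_ofReal h1) (Or.inr hgi)
      simpa using h4)
  simpa [Function.comp_def] using this

theorem memWeightedL1_of_integrable_weight {m : ℕ} {φ : E n → ℂ} (hφ : Integrable φ)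
    (h : Integrable fun x => (((1 + ‖x‖) ^ m : ℝ) : ℂ) * φ x) : MemWeightedL1 m φ := by
  refine ⟨hφ, fun α hα => h.mono ?_ (Eventually.of_forall fun x => ?_)⟩
  · exact (Complex.continuous_ofReal.comp (continuous_monomial α)).aestronglyMeasurable.mul hφ.1
  · rw [norm_mul, norm_mul, Complex.norm_real, Complex.norm_real,
      Real.norm_of_nonneg (by positivity : 0 ≤ (1 + ‖x‖) ^ m), Real.norm_eq_abs]
    gcongr
    calc |monomial α x| ≤ ‖x‖ ^ length α := norm_monomial_le α x
      _ ≤ (1 + ‖x‖) ^ length α := by gcongr; linarith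
      _ ≤ _ := pow_le_pow_right₀ (by linarith [norm_nonneg x]) hα

/-- The coefficient function of the moment `M_β` in `Λ_{α,N}(t; ·)`. -/
def lamTerm (ν : ℂ) (α : Fin n → ℕ) (t : ℝ) (k : ℕ) (β : Fin n → ℕ) (x : E n) : ℂ :=
  ((-2 : ℂ) ^ length α)⁻¹ * ((t ^ (-(length α : ℝ) / 2) : ℝ) : ℂ) *
    (((2 : ℂ) ^ k)⁻¹ * ((t ^ (-(k : ℝ) / 2) : ℝ) : ℂ) *
      dilation t (fun y => hermite ν (α + β) y * gaussian ν y) x)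

theorem integrable_lamTerm {ν : ℂ} (hν : 0 < ν.re) (α : Fin n → ℕ) {t : ℝ} (ht : 0 < t) (k : ℕ)
    (β : Fin n → ℕ) : Integrable (lamTerm ν α t k β) := by
  have h1 := (integrable_hermite_mul_gaussian (n := n) hν (α + β)).comp_smul
    (R := t ^ (-(1 / 2) : ℝ)) (by positivity)
  exact ((h1.const_mul _).const_mul _).const_mul _

theorem Lam_eq_sum (ν : ℂ) (α : Fin n → ℕ) (N : ℕ) (t : ℝ) (φ : E n → ℂ) (x : E n) :
    Lam ν α N t φ x = ∑ k ∈ Finset.range (N + 1), ∑ β ∈ indicesEq n k,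
      moment β φ * lamTerm ν α t k β x := by
  simp only [Lam, lamTerm, Finset.mul_sum]
  refine Finset.sum_congr rfl fun k _ => Finset.sum_congr rfl fun β _ => ?_
  ring

/-- `Λ_{α,N}(t; φ)` is a finite combination of fixed `L¹` functions whose coefficients are the moments
of `φ`. -/
theorem toL1_Lam {ν : ℂ} (hν : 0 < ν.re) (α : Fin n → ℕ) (N : ℕ) {t : ℝ} (ht : 0 < t)
    (φ : E n → ℂ) : Integrable (Lam ν α N t φ) ∧
      toL1 (Lam ν α N t φ) = ∑ k ∈ Finset.range (N + 1), ∑ β ∈ indicesEq n k,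
        moment β φ • toL1 (lamTerm ν α t k β) := by
  have h0 : Lam ν α N t φ = fun x => ∑ k ∈ Finset.range (N + 1), ∑ β ∈ indicesEq n k,
      moment β φ * lamTerm ν α t k β x := funext fun x => Lam_eq_sum ν α N t φ x
  have h1 : ∀ (k : ℕ) (β : Fin n → ℕ), Integrable fun x => moment β φ * lamTerm ν α t k β x :=
    fun k β => (integrable_lamTerm hν α ht k β).const_mul _
  have h2 : ∀ k : ℕ, Integrable fun x => ∑ β ∈ indicesEq n k, moment β φ * lamTerm ν α t k β x :=
    fun k => integrable_finsetSum _ fun β _ => h1 k β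
  rw [h0]
  refine ⟨integrable_finsetSum _ fun k _ => h2 k, ?_⟩
  rw [toL1_sum _ fun k _ => h2 k]
  refine Finset.sum_congr rfl fun k _ => ?_
  rw [toL1_sum _ fun β _ => h1 k β]
  exact Finset.sum_congr rfl fun β _ => toL1_smul _ (integrable_lamTerm hν α ht k β)

/-- `Λ_{α,N}(t; ·)` commutes with Bochner integrals for which the moments do. -/
theorem integral_Lam {ι : Type*} [MeasurableSpace ι] {μ : Measure ι} {ν : ℂ} (hν : 0 < ν.re)
    (α : Fin n → ℕ) {N : ℕ} {t : ℝ} (ht : 0 < t) {G : ι → L1 n}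
    (hG : ∀ β : Fin n → ℕ, length β ≤ N → Integrable (fun s => moment β (G s)) μ ∧
      moment β (∫ s, G s ∂μ : L1 n) = ∫ s, moment β (G s) ∂μ) :
    Integrable (fun s => toL1 (Lam ν α N t (G s))) μ ∧
      ∫ s, toL1 (Lam ν α N t (G s)) ∂μ = toL1 (Lam ν α N t (∫ s, G s ∂μ : L1 n)) := by
  have hle : ∀ k ∈ Finset.range (N + 1), ∀ β ∈ indicesEq n k, length β ≤ N := fun k hk β hβ => by
    rw [mem_indicesEq.1 hβ]; exact Nat.lt_succ_iff.1 (Finset.mem_range.1 hk)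
  have h1 : ∀ k ∈ Finset.range (N + 1), ∀ β ∈ indicesEq n k,
      Integrable (fun s => moment β (G s) • toL1 (lamTerm ν α t k β)) μ := fun k hk β hβ =>
    (hG β (hle k hk β hβ)).1.smul_const _
  have h2 : ∀ k ∈ Finset.range (N + 1), Integrable
      (fun s => ∑ β ∈ indicesEq n k, moment β (G s) • toL1 (lamTerm ν α t k β)) μ := fun k hk =>
    integrable_finsetSum _ fun β hβ => h1 k hk β hβ
  simp only [fun φ : E n → ℂ => (toL1_Lam hν α N ht φ).2]
  refine ⟨integrable_finsetSum _ h2, ?_⟩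
  rw [integral_finsetSum _ h2]
  refine Finset.sum_congr rfl fun k hk => ?_
  rw [integral_finsetSum _ (h1 k hk)]
  refine Finset.sum_congr rfl fun β hβ => ?_
  rw [integral_smul_const, (hG β (hle k hk β hβ)).2]

theorem Lam_smul (ν : ℂ) (α : Fin n → ℕ) (N : ℕ) (t : ℝ) (c : ℂ) (v : L1 n) (x : E n) :
    Lam ν α N t (c • v : L1 n) x = c * Lam ν α N t v x := by
  have h : ∀ β : Fin n → ℕ, moment β (c • v : L1 n) = c * moment β v := by
    intro β
    have h1 : ∫ y, (monomial β y : ℂ) * (c • v : L1 n) y = c * ∫ y, (monomial β y : ℂ) * v y := by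
      rw [← integral_const_mul]
      refine integral_congr_ae ?_
      filter_upwards [Lp.coeFn_smul c v] with y hy
      rw [hy, Pi.smul_apply, smul_eq_mul]; ring
    rw [moment, h1, moment]; ring
  rw [Lam_eq_sum, Lam_eq_sum, Finset.mul_sum]
  refine Finset.sum_congr rfl fun k _ => ?_
  rw [Finset.mul_sum]
  exact Finset.sum_congr rfl fun β _ => by rw [h]; ring

section DampedSolution

variable {ν : ℂ} {θ A : ℝ} {u₀ : E n → ℂ} {u F : ℝ → L1 n}

/-- The recent part of the Duhamel integral is of lower order. -/
theorem IsDampedMildSolution.tendsto_recent (hν : 0 < ν.re)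
    (h : IsDampedMildSolution ν θ A u₀ u F) {m : ℕ} (hθ : 1 + (m : ℝ) / 2 < θ) :
    Tendsto (fun t : ℝ => ENNReal.ofReal (t ^ ((m : ℝ) / 2)) *
      scaledNorm t (∫ s in Ioc (t / 2) t, toL1 (semigroup ν (t - s) (F s)) : L1 n))
      atTop (𝓝 0) := by
  obtain ⟨C, hC1, hC2⟩ := exists_norm_semigroup_le (n := n) hν
  have hA := h.pos
  have hm0 : (0 : ℝ) ≤ m := Nat.cast_nonneg m
  have hC0 : (0 : ℝ) ≤ (C : ℝ) := C.2
  have hCr : (C : ℝ≥0∞) = ENNReal.ofReal (C : ℝ) := (ENNReal.ofReal_coe_nnreal).symm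
  set K : ℝ := C * (A * A + 2 ^ ((n : ℝ) / 2) * A) with hK
  have hK0 : 0 ≤ K := by positivity
  have hpt : ∀ t : ℝ, 0 < t → ∀ s ∈ Ioo (t / 2) t,
      scaledNorm t (toL1 (semigroup ν (t - s) (F s))) ≤ ENNReal.ofReal (K * (t / 2) ^ (-θ)) := by
    intro t ht s hs
    have hs0 : 0 < s := by linarith [hs.1]
    have hτ : 0 < t - s := by linarith [hs.2]
    have hmono : (1 + s) ^ (-θ) ≤ (t / 2) ^ (-θ) :=
      Real.rpow_le_rpow_of_nonpos (by positivity) (by linarith [hs.1]) (by linarith)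
    refine max_le ?_ ?_
    · rw [← Lp.enorm_def]
      have h1 := hC1 (t - s) (F s) hτ (integrable_coe _)
      rw [← enorm_eq_lintegral, ← ofReal_norm (F s), hCr,
        ← ENNReal.ofReal_mul hC0] at h1
      refine h1.trans (ENNReal.ofReal_le_ofReal ?_)
      calc (C : ℝ) * ‖F s‖ ≤ C * (A * A * (1 + s) ^ (-θ)) := by gcongr; exact h.norm_F_L1_le hs0
        _ ≤ C * (A * A * (t / 2) ^ (-θ)) := by gcongr
        _ ≤ _ := by
          rw [hK]
          have : 0 ≤ (C : ℝ) * (2 ^ ((n : ℝ) / 2) * A) * (t / 2) ^ (-θ) := by positivity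
          linarith
    · have h1 : eLpNorm (toL1 (semigroup ν (t - s) (F s))) ∞ volume ≤
          C * ENNReal.ofReal (A * (1 + s) ^ (-θ - (n : ℝ) / 2)) := by
        rw [eLpNorm_congr_ae (coeFn_toL1 (integrable_semigroup hν hτ (integrable_coe (F s)))),
          eLpNorm_exponent_top]
        refine eLpNormEssSup_le_of_ae_enorm_bound (Eventually.of_forall ?_)
        refine hC2 (t - s) (F s) _ hτ ?_
        filter_upwards [h.norm_F_le_top s hs0] with x hx
        rw [← ofReal_norm]
        exact ENNReal.ofReal_le_ofReal hx
      calc _ ≤ ENNReal.ofReal (t ^ ((n : ℝ) / 2)) *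
            (C * ENNReal.ofReal (A * (1 + s) ^ (-θ - (n : ℝ) / 2))) := by gcongr
        _ = ENNReal.ofReal (t ^ ((n : ℝ) / 2) * (C * (A * (1 + s) ^ (-θ - (n : ℝ) / 2)))) := by
            rw [hCr, ← ENNReal.ofReal_mul hC0, ← ENNReal.ofReal_mul (by positivity)]
        _ ≤ _ := by
            refine ENNReal.ofReal_le_ofReal ?_
            have h2 : t ^ ((n : ℝ) / 2) ≤ 2 ^ ((n : ℝ) / 2) * (1 + s) ^ ((n : ℝ) / 2) := by
              rw [← Real.mul_rpow (by norm_num) (by linarith)]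
              exact Real.rpow_le_rpow ht.le (by linarith [hs.1]) (by positivity)
            calc _ ≤ 2 ^ ((n : ℝ) / 2) * (1 + s) ^ ((n : ℝ) / 2) *
                  (C * (A * (1 + s) ^ (-θ - (n : ℝ) / 2))) := by gcongr
              _ = C * (2 ^ ((n : ℝ) / 2) * A) *
                  ((1 + s) ^ ((n : ℝ) / 2) * (1 + s) ^ (-θ - (n : ℝ) / 2)) := by ring
              _ = C * (2 ^ ((n : ℝ) / 2) * A) * (1 + s) ^ (-θ) := by
                  rw [← Real.rpow_add (by linarith)]; congr 2; ring
              _ ≤ C * (2 ^ ((n : ℝ) / 2) * A) * (t / 2) ^ (-θ) := by gcongr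
              _ ≤ _ := by
                  rw [hK]
                  have : 0 ≤ (C : ℝ) * (A * A) * (t / 2) ^ (-θ) := by positivity
                  linarith
  have hbound : ∀ᶠ t : ℝ in atTop, ENNReal.ofReal (t ^ ((m : ℝ) / 2)) *
      scaledNorm t (∫ s in Ioc (t / 2) t, toL1 (semigroup ν (t - s) (F s)) : L1 n) ≤
      ENNReal.ofReal (K * 2 ^ (θ - 1) * t ^ (-(θ - 1 - (m : ℝ) / 2))) := by
    filter_upwards [eventually_gt_atTop 0] with t ht
    have hint : IntegrableOn (fun s => toL1 (semigroup ν (t - s) (F s))) (Ioc (t / 2) t) :=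
      (h.integrableOn_duhamel hν (by linarith) t).mono_set (Ioc_subset_Ioc_left (by linarith))
    have h1 := scaledNorm_integral_le t hint (c := fun _ => ENNReal.ofReal (K * (t / 2) ^ (-θ)))
      ((ae_restrict_iff' measurableSet_Ioc).2 (by
        filter_upwards [(Set.countable_singleton t).ae_notMem volume] with s hst hs
        exact hpt t ht s ⟨hs.1, lt_of_le_of_ne hs.2 hst⟩))
    rw [setLIntegral_const, Real.volume_Ioc, ← ENNReal.ofReal_mul (by positivity)] at h1
    calc _ ≤ ENNReal.ofReal (t ^ ((m : ℝ) / 2)) *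
          ENNReal.ofReal (K * (t / 2) ^ (-θ) * (t - t / 2)) := by gcongr
      _ = _ := by
          rw [← ENNReal.ofReal_mul (by positivity)]
          congr 1
          have e1 : t - t / 2 = (t / 2) ^ (1 : ℝ) := by rw [Real.rpow_one]; ring
          have e2 : (t / 2) ^ (-θ) * (t / 2) ^ (1 : ℝ) = 2 ^ (θ - 1) * t ^ (-(θ - 1)) := by
            rw [← Real.rpow_add (by positivity), Real.div_rpow ht.le (by norm_num),
              show -θ + 1 = -(θ - 1) by ring, Real.rpow_neg (by norm_num : (0 : ℝ) ≤ 2) (θ - 1)]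
            field_simp
          rw [e1, mul_assoc K, e2, show -(θ - 1 - (m : ℝ) / 2) = (m : ℝ) / 2 + -(θ - 1) by ring,
            Real.rpow_add ht]
          ring
  have hlim : Tendsto (fun t : ℝ => ENNReal.ofReal (K * 2 ^ (θ - 1) *
      t ^ (-(θ - 1 - (m : ℝ) / 2)))) atTop (𝓝 0) := by
    have h1 := (tendsto_rpow_neg_atTop (y := θ - 1 - (m : ℝ) / 2) (by linarith)).const_mul
      (K * 2 ^ (θ - 1))
    have h2 := ENNReal.tendsto_ofReal h1
    simpa using h2
  exact tendsto_of_tendsto_of_tendsto_of_le_of_le' tendsto_const_nhds hlim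
    (Eventually.of_forall fun _ => bot_le) hbound

/-- The error weight integrated against the source tends to zero. -/
theorem IsDampedMildSolution.tendsto_source_error (hν : 0 < ν.re)
    (h : IsDampedMildSolution ν θ A u₀ u F) {m : ℕ} (hu₀ : Integrable u₀)
    (hm : Integrable fun x => (((1 + ‖x‖) ^ m : ℝ) : ℂ) * u₀ x) (hθ : 1 + (m : ℝ) / 2 < θ) :
    Tendsto (fun ε : ℝ => ∫⁻ s in Ioi (0 : ℝ),
      (ENNReal.ofReal (√s ^ m * min 1 (|ε| * √s)) * ‖F s‖ₑ +
        ∫⁻ y, ENNReal.ofReal (‖y‖ ^ m * min 1 (|ε| * ‖y‖)) * ‖F s y‖ₑ)) (𝓝 0) (𝓝 0) := by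
  have hm0 : (0 : ℝ) ≤ m := Nat.cast_nonneg m
  have hA := h.pos
  obtain ⟨C, hC, hF⟩ := h.exists_lintegral_weight_F_le hν hu₀ hm hθ
  have hFm : AEMeasurable (fun s => ‖F s‖ₑ) (volume.restrict (Ioi 0)) :=
    (h.continuousOn_F.aestronglyMeasurable measurableSet_Ioi).enorm
  have hint : ∀ K : ℝ, ∫⁻ s in Ioi (0 : ℝ), ENNReal.ofReal (K * (1 + s) ^ ((m : ℝ) / 2 - θ)) ≠ ∞ :=
    fun K => ((integrableOn_one_add_rpow (a := (m : ℝ) / 2 - θ)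
      (by linarith)).const_mul K).lintegral_lt_top.ne
  -- the time part of the weight
  have htime : Tendsto (fun ε : ℝ => ∫⁻ s in Ioi (0 : ℝ),
      ENNReal.ofReal (√s ^ m * min 1 (|ε| * √s)) * ‖F s‖ₑ) (𝓝 0) (𝓝 0) := by
    refine tendsto_lintegral_errorWeight m Real.continuous_sqrt.measurable
      (Eventually.of_forall fun s => Real.sqrt_nonneg s) hFm
      (ne_top_of_le_ne_top (hint (A * A)) ?_) (Eventually.of_forall fun s => enorm_ne_top)
    refine lintegral_mono_ae ((ae_restrict_iff' measurableSet_Ioi).2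
      (Eventually.of_forall fun s (hs : 0 < s) => ?_))
    rw [← ofReal_norm, ← ENNReal.ofReal_mul (by positivity)]
    refine ENNReal.ofReal_le_ofReal ?_
    have h1 : √s ^ m ≤ (1 + s) ^ ((m : ℝ) / 2) := by
      rw [Real.sqrt_eq_rpow, ← Real.rpow_natCast, ← Real.rpow_mul hs.le,
        show 1 / 2 * (m : ℝ) = (m : ℝ) / 2 by ring]
      exact Real.rpow_le_rpow hs.le (by linarith) (by positivity)
    calc _ ≤ (1 + s) ^ ((m : ℝ) / 2) * (A * A * (1 + s) ^ (-θ)) := by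
          gcongr
          exact h.norm_F_L1_le hs
      _ = _ := by rw [sub_eq_add_neg, Real.rpow_add (by linarith)]; ring
  -- the space part of the weight
  have hspace : Tendsto (fun ε : ℝ => ∫⁻ s in Ioi (0 : ℝ),
      ∫⁻ y, ENNReal.ofReal (‖y‖ ^ m * min 1 (|ε| * ‖y‖)) * ‖F s y‖ₑ) (𝓝 0) (𝓝 0) := by
    have hw : ∀ s : ℝ, 0 < s → Integrable fun x => (((1 + ‖x‖) ^ m : ℝ) : ℂ) * F s x :=
      fun s hs => integrable_weight_mul ((hF s hs).trans_lt ENNReal.ofReal_lt_top)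
    have hwm : AEStronglyMeasurable (fun s => weighted m (F s)) (volume.restrict (Ioi 0)) :=
      aestronglyMeasurable_weighted (h.continuousOn_F.aestronglyMeasurable measurableSet_Ioi)
        ((ae_restrict_iff' measurableSet_Ioi).2 (Eventually.of_forall fun s hs => hw s hs))
    have hle : ∀ s : ℝ, ∀ ε : ℝ, ∀ y : E n,
        ENNReal.ofReal (‖y‖ ^ m * min 1 (|ε| * ‖y‖)) * ‖F s y‖ₑ ≤
          ENNReal.ofReal ((1 + ‖y‖) ^ m) * ‖F s y‖ₑ := by
      intro s ε y
      gcongr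
      calc ‖y‖ ^ m * min 1 (|ε| * ‖y‖) ≤ ‖y‖ ^ m :=
            mul_le_of_le_one_right (by positivity) (min_le_left _ _)
        _ ≤ _ := by gcongr; linarith
    have hmeas : ∀ ε : ℝ, AEMeasurable (fun s =>
        ∫⁻ y, ENNReal.ofReal (‖y‖ ^ m * min 1 (|ε| * ‖y‖)) * ‖F s y‖ₑ)
        (volume.restrict (Ioi 0)) := by
      intro ε
      set b : E n → ℂ := fun y => ((‖y‖ ^ m * min 1 (|ε| * ‖y‖) : ℝ) : ℂ) with hb
      have hbn : ∀ y, ‖b y‖ = ‖y‖ ^ m * min 1 (|ε| * ‖y‖) := fun y => by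
        rw [hb, Complex.norm_real, Real.norm_of_nonneg (by positivity)]
      have hbm : Measurable b :=
        (Complex.continuous_ofReal.comp (f := fun y : E n => ‖y‖ ^ m * min 1 (|ε| * ‖y‖))
          (by fun_prop)).measurable
      have hbw : ∀ y, ‖b y‖ ≤ (1 + ‖y‖) ^ m := fun y => by
        rw [hbn]
        calc ‖y‖ ^ m * min 1 (|ε| * ‖y‖) ≤ ‖y‖ ^ m :=
              mul_le_of_le_one_right (by positivity) (min_le_left _ _)
          _ ≤ _ := by gcongr; linarith
      have h1 := ((mulL _ 1 (measurable_div_weight hbm m)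
        (norm_div_weight_le hbw)).continuous.comp_aestronglyMeasurable hwm).enorm
      refine h1.congr ((ae_restrict_iff' measurableSet_Ioi).2
        (Eventually.of_forall fun s hs => ?_))
      simp only
      rw [enorm_mulL]
      refine lintegral_congr_ae ((div_weight_mul_weighted (hw s hs) b).mono fun y hy => ?_)
      simp only at hy ⊢
      rw [← enorm_mul, hy, enorm_mul, ← ofReal_norm (b y), hbn]
    refine tendsto_of_seq_tendsto fun ε hε => ?_
    have := tendsto_lintegral_of_dominated_convergence' (μ := volume.restrict (Ioi (0 : ℝ)))
      (F := fun (k : ℕ) s => ∫⁻ y, ENNReal.ofReal (‖y‖ ^ m * min 1 (|ε k| * ‖y‖)) * ‖F s y‖ₑ)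
      (f := fun _ => 0) (fun s => ENNReal.ofReal (C * (1 + s) ^ ((m : ℝ) / 2 - θ)))
      (fun k => hmeas (ε k))
      (fun k => (ae_restrict_iff' measurableSet_Ioi).2 (Eventually.of_forall fun s hs =>
        (lintegral_mono (hle s (ε k))).trans (hF s hs)))
      (hint C)
      ((ae_restrict_iff' measurableSet_Ioi).2 (Eventually.of_forall fun s hs =>
        (tendsto_lintegral_errorWeight m measurable_norm
          (Eventually.of_forall fun y => norm_nonneg y) (Lp.aestronglyMeasurable (F s)).enorm
          (ne_top_of_le_ne_top ((hF s hs).trans_lt ENNReal.ofReal_lt_top).ne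
            (lintegral_mono fun y => by gcongr; linarith))
          (Eventually.of_forall fun y => enorm_ne_top)).comp hε))
    simpa [Function.comp_def] using this
  have hadd := htime.add hspace
  rw [add_zero] at hadd
  refine hadd.congr fun ε => (lintegral_add_left' (AEMeasurable.mul ?_ hFm) _).symm
  exact (Continuous.measurable (by fun_prop)).ennreal_ofReal.aemeasurable

end DampedSolution

/-! ### The expansion -/

section DampedSolution

variable {ν : ℂ} {θ A : ℝ} {u₀ : E n → ℂ} {u F : ℝ → L1 n}

/-- The asymptotic profile of a mild solution with datum `u₀` and source `F`. -/
def sourceProfile (ν : ℂ) (u₀ : E n → ℂ) (F : ℝ → L1 n) (m : ℕ) (t : ℝ) (x : E n) : ℂ :=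
  Lam ν 0 m t u₀ x + ∑ γ ∈ indicesHalf n m, (-ν) ^ length γ / (multiFactorial γ : ℂ) *
    Lam ν (fun j => 2 * γ j) (m - 2 * length γ) t
      (∫ s in Ioi (0 : ℝ), ((s : ℂ) ^ length γ) • F s : L1 n) x

theorem integrable_sourceProfile (hν : 0 < ν.re) (u₀ : E n → ℂ) (F : ℝ → L1 n) (m : ℕ) {t : ℝ}
    (ht : 0 < t) : Integrable (sourceProfile ν u₀ F m t) :=
  (toL1_Lam hν 0 m ht u₀).1.add
    (integrable_finsetSum _ fun _ _ => (toL1_Lam hν _ _ ht _).1.const_mul _)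

/-- The remainder kernel applied to a function in `L¹_m`, as an element of `L¹`. -/
theorem toL1_kerOp_remKer (hν : 0 < ν.re) {m : ℕ} {t : ℝ} (ht : 0 < t) (s : ℝ) {v : L1 n}
    (hv : MemWeightedL1 m v) :
    Integrable (kerOp (remKer ν m t s) v) ∧
    toL1 (kerOp (remKer ν m t s) v) =
      (if s < t / 2 then toL1 (semigroup ν (t - s) v) else 0) -
        ∑ γ ∈ indicesHalf n m, ((-ν) ^ length γ / (multiFactorial γ : ℂ)) •
          toL1 (Lam ν (fun j => 2 * γ j) (m - 2 * length γ) t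
            (((s : ℂ) ^ length γ) • v : L1 n)) := by
  have hfun : kerOp (remKer ν m t s) v = fun x =>
      (if s < t / 2 then semigroup ν (t - s) v x else 0) -
        ∑ γ ∈ indicesHalf n m, (-ν) ^ length γ / (multiFactorial γ : ℂ) *
          Lam ν (fun j => 2 * γ j) (m - 2 * length γ) t (((s : ℂ) ^ length γ) • v : L1 n) x := by
    ext x
    rw [kerOp_remKer_eq hν ht s hv x]
    simp only [Lam_smul, mul_assoc]
  have h1 : Integrable fun x => if s < t / 2 then semigroup ν (t - s) v x else 0 := by
    split_ifs with hs
    · exact integrable_semigroup hν (by linarith) (integrable_coe v)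
    · exact integrable_zero _ _ _
  have h2 : ∀ γ ∈ indicesHalf n m, Integrable fun x =>
      (-ν) ^ length γ / (multiFactorial γ : ℂ) *
        Lam ν (fun j => 2 * γ j) (m - 2 * length γ) t (((s : ℂ) ^ length γ) • v : L1 n) x :=
    fun γ _ => (toL1_Lam hν _ _ ht _).1.const_mul _
  have h3 := integrable_finsetSum _ h2
  rw [hfun]
  refine ⟨h1.sub h3, ?_⟩
  rw [toL1_sub h1 h3, toL1_sum _ h2]
  congr 1
  · split_ifs
    · rfl
    · exact toL1_zero
  · exact Finset.sum_congr rfl fun γ _ => toL1_smul _ (toL1_Lam hν _ _ ht _).1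

/-- Exact remainder formula: the difference between the solution and its profile consists of the
remainder kernels applied to the datum and to the source, and the recent Duhamel integral. -/
theorem IsDampedMildSolution.eq_profile_add (hν : 0 < ν.re)
    (h : IsDampedMildSolution ν θ A u₀ u F) (hn : 0 < n) {m : ℕ} (hu₀ : MemWeightedL1 m u₀)
    (hθ : 1 + (m : ℝ) / 2 < θ) (hF : ∀ s : ℝ, 0 < s → MemWeightedL1 m (F s)) {t : ℝ}
    (ht : 0 < t) :
    IntegrableOn (fun s => toL1 (kerOp (remKer ν m t s) (F s))) (Ioi 0) ∧
    u t = toL1 (sourceProfile ν u₀ F m t) + (toL1 (kerOp (remKer ν m t 0) u₀) +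
      (∫ s in Ioi (0 : ℝ), toL1 (kerOp (remKer ν m t s) (F s))) +
      ∫ s in Ioc (t / 2) t, toL1 (semigroup ν (t - s) (F s))) := by
  have hm0 : (0 : ℝ) ≤ m := Nat.cast_nonneg m
  set H : ℝ → L1 n := fun s => toL1 (semigroup ν (t - s) (F s)) with hH
  have hHi : IntegrableOn H (Ioc 0 t) := h.integrableOn_duhamel hν (by linarith) t
  -- the source terms of the profile
  set P : (Fin n → ℕ) → ℝ → L1 n := fun γ s =>
    ((-ν) ^ length γ / (multiFactorial γ : ℂ)) •
      toL1 (Lam ν (fun j => 2 * γ j) (m - 2 * length γ) t (((s : ℂ) ^ length γ) • F s : L1 n))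
    with hP
  have hPint : ∀ γ ∈ indicesHalf n m, IntegrableOn (P γ) (Ioi 0) ∧
      ∫ s in Ioi (0 : ℝ), P γ s = ((-ν) ^ length γ / (multiFactorial γ : ℂ)) •
        toL1 (Lam ν (fun j => 2 * γ j) (m - 2 * length γ) t
          (∫ s in Ioi (0 : ℝ), ((s : ℂ) ^ length γ) • F s : L1 n)) := by
    intro γ hγ
    obtain ⟨-, -, h3⟩ := h.time_moment hν hn hu₀ hθ (mem_indicesHalf.1 hγ)
    obtain ⟨h4, h5⟩ := integral_Lam hν (fun j => 2 * γ j) ht h3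
    refine ⟨h4.smul ((-ν) ^ length γ / (multiFactorial γ : ℂ)), ?_⟩
    rw [hP]
    simp only
    rw [integral_smul, h5]
  have hsumint := integrable_finsetSum _ fun γ hγ => (hPint γ hγ).1
  have hcut : IntegrableOn ((Iio (t / 2)).indicator H) (Ioi 0) := by
    refine (integrable_indicator_iff measurableSet_Iio).2 ?_
    rw [IntegrableOn, Measure.restrict_restrict measurableSet_Iio]
    exact hHi.mono_set fun s hs => ⟨hs.2, by linarith [hs.1.out]⟩
  have hQ : ∀ s ∈ Ioi (0 : ℝ), (Iio (t / 2)).indicator H s - ∑ γ ∈ indicesHalf n m, P γ s =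
      toL1 (kerOp (remKer ν m t s) (F s)) := by
    intro s hs
    rw [(toL1_kerOp_remKer hν ht s (hF s hs)).2]
    simp only [indicator, mem_Iio, hH, hP]
  have hQint : IntegrableOn (fun s => toL1 (kerOp (remKer ν m t s) (F s))) (Ioi 0) :=
    IntegrableOn.congr_fun (hcut.sub hsumint) hQ measurableSet_Ioi
  refine ⟨hQint, ?_⟩
  have hQval : ∫ s in Ioi (0 : ℝ), toL1 (kerOp (remKer ν m t s) (F s)) =
      (∫ s in Ioc 0 (t / 2), H s) - ∑ γ ∈ indicesHalf n m,
        ((-ν) ^ length γ / (multiFactorial γ : ℂ)) •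
        toL1 (Lam ν (fun j => 2 * γ j) (m - 2 * length γ) t
          (∫ s in Ioi (0 : ℝ), ((s : ℂ) ^ length γ) • F s : L1 n)) := by
    rw [← setIntegral_congr_fun measurableSet_Ioi hQ, integral_sub hcut hsumint,
      setIntegral_indicator measurableSet_Iio, Ioi_inter_Iio, ← integral_Ioc_eq_integral_Ioo,
      integral_finsetSum _ fun γ hγ => (hPint γ hγ).1]
    congr 1
    exact Finset.sum_congr rfl fun γ hγ => (hPint γ hγ).2
  have hsplit : ∫ s in (0 : ℝ)..t, H s = (∫ s in Ioc 0 (t / 2), H s) +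
      ∫ s in Ioc (t / 2) t, H s := by
    rw [intervalIntegral.integral_of_le ht.le, ← setIntegral_union (Ioc_disjoint_Ioc_of_le le_rfl)
      measurableSet_Ioc (hHi.mono_set (Ioc_subset_Ioc_right (by linarith)))
      (hHi.mono_set (Ioc_subset_Ioc_left (by linarith))),
      Ioc_union_Ioc_eq_Ioc (by linarith) (by linarith)]
  have hdatum : toL1 (kerOp (remKer ν m t 0) u₀) =
      toL1 (semigroup ν t u₀) - toL1 (Lam ν 0 m t u₀) := by
    rw [← toL1_sub (integrable_semigroup hν ht hu₀.1) (toL1_Lam hν 0 m ht u₀).1]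
    congr 1
    ext x
    exact kerOp_remKer_zero hν ht hu₀ x
  have hprof : toL1 (sourceProfile ν u₀ F m t) = toL1 (Lam ν 0 m t u₀) +
      ∑ γ ∈ indicesHalf n m, ((-ν) ^ length γ / (multiFactorial γ : ℂ)) •
        toL1 (Lam ν (fun j => 2 * γ j) (m - 2 * length γ) t
          (∫ s in Ioi (0 : ℝ), ((s : ℂ) ^ length γ) • F s : L1 n)) := by
    have h2 : ∀ γ ∈ indicesHalf n m, Integrable fun x =>
        (-ν) ^ length γ / (multiFactorial γ : ℂ) *
          Lam ν (fun j => 2 * γ j) (m - 2 * length γ) t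
            (∫ s in Ioi (0 : ℝ), ((s : ℂ) ^ length γ) • F s : L1 n) x :=
      fun γ _ => (toL1_Lam hν _ _ ht _).1.const_mul _
    have h4 := toL1_add (toL1_Lam hν 0 m ht u₀).1 (integrable_finsetSum _ h2)
    rw [toL1_sum _ h2] at h4
    refine h4.trans ?_
    congr 1
    exact Finset.sum_congr rfl fun γ _ => toL1_smul _ (toL1_Lam hν _ _ ht _).1
  rw [h.integral_eq t ht, hsplit, hQval, hdatum, hprof]
  abel

/-- The asymptotic expansion in the parabolically scaled norm. -/
theorem IsDampedMildSolution.tendsto_expansion (hν : 0 < ν.re)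
    (h : IsDampedMildSolution ν θ A u₀ u F) (hn : 0 < n) {m : ℕ} (hu₀ : MemWeightedL1 m u₀)
    (hθ : 1 + (m : ℝ) / 2 < θ) :
    Tendsto (fun t : ℝ => ENNReal.ofReal (t ^ ((m : ℝ) / 2)) *
      scaledNorm t (fun x => u t x - sourceProfile ν u₀ F m t x)) atTop (𝓝 0) := by
  have hw := hu₀.integrable_weight hn le_rfl
  obtain ⟨B, hB0, hB⟩ := exists_scaledNorm_remKer_le (n := n) hν m
  obtain ⟨C, hC, hFw⟩ := h.exists_lintegral_weight_F_le hν hu₀.1 hw hθ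
  have hF : ∀ s : ℝ, 0 < s → MemWeightedL1 m (F s) := fun s hs =>
    memWeightedL1_of_integrable_weight (integrable_coe _)
      (integrable_weight_mul ((hFw s hs).trans_lt ENNReal.ofReal_lt_top))
  set D₀ : ℝ → ℝ≥0∞ := fun ε =>
    ∫⁻ y, ENNReal.ofReal (‖y‖ ^ m * min 1 (|ε| * ‖y‖)) * ‖u₀ y‖ₑ with hD₀
  set D₁ : ℝ → ℝ≥0∞ := fun ε => ∫⁻ s in Ioi (0 : ℝ),
      (ENNReal.ofReal (√s ^ m * min 1 (|ε| * √s)) * ‖F s‖ₑ +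
        ∫⁻ y, ENNReal.ofReal (‖y‖ ^ m * min 1 (|ε| * ‖y‖)) * ‖F s y‖ₑ) with hD₁
  have hD₀lim : Tendsto D₀ (𝓝 0) (𝓝 0) := by
    refine tendsto_lintegral_errorWeight m measurable_norm
      (Eventually.of_forall fun y => norm_nonneg y) hu₀.1.1.enorm ?_
      (Eventually.of_forall fun y => enorm_ne_top)
    refine ne_top_of_le_ne_top hw.2.ne (lintegral_mono fun y => ?_)
    simp only
    rw [enorm_mul, enorm_weight]
    gcongr
    linarith
  have hD₁lim : Tendsto D₁ (𝓝 0) (𝓝 0) := h.tendsto_source_error hν hu₀.1 hw hθ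
  have hε : Tendsto (fun t : ℝ => t ^ (-(1 / 2) : ℝ)) atTop (𝓝 0) :=
    tendsto_rpow_neg_atTop (by norm_num)
  have hlim : Tendsto (fun t : ℝ => ENNReal.ofReal B * D₀ (t ^ (-(1 / 2) : ℝ)) +
      ENNReal.ofReal B * D₁ (t ^ (-(1 / 2) : ℝ)) +
      ENNReal.ofReal (t ^ ((m : ℝ) / 2)) *
        scaledNorm t (∫ s in Ioc (t / 2) t, toL1 (semigroup ν (t - s) (F s)) : L1 n))
      atTop (𝓝 0) := by
    have h1 := ENNReal.Tendsto.const_mul (hD₀lim.comp hε)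
      (Or.inr (ENNReal.ofReal_ne_top (r := B)))
    have h2 := ENNReal.Tendsto.const_mul (hD₁lim.comp hε)
      (Or.inr (ENNReal.ofReal_ne_top (r := B)))
    simpa using (h1.add h2).add (h.tendsto_recent hν hθ)
  refine tendsto_of_tendsto_of_tendsto_of_le_of_le' tendsto_const_nhds hlim
    (Eventually.of_forall fun _ => bot_le) ?_
  filter_upwards [eventually_gt_atTop 0] with t ht
  obtain ⟨hQ, hu⟩ := h.eq_profile_add hν hn hu₀ hθ hF ht
  set ε := t ^ (-(1 / 2) : ℝ) with hεdef
  have hε0 : 0 ≤ ε := by positivity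
  have hr : ENNReal.ofReal (t ^ ((m : ℝ) / 2)) ≠ ∞ := ENNReal.ofReal_ne_top
  -- the datum
  have hi0 : Integrable (kerOp (remKer ν m t 0) u₀) := by
    refine ((integrable_semigroup hν ht hu₀.1).sub (toL1_Lam hν 0 m ht u₀).1).congr
      (Eventually.of_forall fun x => ?_)
    exact (kerOp_remKer_zero hν ht hu₀ x).symm
  have hterm0 : ENNReal.ofReal (t ^ ((m : ℝ) / 2)) *
      scaledNorm t (toL1 (kerOp (remKer ν m t 0) u₀)) ≤ ENNReal.ofReal B * D₀ ε := by
    rw [scaledNorm_congr (coeFn_toL1 hi0)]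
    refine (hB t 0 u₀ ht le_rfl hu₀.1.1).trans ?_
    rw [hD₀, ← lintegral_const_mul' _ _ ENNReal.ofReal_ne_top]
    refine lintegral_mono fun y => ?_
    simp only
    rw [← mul_assoc, ← ENNReal.ofReal_mul hB0, abs_of_nonneg hε0]
    gcongr
    simp [hεdef]
  -- the source
  have hterm1 : ENNReal.ofReal (t ^ ((m : ℝ) / 2)) *
      scaledNorm t (∫ s in Ioi (0 : ℝ), toL1 (kerOp (remKer ν m t s) (F s)) : L1 n) ≤
        ENNReal.ofReal B * D₁ ε := by
    refine (mul_le_mul_right (scaledNorm_integral_le t hQ (Eventually.of_forall fun s => le_rfl))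
      _).trans ?_
    rw [← lintegral_const_mul' _ _ hr, hD₁, ← lintegral_const_mul' _ _ ENNReal.ofReal_ne_top]
    refine lintegral_mono_ae ((ae_restrict_iff' measurableSet_Ioi).2
      (Eventually.of_forall fun s (hs : 0 < s) => ?_))
    rw [scaledNorm_congr (coeFn_toL1 (toL1_kerOp_remKer hν ht s (hF s hs)).1)]
    refine (hB t s (F s) ht hs.le (Lp.aestronglyMeasurable _)).trans (le_of_eq ?_)
    rw [enorm_eq_lintegral, ← lintegral_const_mul' _ _ ENNReal.ofReal_ne_top,
      ← lintegral_add_left' ((Lp.aestronglyMeasurable (F s)).enorm.const_mul _),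
      ← lintegral_const_mul' _ _ ENNReal.ofReal_ne_top]
    refine lintegral_congr fun y => ?_
    rw [← add_mul, ← mul_assoc, abs_of_nonneg hε0,
      ← ENNReal.ofReal_add (by positivity) (by positivity), ← ENNReal.ofReal_mul hB0]
  -- sum of the three contributions
  have hae : (fun x => u t x - sourceProfile ν u₀ F m t x) =ᵐ[volume] fun x =>
      (toL1 (kerOp (remKer ν m t 0) u₀) x +
        (∫ s in Ioi (0 : ℝ), toL1 (kerOp (remKer ν m t s) (F s)) : L1 n) x) +
      (∫ s in Ioc (t / 2) t, toL1 (semigroup ν (t - s) (F s)) : L1 n) x := by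
    rw [hu]
    filter_upwards [coeFn_toL1 (integrable_sourceProfile hν u₀ F m ht),
      Lp.coeFn_add (toL1 (sourceProfile ν u₀ F m t)) (toL1 (kerOp (remKer ν m t 0) u₀) +
      (∫ s in Ioi (0 : ℝ), toL1 (kerOp (remKer ν m t s) (F s))) +
      ∫ s in Ioc (t / 2) t, toL1 (semigroup ν (t - s) (F s))),
      Lp.coeFn_add (toL1 (kerOp (remKer ν m t 0) u₀) +
      (∫ s in Ioi (0 : ℝ), toL1 (kerOp (remKer ν m t s) (F s))))
      (∫ s in Ioc (t / 2) t, toL1 (semigroup ν (t - s) (F s))),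
      Lp.coeFn_add (toL1 (kerOp (remKer ν m t 0) u₀))
      (∫ s in Ioi (0 : ℝ), toL1 (kerOp (remKer ν m t s) (F s)))] with x h1 h2 h3 h4
    rw [h2, Pi.add_apply, h3, Pi.add_apply, h4, Pi.add_apply, h1]
    ring
  rw [scaledNorm_congr hae]
  refine (mul_le_mul_right ((scaledNorm_add_le t
    ((Lp.aestronglyMeasurable _).add (Lp.aestronglyMeasurable _))
    (Lp.aestronglyMeasurable _)).trans (add_le_add_left (scaledNorm_add_le t
      (Lp.aestronglyMeasurable _) (Lp.aestronglyMeasurable _)) _)) _).trans ?_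
  rw [mul_add, mul_add]
  gcongr

end DampedSolution

end CGL

end

theorem theorem1p3 {n : ℕ} (hn : 0 < n) (m : ℕ) {ν : ℂ} (hν : 0 < ν.re)
    {p : ℝ} (hp : 1 + ((m : ℝ) + 2) / (n : ℝ) < p)
    {f : ℂ → ℂ} (hf : CGL.IsPowerNonlinearity p f)
    {u₀ : CGL.E n → ℂ} (hu₀ : CGL.MemWeightedL1 m u₀) (hu₀_top : MemLp u₀ ∞ volume)
    {u : ℝ → CGL.L1 n} (hu : CGL.IsGlobalSolution ν f u₀ u) (hdecay : CGL.Decays u) :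
    -- the profile is well defined: the integrals and moments that occur in it converge
    (∀ k : ℕ, 2 * k ≤ m →
      IntegrableOn (CGL.psiIntegrand f u k) (Ioi 0) volume ∧
      CGL.MemWeightedL1 (m - 2 * k) (CGL.psi f u k)) ∧
    -- the asymptotic expansion
    ∀ q : ℝ≥0∞, 1 ≤ q →
      Tendsto
        (fun t : ℝ => ENNReal.ofReal (t ^ (CGL.decayExponent n q + (m : ℝ) / 2)) *
          eLpNorm (fun x => u t x - CGL.profile ν f u₀ u m t x) q volume)
        atTop (𝓝 0) := by
  have hn0 : (0 : ℝ) < n := Nat.cast_pos.2 hn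
  have hm0 : (0 : ℝ) ≤ m := Nat.cast_nonneg m
  have hp1 : 1 < p := lt_of_le_of_lt (le_add_of_nonneg_right (by positivity)) hp
  have hθ : 1 + (m : ℝ) / 2 < (n : ℝ) / 2 * (p - 1) := by
    have h1 : ((m : ℝ) + 2) / n < p - 1 := by linarith
    rw [div_lt_iff₀ hn0] at h1
    linarith
  obtain ⟨A, hA⟩ := hu.exists_isDamped hp1 hf hdecay
  have hint : ∀ k : ℕ, CGL.psiIntegrand f u k =
      fun s : ℝ => ((s : ℂ) ^ k) • CGL.nonlin f (u s) := by
    intro k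
    ext1 s
    rw [CGL.psiIntegrand, ← Complex.ofReal_pow]
    exact RCLike.real_smul_eq_coe_smul (K := ℂ) _ _
  have hpsi : ∀ k : ℕ, CGL.psi f u k = ∫ s in Ioi (0 : ℝ), ((s : ℂ) ^ k) • CGL.nonlin f (u s) := by
    intro k
    rw [CGL.psi, hint]
  refine ⟨fun k hk => ?_, fun q hq => ?_⟩
  · obtain ⟨h1, h2, -⟩ := hA.time_moment hν hn hu₀ hθ hk
    rw [hint, hpsi]
    exact ⟨h1, h2⟩
  · have hprof : ∀ t : ℝ, CGL.profile ν f u₀ u m t =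
        CGL.sourceProfile ν u₀ (fun s => CGL.nonlin f (u s)) m t := by
      intro t
      ext x
      simp only [CGL.profile, CGL.sourceProfile, hpsi]
    refine tendsto_of_tendsto_of_tendsto_of_le_of_le' tendsto_const_nhds
      (hA.tendsto_expansion hν hn hu₀ hθ) (Eventually.of_forall fun _ => bot_le) ?_
    filter_upwards [eventually_gt_atTop 0] with t ht
    simp only [hprof]
    have hmeas : AEStronglyMeasurable (fun x => u t x -
        CGL.sourceProfile ν u₀ (fun s => CGL.nonlin f (u s)) m t x) volume :=
      (Lp.aestronglyMeasurable _).sub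
        (CGL.integrable_sourceProfile hν u₀ (fun s => CGL.nonlin f (u s)) m ht).1
    rw [add_comm, Real.rpow_add ht, ENNReal.ofReal_mul (by positivity), mul_assoc]
    gcongr
    exact CGL.decayExponent_mul_eLpNorm_le ht hmeas hq
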